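/- **Setting.** A tabular vector-valued Markov game (VMG) $\mathcal G=(\mathcal S,\mathcal A,\mathcal B,H,\mathbb P,\mathbf r)$ has finite state space $|\mathcal S|\le S$, finite action sets $|\mathcal A|\le A$ (min-player) and $|\mathcal B|\le B$ (max-player), horizon $H$, a fixed initial state $s_1$, unknown transition probabilities $\mathbb P_h(\cdot\mid s,a,b)$ and unknown mean returns $\mathbf r_h(s,a,b)$ in the closed Euclidean unit ball of $\mathbb R^d$, $d\ge1$. In an episode the two players take actions $a_h,b_h$ in state $s_h$, for $h=1,\dots,H$; given the past, $s_{h+1}\sim\mathbb P_h(\cdot\mid s_h,a_h,b_h)$, and a random return vector with conditional mean $\mathbf r_h(s_h,a_h,b_h)$ is generated, which lies in the unit ball almost surely. For $\|\theta\|\le 1$ and Markov policies $\mu=(\mu_h:\mathcal S\to\Delta(\mathcal A))$, $\nu=(\nu_h:\mathcal S\to\Delta(\mathcal B))$, let $V_h^{\mu,\nu}(s;\theta)$ be the value function of the scalar game $\mathcal G_\theta$ with rewards $\langle\theta,\mathbf r_h\rangle$, and let $V_h^{\mu,\dagger}=\max_{\nu'}V_h^{\mu,\nu'}$, $V_h^{\dagger,\nu}=\min_{\mu'}V_h^{\mu',\nu}$.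 **Algorithm (VI-Zero, $K$ episodes, bonus $\beta_t$).** Let $N^k_h(s,a,b)$ and $N^k_h(s,a,b,s')$ count the visits and transitions in step $h$ of the episodes before episode $k$, and let $\widehat{\mathbb P}^k_h$, $\widehat{\mathbf r}^k_h$ be the corresponding empirical frequencies and empirical means of the sampled returns. Set $\widetilde V^k_{H+1}=0$ and, for $h=H,\dots,1$, $$\widetilde Q^k_h(s,a,b)=\begin{cases}\min\{[\widehat{\mathbb P}^k_h\widetilde V^k_{h+1}](s,a,b)+\beta_{N^k_h(s,a,b)},\,H\} & \text{if } N^k_h(s,a,b)>0,\\ H & \text{otherwise,}\end{cases}\qquad \widetilde V^k_h(s)=\max_{a,b}\widetilde Q^k_h(s,a,b).$$ In episode $k$ both players follow the joint policy $\pi^k_h(s)\in\arg\max_{a,b}\widetilde Q^k_h(s,a,b)$ (ties broken by any fixed rule); no return is used. Let $\mathrm{out}\in\arg\min_{1\le k\le K}\widetilde V^k_1(s_1)$. In the planning phase the sampled returns are revealed, and for a query $\theta$ the output $(\mu_\theta,\nu_\theta)$ is an output of Nash value iteration, or any other Nash equilibrium (for all steps and states), for the empirical game $\widehat{\mathcal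 G}^{\mathrm{out}}_\theta$ with transitions $\widehat{\mathbb P}^{\mathrm{out}}$ and rewards $\langle\theta,\widehat{\mathbf r}^{\mathrm{out}}\rangle$; at triples without a visit the transition probabilities, and the returns in the unit ball, of the empirical game may be chosen arbitrarily. **Theorem.** There are absolute constants $c_\beta,c_K>0$ such that for all positive integers $d,H,S,A,B$ and all $\varepsilon\in(0,H]$, $\delta\in(0,1]$ the following holds. Put $$\iota=\log\frac{dSABKH}{\delta},\qquad \beta_t=c_\beta\Big(\sqrt{\frac{\min\{d,S\}H^2\iota}{t}}+\frac{H^2S\iota}{t}\Big),\qquad \iota'=\log\frac{dSABH}{\min\{\varepsilon,1\}\,\delta}.$$ If $$K\ \ge\ c_K\Big(\frac{\min\{d,S\}H^4SAB\,\iota'}{\varepsilon^2}+\frac{H^3S^2AB\,(\iota')^2}{\varepsilon}\Big),$$ then for every such VMG, with probability at least $1-\delta$, simultaneously for all $\|\theta\|\le 1$, the planning phase has an output and every output $(\mu_\theta,\nu_\theta)$ satisfies $$V_1^{\mu_\theta,\dagger}(s_1;\theta)-V_1^{\dagger,\nu_\theta}(s_1;\theta)\le\varepsilon .$$ Hence the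 algorithm is a reward-free algorithm for tabular VMGs: some number of episodes $m_{\mathrm{RFE}}(\varepsilon,\delta)\le\big\lceil c_K\big(\min\{d,S\}H^4SAB\,\iota'/\varepsilon^2+H^3S^2AB\,(\iota')^2/\varepsilon\big)\big\rceil$, not depending on the game, suffices. -/

import Mathlib

open MeasureTheory

universe u v w z

/-- A Markov policy of one player over `H` steps: a mixed action for every step and state. -/
abbrev Policy (H : ℕ) (𝒮 𝒜 : Type*) [Fintype 𝒜] : Type _ :=
  Fin H → 𝒮 → stdSimplex ℝ 𝒜

/-- A tabular vector-valued Markov game with `H` steps and `d`-dimensional returns. Step `h` of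
the text, `1 ≤ h ≤ H`, is the element `h - 1` of `Fin H`. The first action belongs to the
min-player, the second one to the max-player; `ret` is the mean return. -/
structure VMG (d H : ℕ) (𝒮 𝒜 ℬ : Type*) [Fintype 𝒮] where
  trans : Fin H → 𝒮 → 𝒜 → ℬ → stdSimplex ℝ 𝒮
  ret : Fin H → 𝒮 → 𝒜 → ℬ → EuclideanSpace ℝ (Fin d)
  norm_ret_le : ∀ h s a b, ‖ret h s a b‖ ≤ 1

/-- The expected payoff of a matrix game under mixed actions `x` (min-player), `y` (max-player). -/
noncomputable def matrixPayoff {𝒜 ℬ : Type*} [Fintype 𝒜] [Fintype ℬ]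
    (M : 𝒜 → ℬ → ℝ) (x : stdSimplex ℝ 𝒜) (y : stdSimplex ℝ ℬ) : ℝ :=
  ∑ a, ∑ b, x.1 a * y.1 b * M a b

/-- `(x, y)` is a Nash equilibrium of the zero-sum matrix game `M`, rows minimizing. -/
def IsMatrixNash {𝒜 ℬ : Type*} [Fintype 𝒜] [Fintype ℬ]
    (M : 𝒜 → ℬ → ℝ) (x : stdSimplex ℝ 𝒜) (y : stdSimplex ℝ ℬ) : Prop :=
  (∀ x', matrixPayoff M x y ≤ matrixPayoff M x' y) ∧
  (∀ y', matrixPayoff M x y' ≤ matrixPayoff M x y)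

namespace VMG

variable {d H : ℕ} {𝒮 𝒜 ℬ : Type*} [Fintype 𝒮] [Fintype 𝒜] [Fintype ℬ]

/-- One step of look-ahead in the game scalarized by `θ`: the expected immediate scalar return
plus the expectation of `V` at the next state. -/
noncomputable def lookahead (G : VMG d H 𝒮 𝒜 ℬ) (θ : EuclideanSpace ℝ (Fin d)) (h : Fin H)
    (V : 𝒮 → ℝ) (s : 𝒮) (a : 𝒜) (b : ℬ) : ℝ :=
  inner ℝ θ (G.ret h s a b) + ∑ s', (G.trans h s a b).1 s' * V s'

/-- The value function of `(μ, ν)` in the game scalarized by `θ`: the expected sum of the scalar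
returns from step `h` on, started at `s`, evaluated backwards from the value `0` after the last
step. The index runs over the `H` steps and the end of the episode. -/
noncomputable def value (G : VMG d H 𝒮 𝒜 ℬ) (θ : EuclideanSpace ℝ (Fin d))
    (μ : Policy H 𝒮 𝒜) (ν : Policy H 𝒮 ℬ) : Fin (H + 1) → 𝒮 → ℝ :=
  Fin.reverseInduction (motive := fun _ => 𝒮 → ℝ) (fun _ => 0)
    (fun h V s => matrixPayoff (G.lookahead θ h V s) (μ h s) (ν h s))

/-- The Q-value function of `(μ, ν)` in the game scalarized by `θ`. -/
noncomputable def qValue (G : VMG d H 𝒮 𝒜 ℬ) (θ : EuclideanSpace ℝ (Fin d))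
    (μ : Policy H 𝒮 𝒜) (ν : Policy H 𝒮 ℬ) (h : Fin H) : 𝒮 → 𝒜 → ℬ → ℝ :=
  G.lookahead θ h (G.value θ μ ν h.succ)

/-- The value of `μ` against a best response of the max-player. The supremum is over a nonempty
set (if there is an action) of numbers in `[-H ‖θ‖, H ‖θ‖]`. -/
noncomputable def valueVsBestMax (G : VMG d H 𝒮 𝒜 ℬ) (θ : EuclideanSpace ℝ (Fin d))
    (μ : Policy H 𝒮 𝒜) (h : Fin (H + 1)) (s : 𝒮) : ℝ :=
  ⨆ ν : Policy H 𝒮 ℬ, G.value θ μ ν h s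

/-- The value of `ν` against a best response of the min-player. -/
noncomputable def valueVsBestMin (G : VMG d H 𝒮 𝒜 ℬ) (θ : EuclideanSpace ℝ (Fin d))
    (ν : Policy H 𝒮 ℬ) (h : Fin (H + 1)) (s : 𝒮) : ℝ :=
  ⨅ μ : Policy H 𝒮 𝒜, G.value θ μ ν h s

/-- The duality gap of `(μ, ν)` at the initial state in the game scalarized by `θ`. -/
noncomputable def dualityGap (G : VMG d H 𝒮 𝒜 ℬ) (s₁ : 𝒮) (θ : EuclideanSpace ℝ (Fin d))
    (μ : Policy H 𝒮 𝒜) (ν : Policy H 𝒮 ℬ) : ℝ :=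
  G.valueVsBestMax θ μ 0 s₁ - G.valueVsBestMin θ ν 0 s₁

/-- Nash equilibrium of the game scalarized by `θ`: from no step and no state on can a player gain
by changing the own policy. -/
def IsNash (G : VMG d H 𝒮 𝒜 ℬ) (θ : EuclideanSpace ℝ (Fin d))
    (μ : Policy H 𝒮 𝒜) (ν : Policy H 𝒮 ℬ) : Prop :=
  ∀ h s, (∀ μ', G.value θ μ ν h s ≤ G.value θ μ' ν h s) ∧
    (∀ ν', G.value θ μ ν' h s ≤ G.value θ μ ν h s)

/-- `(μ, ν)` is a possible output of Nash value iteration on the game scalarized by `θ`: going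
backwards from `h = H`, with `Q_h = r_h + P_h V_{h+1}`, the pair `(μ_h(s), ν_h(s))` is some Nash
equilibrium of the matrix game `Q_h(s, ·, ·)`, and `V_h(s)` is the payoff under this pair.
As the `V_h` computed like this is the value function of `(μ, ν)`, it is written so. -/
def IsNashVIOutput (G : VMG d H 𝒮 𝒜 ℬ) (θ : EuclideanSpace ℝ (Fin d))
    (μ : Policy H 𝒮 𝒜) (ν : Policy H 𝒮 ℬ) : Prop :=
  ∀ h s, IsMatrixNash (G.qValue θ μ ν h s) (μ h s) (ν h s)

end VMG

/-- What is observed in one episode of exploration: the states `s_1, …, s_{H+1}` and the joint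
actions of the `H` steps, but no returns. -/
structure Episode (H : ℕ) (𝒮 𝒜 ℬ : Type*) where
  state : Fin (H + 1) → 𝒮
  act : Fin H → 𝒜 × ℬ

/-- An algorithm with an exploration phase of `K` episodes, in which it controls both players.
Before each episode, `explore` chooses a (deterministic) joint policy from the states and actions
of the past episodes, without the returns. After the last episode the sampled returns
are revealed too, and `plan` is the set of its possible outputs for the query `θ`. -/
structure ExplorePlan (K d H : ℕ) (𝒮 𝒜 ℬ : Type*) [Fintype 𝒜] [Fintype ℬ] where
  explore : (k : ℕ) → (Fin k → Episode H 𝒮 𝒜 ℬ) → Fin H → 𝒮 → 𝒜 × ℬ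
  plan : (Fin K → Episode H 𝒮 𝒜 ℬ) → (Fin K → Fin H → EuclideanSpace ℝ (Fin d)) →
    EuclideanSpace ℝ (Fin d) → Set (Policy H 𝒮 𝒜 × Policy H 𝒮 ℬ)

/-- The exploration phase of `alg` on the game `G`, as a random process on `(Ω, P)`: episode `k`
starts at `s₁`, the joint action of step `h` is the one prescribed by the policy chosen before the
episode, and, given all that happened until the action of step `h` is taken, the next state is
distributed according to `G.trans` and the sampled return, which lies in the unit ball, has mean
`G.ret`. `ℱ (k * (H + 1) + h)` is the information up to the state of step `h` in episode `k`. -/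
structure ExplorationRun {K d H : ℕ} {𝒮 𝒜 ℬ : Type*} [Fintype 𝒮] [Fintype 𝒜] [Fintype ℬ]
    (alg : ExplorePlan K d H 𝒮 𝒜 ℬ) (G : VMG d H 𝒮 𝒜 ℬ) (s₁ : 𝒮)
    {Ω : Type*} [m : MeasurableSpace Ω] (P : Measure Ω) where
  episode : Fin K → Ω → Episode H 𝒮 𝒜 ℬ
  ret : Fin K → Fin H → Ω → EuclideanSpace ℝ (Fin d)
  ℱ : Filtration ℕ m
  state_zero : ∀ k ω, (episode k ω).state 0 = s₁
  act_eq : ∀ (k : Fin K) (h : Fin H) (ω : Ω), (episode k ω).act h =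
    alg.explore k (fun i => episode (Fin.castLE k.isLt.le i) ω) h
      ((episode k ω).state h.castSucc)
  measurable_state : ∀ (k : Fin K) (h : Fin (H + 1)) (s : 𝒮),
    MeasurableSet[ℱ (k * (H + 1) + h)] {ω | (episode k ω).state h = s}
  condExp_state : ∀ (k : Fin K) (h : Fin H) (s' : 𝒮),
    P[Set.indicator {ω | (episode k ω).state h.succ = s'} (fun _ => (1 : ℝ)) |
        ℱ (k * (H + 1) + h)] =ᵐ[P]
      fun ω => (G.trans h ((episode k ω).state h.castSucc)
        ((episode k ω).act h).1 ((episode k ω).act h).2).1 s'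
  measurable_ret : ∀ (k : Fin K) (h : Fin H),
    StronglyMeasurable[ℱ (k * (H + 1) + h + 1)] (ret k h)
  norm_ret_le : ∀ k h, ∀ᵐ ω ∂P, ‖ret k h ω‖ ≤ 1
  condExp_ret : ∀ (k : Fin K) (h : Fin H),
    P[ret k h | ℱ (k * (H + 1) + h)] =ᵐ[P]
      fun ω => G.ret h ((episode k ω).state h.castSucc)
        ((episode k ω).act h).1 ((episode k ω).act h).2

/-- The guarantee of a reward-free algorithm with accuracy `ε` and confidence `1 - δ`, reached after
the `K` episodes of `alg`: for every game and every run of the exploration phase, outside an event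
of probability at most `δ`, for all `θ` in the unit ball the planning phase has an output and
every output has duality gap at most `ε`. -/
def ExplorePlan.IsRewardFree {K d H : ℕ} {𝒮 : Type u} {𝒜 : Type v} {ℬ : Type w}
    [Fintype 𝒮] [Fintype 𝒜] [Fintype ℬ]
    (alg : ExplorePlan K d H 𝒮 𝒜 ℬ) (s₁ : 𝒮) (ε δ : ℝ) : Prop :=
  ∀ (G : VMG d H 𝒮 𝒜 ℬ) (Ω : Type z) [MeasurableSpace Ω] (P : Measure Ω)
    [IsProbabilityMeasure P] (R : ExplorationRun alg G s₁ P),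
    P {ω | ¬ ∀ θ : EuclideanSpace ℝ (Fin d), ‖θ‖ ≤ 1 →
        (alg.plan (fun k => R.episode k ω) (fun k h => R.ret k h ω) θ).Nonempty ∧
        ∀ μ ν, (μ, ν) ∈ alg.plan (fun k => R.episode k ω) (fun k h => R.ret k h ω) θ →
          G.dualityGap s₁ θ μ ν ≤ ε} ≤ ENNReal.ofReal δ

namespace VIZero

variable {k d H : ℕ} {𝒮 𝒜 ℬ : Type*}

open Classical in
/-- The set of episodes among the given ones that visit `(s, a, b)` in step `h`. -/
noncomputable def visitSet (D : Fin k → Episode H 𝒮 𝒜 ℬ) (h : Fin H) (s : 𝒮) (a : 𝒜) (b : ℬ) :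
    Finset (Fin k) :=
  {i | (D i).state h.castSucc = s ∧ (D i).act h = (a, b)}

/-- The counter `N_h(s, a, b)`. -/
noncomputable def visits (D : Fin k → Episode H 𝒮 𝒜 ℬ) (h : Fin H) (s : 𝒮) (a : 𝒜) (b : ℬ) : ℕ :=
  (visitSet D h s a b).card

open Classical in
/-- The counter `N_h(s, a, b, s')`. -/
noncomputable def visitsTo (D : Fin k → Episode H 𝒮 𝒜 ℬ) (h : Fin H) (s : 𝒮) (a : 𝒜) (b : ℬ)
    (s' : 𝒮) : ℕ :=
  ((visitSet D h s a b).filter fun i => (D i).state h.succ = s').card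

/-- The empirical transition probability, used only where `visits` is positive. -/
noncomputable def empTrans (D : Fin k → Episode H 𝒮 𝒜 ℬ) (h : Fin H) (s : 𝒮) (a : 𝒜) (b : ℬ)
    (s' : 𝒮) : ℝ :=
  (visitsTo D h s a b s' : ℝ) / visits D h s a b

/-- The empirical mean of the sampled returns, used only where `visits` is positive. -/
noncomputable def empRet (D : Fin k → Episode H 𝒮 𝒜 ℬ)
    (r : Fin k → Fin H → EuclideanSpace ℝ (Fin d)) (h : Fin H) (s : 𝒮) (a : 𝒜) (b : ℬ) :
    EuclideanSpace ℝ (Fin d) :=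
  (visits D h s a b : ℝ)⁻¹ • ∑ i ∈ visitSet D h s a b, r i h

section

variable [Fintype 𝒮]

/-- The update of the uncertainty function `Q̃_h` from `Ṽ_{h+1} = V`, with bonus `β`. -/
noncomputable def qUpdate (β : ℕ → ℝ) (D : Fin k → Episode H 𝒮 𝒜 ℬ) (h : Fin H) (V : 𝒮 → ℝ)
    (s : 𝒮) (p : 𝒜 × ℬ) : ℝ :=
  if visits D h s p.1 p.2 = 0 then (H : ℝ)
  else min (∑ s', empTrans D h s p.1 p.2 s' * V s' + β (visits D h s p.1 p.2)) (H : ℝ)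

variable [Fintype 𝒜] [Fintype ℬ] [Nonempty 𝒜] [Nonempty ℬ]

/-- The function `Ṽ` at the beginning of the episode that follows the data `D`. -/
noncomputable def vTilde (β : ℕ → ℝ) (D : Fin k → Episode H 𝒮 𝒜 ℬ) : Fin (H + 1) → 𝒮 → ℝ :=
  Fin.reverseInduction (motive := fun _ => 𝒮 → ℝ) (fun _ => 0)
    (fun h V s => Finset.univ.sup' Finset.univ_nonempty (qUpdate β D h V s))

/-- The function `Q̃` at the beginning of the episode that follows the data `D`. -/
noncomputable def qTilde (β : ℕ → ℝ) (D : Fin k → Episode H 𝒮 𝒜 ℬ) (h : Fin H) (s : 𝒮) :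
    𝒜 × ℬ → ℝ :=
  qUpdate β D h (vTilde β D h.succ) s

/-- `Ghat` is an empirical game for the data `D`, `r`: it has the empirical transitions and mean
returns wherever there is a visit, and anything elsewhere. -/
def IsEmpiricalGame (D : Fin k → Episode H 𝒮 𝒜 ℬ) (r : Fin k → Fin H → EuclideanSpace ℝ (Fin d))
    (Ghat : VMG d H 𝒮 𝒜 ℬ) : Prop :=
  ∀ h s a b, visits D h s a b ≠ 0 →
    (Ghat.trans h s a b).1 = empTrans D h s a b ∧ Ghat.ret h s a b = empRet D r h s a b

/-- VI-Zero with bonus `β` over joint actions. In the exploration phase, ties in the argmax are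
broken by `sel`. The planning phase takes a `k` with `Ṽ^k_1(s₁)` least and a game
`Ghat` that is empirical for the data before episode `k`, and returns the output of Nash value
iteration, or any other Nash equilibrium, for `Ghat` scalarized by `θ`. -/
noncomputable def algorithm (K : ℕ) (β : ℕ → ℝ) (s₁ : 𝒮)
    (sel : ℕ → Fin H → 𝒮 → (𝒜 × ℬ → ℝ) → 𝒜 × ℬ) : ExplorePlan K d H 𝒮 𝒜 ℬ where
  explore k D h s := sel k h s (qTilde β D h s)
  plan D r θ := {π | ∃ k : Fin K,
    (∀ j : Fin K, vTilde β (fun i : Fin k => D (Fin.castLE k.isLt.le i)) 0 s₁ ≤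
      vTilde β (fun i : Fin j => D (Fin.castLE j.isLt.le i)) 0 s₁) ∧
    ∃ Ghat : VMG d H 𝒮 𝒜 ℬ,
      IsEmpiricalGame (fun i : Fin k => D (Fin.castLE k.isLt.le i))
        (fun i : Fin k => r (Fin.castLE k.isLt.le i)) Ghat ∧
      (Ghat.IsNashVIOutput θ π.1 π.2 ∨ Ghat.IsNash θ π.1 π.2)}

end

/-- The bonus `β_t`, with `ι = log (d S A B K H / δ)`. -/
noncomputable def bonus (c : ℝ) (d H S A B K : ℕ) (δ : ℝ) (t : ℕ) : ℝ :=
  c * (√(min (d : ℝ) S * H ^ 2 * Real.log (d * S * A * B * K * H / δ) / t) +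
    H ^ 2 * S * Real.log (d * S * A * B * K * H / δ) / t)

/-- The logarithmic factor `log (d S A B H / (min(ε, 1) δ))` of the sample complexity. -/
noncomputable def logFactor (d H S A B : ℕ) (ε δ : ℝ) : ℝ :=
  Real.log (d * S * A * B * H / (min ε 1 * δ))

/-- The sample complexity `min(d, S) H⁴ S A B ι / ε² + H³ S² A B ι² / ε`. -/
noncomputable def rate (d H S A B : ℕ) (ε δ : ℝ) : ℝ :=
  min (d : ℝ) S * H ^ 4 * S * A * B * logFactor d H S A B ε δ / ε ^ 2 +
    H ^ 3 * S ^ 2 * A * B * logFactor d H S A B ε δ ^ 2 / ε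

/-- For all games with at most `S` states, `A` and `B` actions, horizon `H` and `d`-dimensional
returns, and for every tie-breaking rule, VI-Zero with `K` episodes and bonus
`β_t` with constant `cβ`, followed by planning, has the reward-free guarantee. -/
def Succeeds (cβ : ℝ) (d H S A B K : ℕ) (ε δ : ℝ) : Prop :=
  ∀ (𝒮 : Type u) (𝒜 : Type v) (ℬ : Type w) [Fintype 𝒮] [Fintype 𝒜] [Fintype ℬ]
    [Nonempty 𝒜] [Nonempty ℬ],
    Fintype.card 𝒮 ≤ S → Fintype.card 𝒜 ≤ A → Fintype.card ℬ ≤ B →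
    ∀ (s₁ : 𝒮) (sel : ℕ → Fin H → 𝒮 → (𝒜 × ℬ → ℝ) → 𝒜 × ℬ),
      (∀ k h s (f : 𝒜 × ℬ → ℝ) p, f p ≤ f (sel k h s f)) →
      ExplorePlan.IsRewardFree.{u, v, w, z}
        (algorithm (d := d) K (bonus cβ d H S A B K δ) s₁ sel) s₁ ε δ

end VIZero

/-! The uncertainty `Ṽ` of VI-Zero has two roles. It bounds, for all `θ` at once, the duality gap of
every equilibrium of the empirical game, and it satisfies along the explored trajectories a
recursion which makes its sum over the episodes small. As the planning phase uses the episode with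
least `Ṽ_1(s₁)`, the average bounds the gap.

Planning. Minimax value and best-response values are all obtained by dynamic programming with
functionals that are nonexpansive in the sup distance of matrices, so one error analysis
(`VMG.dynProg`) serves for all. The delicate term is `(P - P̂) V`, where `V` may depend on the data.
For the Nash value `V = V*_θ` of the true game it is controlled directly: `V*_θ` is deterministic
and Lipschitz in `θ`, so a grid of logarithmic size about `d` log suffices, while summing over
coordinates gives the alternative factor `S`. This yields `min{d, S}` in the bonus, and `|V* - V̂*|
≤ 2 Ṽ`. The best-response values of the data-dependent policies are compared with `V*` as a
reference: `(P - P̂)(V^μ - V*)` is bounded coordinatewise by `|P - P̂| ≤ P̂ / H + e`. The first part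
costs only a factor `1 + 1/H` per step, a constant in total; the second goes into the lower-order
part of the bonus. Best response and equilibrium coincide in the empirical game, so `V^μ` can be
anchored at `V̂*`. This is `VMG.dualityGap_le_of_isNashVIOutput`.

Exploration. Greedy actions give `Ṽ_h ≤ (1 + 1/(2H)) P Ṽ_{h+1} + 2β` at a visited triple that has
been visited before, and at most `H` is charged at a first visit. The sum over episodes of `P
Ṽ_{h+1}` is replaced by the sum at the actual next states, again up to a factor close to one, by a
multiplicative martingale inequality. Iterating `H` times costs a constant, and counting visits with
Cauchy–Schwarz makes the main part of the sum of order `H √(min{d, S} H² ι · S A B K)`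
(`ExplorationRun.Good.sum_vTilde_le`). Dividing by `K` gives the rate.

Probability. A single exponential supermartingale for variables in `[0, 1]`, at different parameters
`η`, supplies all statements on transitions; mean returns are treated by a dimension-free Hilbert
space inequality based on `cosh ‖·‖`.

It remains to pass from the logarithm with `K` to the one without, which is done in `rate_log_le`.
-/

set_option linter.unusedSectionVars false

/-! ### Matrix games: minimax value and best responses as nonexpansive functionals. -/

section MatrixGame

variable {𝒜 ℬ : Type*} [Fintype 𝒜] [Fintype ℬ]

theorem matrixPayoff_eq_sum_left (M : 𝒜 → ℬ → ℝ) (x : stdSimplex ℝ 𝒜) (y : stdSimplex ℝ ℬ) :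
    matrixPayoff M x y = ∑ a, x.1 a * ∑ b, y.1 b * M a b := by
  simp only [matrixPayoff, Finset.mul_sum, mul_assoc]

theorem matrixPayoff_eq_sum_right (M : 𝒜 → ℬ → ℝ) (x : stdSimplex ℝ 𝒜) (y : stdSimplex ℝ ℬ) :
    matrixPayoff M x y = ∑ b, y.1 b * ∑ a, x.1 a * M a b := by
  rw [matrixPayoff, Finset.sum_comm]
  simp only [Finset.mul_sum]
  exact Finset.sum_congr rfl fun _ _ => Finset.sum_congr rfl fun _ _ => by ring

theorem stdSimplex_sum_mul_le {α : Type*} [Fintype α] (p : stdSimplex ℝ α) {f : α → ℝ} {c : ℝ}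
    (hf : ∀ a, f a ≤ c) : ∑ a, p.1 a * f a ≤ c := by
  calc ∑ a, p.1 a * f a ≤ ∑ a, p.1 a * c :=
        Finset.sum_le_sum fun a _ => mul_le_mul_of_nonneg_left (hf a) (p.2.1 a)
    _ = c := by rw [← Finset.sum_mul, p.2.2, one_mul]

theorem le_stdSimplex_sum_mul {α : Type*} [Fintype α] (p : stdSimplex ℝ α) {f : α → ℝ} {c : ℝ}
    (hf : ∀ a, c ≤ f a) : c ≤ ∑ a, p.1 a * f a := by
  calc c = ∑ a, p.1 a * c := by rw [← Finset.sum_mul, p.2.2, one_mul]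
    _ ≤ ∑ a, p.1 a * f a :=
        Finset.sum_le_sum fun a _ => mul_le_mul_of_nonneg_left (hf a) (p.2.1 a)

theorem abs_stdSimplex_sum_mul_le {α : Type*} [Fintype α] (p : stdSimplex ℝ α) {f : α → ℝ} {c : ℝ}
    (hf : ∀ a, |f a| ≤ c) : |∑ a, p.1 a * f a| ≤ c :=
  abs_le.2 ⟨le_stdSimplex_sum_mul p fun a => (abs_le.1 (hf a)).1,
    stdSimplex_sum_mul_le p fun a => (abs_le.1 (hf a)).2⟩

theorem matrixPayoff_le_add (x : stdSimplex ℝ 𝒜) (y : stdSimplex ℝ ℬ) {M M' : 𝒜 → ℬ → ℝ} {e : ℝ}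
    (h : ∀ a b, M a b ≤ M' a b + e) : matrixPayoff M x y ≤ matrixPayoff M' x y + e := by
  have h2 : matrixPayoff M x y - matrixPayoff M' x y =
      ∑ a, x.1 a * ∑ b, y.1 b * (M a b - M' a b) := by
    simp only [matrixPayoff_eq_sum_left, mul_sub, Finset.sum_sub_distrib]
  have : matrixPayoff M x y - matrixPayoff M' x y ≤ e := by
    rw [h2]
    exact stdSimplex_sum_mul_le x fun a => stdSimplex_sum_mul_le y fun b => by linarith [h a b]
  linarith

/-- A real functional of matrices that is nonexpansive for the entrywise sup distance and vanishes
at the zero matrix. -/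
structure IsGameFunctional (Φ : (𝒜 → ℬ → ℝ) → ℝ) : Prop where
  le_add : ∀ (M M' : 𝒜 → ℬ → ℝ) (e : ℝ), (∀ a b, M a b ≤ M' a b + e) → Φ M ≤ Φ M' + e
  zero : Φ 0 = 0

theorem IsGameFunctional.abs_sub_le {Φ : (𝒜 → ℬ → ℝ) → ℝ} (hΦ : IsGameFunctional Φ)
    {M M' : 𝒜 → ℬ → ℝ} {e : ℝ} (h : ∀ a b, |M a b - M' a b| ≤ e) : |Φ M - Φ M'| ≤ e := by
  have h1 := hΦ.le_add M M' e fun a b => by linarith [(abs_le.1 (h a b)).2]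
  have h2 := hΦ.le_add M' M e fun a b => by linarith [(abs_le.1 (h a b)).1]
  exact abs_le.2 ⟨by linarith, by linarith⟩

/-- A Nash equilibrium is a saddle point of a bilinear form on a product of simplices, so Sion's
minimax theorem applies. -/
theorem exists_isMatrixNash [Nonempty 𝒜] [Nonempty ℬ] (M : 𝒜 → ℬ → ℝ) :
    ∃ x y, IsMatrixNash M x y := by
  classical
  let f : (𝒜 → ℝ) → (ℬ → ℝ) → ℝ := fun x y => ∑ a, ∑ b, x a * y b * M a b
  have hlin1 : ∀ y, IsLinearMap ℝ (fun x => f x y) := fun y =>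
    ⟨fun x x' => by simp only [f, Pi.add_apply, add_mul, Finset.sum_add_distrib],
     fun c x => by simp only [f, Pi.smul_apply, smul_eq_mul, Finset.mul_sum, mul_assoc]⟩
  have hlin2 : ∀ x, IsLinearMap ℝ (fun y => f x y) := fun x =>
    ⟨fun y y' => by simp only [f, Pi.add_apply, add_mul, mul_add, Finset.sum_add_distrib],
     fun c y => by
      simp only [f, Pi.smul_apply, smul_eq_mul, Finset.mul_sum]
      exact Finset.sum_congr rfl fun _ _ => Finset.sum_congr rfl fun _ _ => by ring⟩
  have hc1 : ∀ y, Continuous (fun x => f x y) := fun y => by fun_prop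
  have hc2 : ∀ x, Continuous (fun y => f x y) := fun x => by fun_prop
  have hne1 : (stdSimplex ℝ 𝒜).Nonempty := ⟨_, single_mem_stdSimplex ℝ (Classical.arbitrary 𝒜)⟩
  have hne2 : (stdSimplex ℝ ℬ).Nonempty := ⟨_, single_mem_stdSimplex ℝ (Classical.arbitrary ℬ)⟩
  obtain ⟨x, hx, y, hy, h⟩ := Sion.exists_isSaddlePointOn (f := f) hne1 (convex_stdSimplex ℝ 𝒜)
    (isCompact_stdSimplex ℝ 𝒜)
    (fun y _ => (hc1 y).lowerSemicontinuous.lowerSemicontinuousOn _)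
    (fun y _ => (((hlin1 y).mk' _).convexOn (convex_stdSimplex ℝ 𝒜)).quasiconvexOn)
    (convex_stdSimplex ℝ ℬ) hne2 (isCompact_stdSimplex ℝ ℬ)
    (fun x _ => (hc2 x).upperSemicontinuous.upperSemicontinuousOn _)
    (fun x _ => (((hlin2 x).mk' _).concaveOn (convex_stdSimplex ℝ ℬ)).quasiconcaveOn)
  exact ⟨⟨x, hx⟩, ⟨y, hy⟩, fun x' => h x'.1 x'.2 y hy, fun y' => h x hx y'.1 y'.2⟩

/-- The minimax value of a matrix game. -/
noncomputable def matrixValue [Nonempty 𝒜] [Nonempty ℬ] (M : 𝒜 → ℬ → ℝ) : ℝ :=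
  matrixPayoff M (exists_isMatrixNash M).choose (exists_isMatrixNash M).choose_spec.choose

/-- Swap one strategy at a time: `M(x, y) ≤ M(x', y) ≤ M'(x', y) + e ≤ M'(x', y') + e`. For `M = M'`
and `e = 0` this is the uniqueness of the value, in general its nonexpansiveness. -/
theorem IsMatrixNash.payoff_le_add {M M' : 𝒜 → ℬ → ℝ} {x x' : stdSimplex ℝ 𝒜}
    {y y' : stdSimplex ℝ ℬ} (h : IsMatrixNash M x y) (h' : IsMatrixNash M' x' y') {e : ℝ}
    (he : ∀ a b, M a b ≤ M' a b + e) : matrixPayoff M x y ≤ matrixPayoff M' x' y' + e := by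
  linarith [h.1 x', h'.2 y, matrixPayoff_le_add x' y he]

theorem IsMatrixNash.matrixValue_eq [Nonempty 𝒜] [Nonempty ℬ] {M : 𝒜 → ℬ → ℝ}
    {x : stdSimplex ℝ 𝒜} {y : stdSimplex ℝ ℬ} (h : IsMatrixNash M x y) :
    matrixValue M = matrixPayoff M x y := by
  have h' := (exists_isMatrixNash M).choose_spec.choose_spec
  apply le_antisymm
  · exact (h'.payoff_le_add h (e := 0) (by simp)).trans_eq (add_zero _)
  · exact (h.payoff_le_add h' (e := 0) (by simp)).trans_eq (add_zero _)

theorem isGameFunctional_matrixValue [Nonempty 𝒜] [Nonempty ℬ] :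
    IsGameFunctional (matrixValue (𝒜 := 𝒜) (ℬ := ℬ)) where
  le_add M M' _ he := (exists_isMatrixNash M).choose_spec.choose_spec.payoff_le_add
    (exists_isMatrixNash M').choose_spec.choose_spec he
  zero := by simp [matrixValue, matrixPayoff]

/-- The payoff of the best response of the max-player to `x`. -/
noncomputable def bestMax [Nonempty ℬ] (x : stdSimplex ℝ 𝒜) (M : 𝒜 → ℬ → ℝ) : ℝ :=
  Finset.univ.sup' Finset.univ_nonempty fun b => ∑ a, x.1 a * M a b

/-- The payoff of the best response of the min-player to `y`. -/
noncomputable def bestMin [Nonempty 𝒜] (y : stdSimplex ℝ ℬ) (M : 𝒜 → ℬ → ℝ) : ℝ :=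
  Finset.univ.inf' Finset.univ_nonempty fun a => ∑ b, y.1 b * M a b

theorem matrixPayoff_le_bestMax [Nonempty ℬ] (x : stdSimplex ℝ 𝒜) (y : stdSimplex ℝ ℬ)
    (M : 𝒜 → ℬ → ℝ) : matrixPayoff M x y ≤ bestMax x M := by
  rw [matrixPayoff_eq_sum_right]
  exact stdSimplex_sum_mul_le y fun b =>
    Finset.le_sup' (fun b => ∑ a, x.1 a * M a b) (Finset.mem_univ b)

theorem bestMin_le_matrixPayoff [Nonempty 𝒜] (x : stdSimplex ℝ 𝒜) (y : stdSimplex ℝ ℬ)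
    (M : 𝒜 → ℬ → ℝ) : bestMin y M ≤ matrixPayoff M x y := by
  rw [matrixPayoff_eq_sum_left]
  exact le_stdSimplex_sum_mul x fun a =>
    Finset.inf'_le (fun a => ∑ b, y.1 b * M a b) (Finset.mem_univ a)

theorem isGameFunctional_bestMax [Nonempty ℬ] (x : stdSimplex ℝ 𝒜) :
    IsGameFunctional (bestMax (ℬ := ℬ) x) where
  le_add M M' e he := by
    refine Finset.sup'_le _ _ fun b _ => ?_
    have h1 := stdSimplex_sum_mul_le x (f := fun a => M a b - M' a b) (c := e)
      fun a => by linarith [he a b]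
    have h2 : ∑ a, x.1 a * M' a b ≤ bestMax x M' :=
      Finset.le_sup' (fun b => ∑ a, x.1 a * M' a b) (Finset.mem_univ b)
    simp only [mul_sub, Finset.sum_sub_distrib] at h1
    linarith
  zero := by simp [bestMax]

theorem isGameFunctional_bestMin [Nonempty 𝒜] (y : stdSimplex ℝ ℬ) :
    IsGameFunctional (bestMin (𝒜 := 𝒜) y) where
  le_add M M' e he := by
    rw [← sub_le_iff_le_add]
    refine Finset.le_inf' _ _ fun a _ => ?_
    have h1 := stdSimplex_sum_mul_le y (f := fun b => M a b - M' a b) (c := e)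
      fun b => by linarith [he a b]
    have h2 : bestMin y M ≤ ∑ b, y.1 b * M a b :=
      Finset.inf'_le (fun a => ∑ b, y.1 b * M a b) (Finset.mem_univ a)
    simp only [mul_sub, Finset.sum_sub_distrib] at h1
    linarith
  zero := by simp [bestMin]

/-- Pure deviations suffice. Together with `IsMatrixNash.matrixValue_eq` and
`IsMatrixNash.bestMin_eq`, all three functionals agree at an equilibrium; so in the empirical game
the three dynamic programs have one common value function. -/
theorem IsMatrixNash.bestMax_eq [Nonempty ℬ] {M : 𝒜 → ℬ → ℝ} {x : stdSimplex ℝ 𝒜}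
    {y : stdSimplex ℝ ℬ} (h : IsMatrixNash M x y) : bestMax x M = matrixPayoff M x y := by
  classical
  refine le_antisymm (Finset.sup'_le _ _ fun b _ => ?_) (matrixPayoff_le_bestMax x y M)
  have := h.2 ⟨Pi.single b 1, single_mem_stdSimplex ℝ b⟩
  rw [matrixPayoff_eq_sum_right] at this
  simpa [Pi.single_apply] using this

theorem IsMatrixNash.bestMin_eq [Nonempty 𝒜] {M : 𝒜 → ℬ → ℝ} {x : stdSimplex ℝ 𝒜}
    {y : stdSimplex ℝ ℬ} (h : IsMatrixNash M x y) : bestMin y M = matrixPayoff M x y := by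
  classical
  refine le_antisymm (bestMin_le_matrixPayoff x y M) (Finset.le_inf' _ _ fun a _ => ?_)
  have := h.1 ⟨Pi.single a 1, single_mem_stdSimplex ℝ a⟩
  rw [matrixPayoff_eq_sum_left _ ⟨Pi.single a 1, _⟩] at this
  simpa [Pi.single_apply] using this

end MatrixGame

/-! ### Equilibria of Markov games and dynamic programming with general functionals. -/

namespace VMG

variable {d H : ℕ} {𝒮 𝒜 ℬ : Type*} [Fintype 𝒮] [Fintype 𝒜] [Fintype ℬ]

@[simp]
theorem value_last (G : VMG d H 𝒮 𝒜 ℬ) (θ : EuclideanSpace ℝ (Fin d)) (μ : Policy H 𝒮 𝒜)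
    (ν : Policy H 𝒮 ℬ) (s : 𝒮) : G.value θ μ ν (Fin.last H) s = 0 := by
  simp [value]

theorem value_castSucc (G : VMG d H 𝒮 𝒜 ℬ) (θ : EuclideanSpace ℝ (Fin d)) (μ : Policy H 𝒮 𝒜)
    (ν : Policy H 𝒮 ℬ) (h : Fin H) (s : 𝒮) :
    G.value θ μ ν h.castSucc s = matrixPayoff (G.qValue θ μ ν h s) (μ h s) (ν h s) := by
  simp [value, qValue]

theorem lookahead_le_add (G : VMG d H 𝒮 𝒜 ℬ) (θ : EuclideanSpace ℝ (Fin d)) (h : Fin H)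
    {V V' : 𝒮 → ℝ} {c : ℝ} (hV : ∀ s, V s ≤ V' s + c) (s : 𝒮) (a : 𝒜) (b : ℬ) :
    G.lookahead θ h V s a b ≤ G.lookahead θ h V' s a b + c := by
  have h1 := stdSimplex_sum_mul_le (G.trans h s a b) (f := fun s => V s - V' s) (c := c)
      fun a => by linarith [hV a]
  simp only [mul_sub, Finset.sum_sub_distrib] at h1
  simp only [lookahead]
  linarith

/-- The value of step `h` depends only on the policies from step `h` on. -/
theorem value_congr (G : VMG d H 𝒮 𝒜 ℬ) (θ : EuclideanSpace ℝ (Fin d)) {μ μ' : Policy H 𝒮 𝒜}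
    {ν ν' : Policy H 𝒮 ℬ} (h : Fin (H + 1))
    (hμ : ∀ i : Fin H, h ≤ i.castSucc → μ i = μ' i)
    (hν : ∀ i : Fin H, h ≤ i.castSucc → ν i = ν' i) : G.value θ μ ν h = G.value θ μ' ν' h := by
  induction h using Fin.reverseInduction with
  | last => ext s; simp
  | cast h ih =>
    ext s
    have hlt : ∀ i : Fin H, h.succ ≤ i.castSucc → h.castSucc ≤ i.castSucc := fun i hi =>
      le_trans (Fin.castSucc_lt_succ).le hi
    rw [value_castSucc, value_castSucc, qValue, qValue,
      ih (fun i hi => hμ i (hlt i hi)) (fun i hi => hν i (hlt i hi)), hμ h le_rfl, hν h le_rfl]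

/-- One-shot deviation: a change of the policy only at step `h` and state `s` leaves the values from
step `h + 1` on unchanged, so it is a deviation in the matrix game there. The planning analysis thus
needs only outputs of Nash value iteration. -/
theorem IsNash.isNashVIOutput {G : VMG d H 𝒮 𝒜 ℬ} {θ : EuclideanSpace ℝ (Fin d)}
    {μ : Policy H 𝒮 𝒜} {ν : Policy H 𝒮 ℬ} (hN : G.IsNash θ μ ν) : G.IsNashVIOutput θ μ ν := by
  classical
  intro h s
  have hne : ∀ i : Fin H, h.succ ≤ i.castSucc → i ≠ h := by
    rintro i hi rfl
    exact absurd hi (not_le.2 (Fin.castSucc_lt_succ))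
  constructor
  · intro x
    have := (hN h.castSucc s).1 (Function.update μ h (Function.update (μ h) s x))
    rw [value_castSucc, value_castSucc, qValue, qValue, value_congr G θ (μ := Function.update μ h _)
      (μ' := μ) (ν := ν) (ν' := ν) h.succ (fun i hi => Function.update_of_ne (hne i hi) _ _)
      (fun _ _ => rfl)] at this
    simpa [qValue] using this
  · intro y
    have := (hN h.castSucc s).2 (Function.update ν h (Function.update (ν h) s y))
    rw [value_castSucc, value_castSucc, qValue, qValue, value_congr G θ (ν := Function.update ν h _)
      (ν' := ν) (μ := μ) (μ' := μ) h.succ (fun _ _ => rfl)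
      (fun i hi => Function.update_of_ne (hne i hi) _ _)] at this
    simpa [qValue] using this

/-- Backward construction: overwriting the policies at step `h` by matrix equilibria does not affect
the matrices `Q_i` with `i ≥ h`. -/
theorem exists_isNashVIOutput [Nonempty 𝒜] [Nonempty ℬ] (G : VMG d H 𝒮 𝒜 ℬ)
    (θ : EuclideanSpace ℝ (Fin d)) : ∃ μ ν, G.IsNashVIOutput θ μ ν := by
  classical
  suffices key : ∀ h : Fin (H + 1), ∃ (μ : Policy H 𝒮 𝒜) (ν : Policy H 𝒮 ℬ), ∀ i : Fin H,
      h ≤ i.castSucc → ∀ s, IsMatrixNash (G.qValue θ μ ν i s) (μ i s) (ν i s) by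
    obtain ⟨μ, ν, hμν⟩ := key 0
    exact ⟨μ, ν, fun h s => hμν h (Fin.zero_le _) s⟩
  intro h
  induction h using Fin.reverseInduction with
  | last =>
    refine ⟨fun _ _ => Classical.arbitrary _, fun _ _ => Classical.arbitrary _, fun i hi => ?_⟩
    exact absurd hi (not_le.2 i.castSucc_lt_last)
  | cast h ih =>
    obtain ⟨μ, ν, hμν⟩ := ih
    choose x y hxy using fun s => exists_isMatrixNash (G.qValue θ μ ν h s)
    have hq : ∀ i : Fin H, h ≤ i →
        G.qValue θ (Function.update μ h x) (Function.update ν h y) i = G.qValue θ μ ν i := by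
      intro i hi
      have hne : ∀ j : Fin H, i.succ ≤ j.castSucc → j ≠ h := by
        rintro j hj rfl
        exact absurd hj (not_le.2 ((Fin.castSucc_le_castSucc_iff.2 hi).trans_lt
          Fin.castSucc_lt_succ))
      rw [qValue, qValue, value_congr G θ i.succ
        (fun j hj => Function.update_of_ne (hne j hj) _ _)
        (fun j hj => Function.update_of_ne (hne j hj) _ _)]
    refine ⟨Function.update μ h x, Function.update ν h y, fun i hi s => ?_⟩
    have hi' : h ≤ i := by simpa using hi
    rw [hq i hi']
    rcases eq_or_lt_of_le hi' with rfl | hlt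
    · simpa using hxy s
    · rw [Function.update_of_ne hlt.ne', Function.update_of_ne hlt.ne']
      exact hμν i (Fin.succ_le_castSucc_iff.2 hlt) s

/-- Dynamic programming with the functional `Φ h s` at step `h` and state `s`. -/
noncomputable def dynProg (G : VMG d H 𝒮 𝒜 ℬ) (θ : EuclideanSpace ℝ (Fin d))
    (Φ : Fin H → 𝒮 → (𝒜 → ℬ → ℝ) → ℝ) : Fin (H + 1) → 𝒮 → ℝ :=
  Fin.reverseInduction (motive := fun _ => 𝒮 → ℝ) (fun _ => 0)
    (fun h V s => Φ h s (G.lookahead θ h V s))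

section DynProg

variable (G : VMG d H 𝒮 𝒜 ℬ) (θ : EuclideanSpace ℝ (Fin d)) (Φ : Fin H → 𝒮 → (𝒜 → ℬ → ℝ) → ℝ)

@[simp]
theorem dynProg_last (s : 𝒮) : G.dynProg θ Φ (Fin.last H) s = 0 := by
  simp [dynProg]

theorem dynProg_castSucc (h : Fin H) (s : 𝒮) :
    G.dynProg θ Φ h.castSucc s = Φ h s (G.lookahead θ h (G.dynProg θ Φ h.succ) s) := by
  simp [dynProg]

variable {Φ}

/-- Nonexpansive functionals pass on a change of the immediate returns of at most `‖θ - θ'‖` per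
remaining step. This allows the discretization of `θ`; the choice `θ' = 0` gives the a priori size
of the values. -/
theorem abs_dynProg_sub_le (θ' : EuclideanSpace ℝ (Fin d)) (hΦ : ∀ h s, IsGameFunctional (Φ h s))
    (h : Fin (H + 1)) (s : 𝒮) :
    |G.dynProg θ Φ h s - G.dynProg θ' Φ h s| ≤ (H - h : ℝ) * ‖θ - θ'‖ := by
  induction h using Fin.reverseInduction generalizing s with
  | last => simp
  | cast h ih =>
    rw [dynProg_castSucc, dynProg_castSucc]
    refine (hΦ h s).abs_sub_le fun a b => ?_
    have h1 := abs_stdSimplex_sum_mul_le (G.trans h s a b) ih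
    have h2 : |inner ℝ (θ - θ') (G.ret h s a b)| ≤ ‖θ - θ'‖ :=
      (abs_real_inner_le_norm _ _).trans
        (mul_le_of_le_one_right (norm_nonneg _) (G.norm_ret_le h s a b))
    have h3 : G.lookahead θ h (G.dynProg θ Φ h.succ) s a b -
        G.lookahead θ' h (G.dynProg θ' Φ h.succ) s a b = inner ℝ (θ - θ') (G.ret h s a b) +
        ∑ s', (G.trans h s a b).1 s' * (G.dynProg θ Φ h.succ s' - G.dynProg θ' Φ h.succ s') := by
      simp only [lookahead, inner_sub_left, mul_sub, Finset.sum_sub_distrib]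
      ring
    rw [h3]
    refine (abs_add_le _ _).trans ((add_le_add h2 h1).trans (le_of_eq ?_))
    simp only [Fin.val_succ, Fin.val_castSucc]
    push_cast
    ring

theorem dynProg_zero (hΦ : ∀ h s, IsGameFunctional (Φ h s)) (h : Fin (H + 1)) (s : 𝒮) :
    G.dynProg 0 Φ h s = 0 := by
  induction h using Fin.reverseInduction generalizing s with
  | last => simp
  | cast h ih =>
    rw [dynProg_castSucc, show G.dynProg 0 Φ h.succ = 0 from funext ih]
    have : G.lookahead 0 h 0 s = 0 := by
      ext a b
      simp [lookahead]
    rw [this, (hΦ h s).zero]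

theorem abs_dynProg_le (hΦ : ∀ h s, IsGameFunctional (Φ h s)) (h : Fin (H + 1)) (s : 𝒮) :
    |G.dynProg θ Φ h s| ≤ (H - h : ℝ) * ‖θ‖ := by
  simpa [dynProg_zero G hΦ] using G.abs_dynProg_sub_le θ 0 hΦ h s

theorem abs_lookahead_dynProg_le (hΦ : ∀ h s, IsGameFunctional (Φ h s)) (hθ : ‖θ‖ ≤ 1) (h : Fin H)
    (s : 𝒮) (a : 𝒜) (b : ℬ) : |G.lookahead θ h (G.dynProg θ Φ h.succ) s a b| ≤ H := by
  have h1 := abs_stdSimplex_sum_mul_le (G.trans h s a b) (G.abs_dynProg_le θ hΦ h.succ)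
  have h2 : |inner ℝ θ (G.ret h s a b)| ≤ ‖θ‖ :=
    (abs_real_inner_le_norm _ _).trans
      (mul_le_of_le_one_right (norm_nonneg _) (G.norm_ret_le h s a b))
  rw [lookahead]
  refine (abs_add_le _ _).trans ((add_le_add h2 h1).trans ?_)
  have : (h : ℝ) + 1 ≤ H := by exact_mod_cast h.isLt
  simp only [Fin.val_succ]
  push_cast
  have hh : (0 : ℝ) ≤ (h : ℕ) := by positivity
  nlinarith [norm_nonneg θ]

end DynProg

/-- Only this inequality is needed, as the duality gap is bounded from above: no policy beats the
dynamic program that takes the best pure action everywhere. -/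
theorem value_le_dynProg_bestMax [Nonempty ℬ] (G : VMG d H 𝒮 𝒜 ℬ) (θ : EuclideanSpace ℝ (Fin d))
    (μ : Policy H 𝒮 𝒜) (ν : Policy H 𝒮 ℬ) (h : Fin (H + 1)) (s : 𝒮) :
    G.value θ μ ν h s ≤ G.dynProg θ (fun h s => bestMax (μ h s)) h s := by
  induction h using Fin.reverseInduction generalizing s with
  | last => simp
  | cast h ih =>
    rw [value_castSucc, dynProg_castSucc]
    refine (matrixPayoff_le_bestMax _ _ _).trans ?_
    simpa [qValue] using (isGameFunctional_bestMax (ℬ := ℬ) (μ h s)).le_add _ _ 0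
      (G.lookahead_le_add θ h (by simpa using ih) s)

theorem dynProg_bestMin_le_value [Nonempty 𝒜] (G : VMG d H 𝒮 𝒜 ℬ) (θ : EuclideanSpace ℝ (Fin d))
    (μ : Policy H 𝒮 𝒜) (ν : Policy H 𝒮 ℬ) (h : Fin (H + 1)) (s : 𝒮) :
    G.dynProg θ (fun h s => bestMin (ν h s)) h s ≤ G.value θ μ ν h s := by
  induction h using Fin.reverseInduction generalizing s with
  | last => simp
  | cast h ih =>
    rw [value_castSucc, dynProg_castSucc]
    refine le_trans ?_ (bestMin_le_matrixPayoff _ (ν h s) _)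
    simpa [qValue] using (isGameFunctional_bestMin (𝒜 := 𝒜) (ν h s)).le_add _ _ 0
      (G.lookahead_le_add θ h (by simpa using ih) s)

/-- If the functionals reproduce the payoffs of an output of Nash value iteration, dynamic
programming with them computes its value function. -/
theorem dynProg_eq_value {G : VMG d H 𝒮 𝒜 ℬ} {θ : EuclideanSpace ℝ (Fin d)}
    {μ : Policy H 𝒮 𝒜} {ν : Policy H 𝒮 ℬ} {Φ : Fin H → 𝒮 → (𝒜 → ℬ → ℝ) → ℝ}
    (hΦ : ∀ h s, Φ h s (G.qValue θ μ ν h s) = matrixPayoff (G.qValue θ μ ν h s) (μ h s) (ν h s)) :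
    G.dynProg θ Φ = G.value θ μ ν := by
  ext h s
  induction h using Fin.reverseInduction generalizing s with
  | last => simp
  | cast h ih =>
    rw [value_castSucc, dynProg_castSucc, ← hΦ, qValue, funext ih]

/-- The value function of the Nash equilibria. -/
noncomputable def nashValue [Nonempty 𝒜] [Nonempty ℬ] (G : VMG d H 𝒮 𝒜 ℬ)
    (θ : EuclideanSpace ℝ (Fin d)) : Fin (H + 1) → 𝒮 → ℝ :=
  G.dynProg θ fun _ _ => matrixValue

end VMG

/-! ### From an error bound for the model to the duality gap of its equilibria. -/

namespace VMG

variable {d H : ℕ} {𝒮 𝒜 ℬ : Type*} [Fintype 𝒮] [Fintype 𝒜] [Fintype ℬ]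

/-- `w` dominates the estimation error of the model `Ghat` of the game `G`: at each triple, either
`w` has the trivial value, or it exceeds a look-ahead under `Ghat` plus bonuses for the mean
return, for the expectation of the values `V` at the next state, and for the expectation of
arbitrary functions. -/
def IsErrorBound (G Ghat : VMG d H 𝒮 𝒜 ℬ) (V w : Fin (H + 1) → 𝒮 → ℝ) : Prop :=
  ∀ h s a b, (H : ℝ) ≤ w h.castSucc s ∨ ∃ β₁ β₂ e : ℝ, 0 ≤ e ∧
    ‖G.ret h s a b - Ghat.ret h s a b‖ ≤ β₁ ∧
    |∑ x, ((G.trans h s a b).1 x - (Ghat.trans h s a b).1 x) * V h.succ x| ≤ β₂ ∧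
    (∀ x, |(G.trans h s a b).1 x - (Ghat.trans h s a b).1 x| ≤
      (Ghat.trans h s a b).1 x / H + e) ∧
    min (∑ x, (Ghat.trans h s a b).1 x * w h.succ x + (β₁ + β₂ + Fintype.card 𝒮 * e * (2 * H)))
      (H : ℝ) ≤ w h.castSucc s

variable {G Ghat : VMG d H 𝒮 𝒜 ℬ} {θ : EuclideanSpace ℝ (Fin d)} {V w : Fin (H + 1) → 𝒮 → ℝ}

/-- The transition error is split at a reference function `U`, to which concentration applies; what
is left is the transition error on `V - U` and a propagation term under `Ghat`. -/
theorem lookahead_sub (G Ghat : VMG d H 𝒮 𝒜 ℬ) (θ : EuclideanSpace ℝ (Fin d)) (h : Fin H)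
    (U V V' : 𝒮 → ℝ) (s : 𝒮) (a : 𝒜) (b : ℬ) :
    G.lookahead θ h V s a b - Ghat.lookahead θ h V' s a b =
      inner ℝ θ (G.ret h s a b - Ghat.ret h s a b) +
      ∑ x, ((G.trans h s a b).1 x - (Ghat.trans h s a b).1 x) * U x +
      ∑ x, ((G.trans h s a b).1 x - (Ghat.trans h s a b).1 x) * (V x - U x) +
      ∑ x, (Ghat.trans h s a b).1 x * (V x - V' x) := by
  simp only [lookahead, inner_sub_right, mul_sub, sub_mul, Finset.sum_sub_distrib]
  ring

theorem min_mul_le {x y c q : ℝ} (hc : 0 ≤ c) (h : min x y ≤ q) : min (c * x) (c * y) ≤ c * q := by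
  rw [← mul_min_of_nonneg _ _ hc]
  exact mul_le_mul_of_nonneg_left h hc

theorem abs_inner_ret_sub_le (hθ : ‖θ‖ ≤ 1) {h : Fin H} {s : 𝒮} {a : 𝒜} {b : ℬ} {β : ℝ}
    (hβ : ‖G.ret h s a b - Ghat.ret h s a b‖ ≤ β) :
    |inner ℝ θ (G.ret h s a b - Ghat.ret h s a b)| ≤ β :=
  (abs_real_inner_le_norm _ _).trans
    ((mul_le_of_le_one_left (norm_nonneg _) hθ).trans hβ)

/-- The dynamic programming values in `G` and `Ghat` are close, for the functional whose value in
`G` the error bound refers to. -/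
theorem abs_dynProg_sub_dynProg_le {Φ : Fin H → 𝒮 → (𝒜 → ℬ → ℝ) → ℝ}
    (hΦ : ∀ h s, IsGameFunctional (Φ h s)) (hθ : ‖θ‖ ≤ 1)
    (hw : IsErrorBound G Ghat (G.dynProg θ Φ) w) (hw0 : ∀ h s, 0 ≤ w h s)
    (h : Fin (H + 1)) (s : 𝒮) :
    |G.dynProg θ Φ h s - Ghat.dynProg θ Φ h s| ≤ 2 * w h s := by
  induction h using Fin.reverseInduction generalizing s with
  | last => simpa using hw0 _ s
  | cast h ih =>
    rw [dynProg_castSucc, dynProg_castSucc]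
    refine (hΦ h s).abs_sub_le fun a b => ?_
    -- Both look-aheads lie in `[-H, H]`. Where `w` is truncated at `H` only this is available,
    -- hence the factor `2` in the claim.
    have htriv : |G.lookahead θ h (G.dynProg θ Φ h.succ) s a b -
        Ghat.lookahead θ h (Ghat.dynProg θ Φ h.succ) s a b| ≤ 2 * H := by
      refine (abs_sub _ _).trans ?_
      linarith [G.abs_lookahead_dynProg_le θ hΦ hθ h s a b,
        Ghat.abs_lookahead_dynProg_le θ hΦ hθ h s a b]
    rcases hw h s a b with h1 | ⟨β₁, β₂, e, he0, hβ₁, hβ₂, he, h1⟩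
    · linarith
    · refine le_trans (le_min ?_ htriv) (min_mul_le zero_le_two h1)
      -- The reference is the value in `G` itself, so the transition error on the difference
      -- vanishes.
      rw [lookahead_sub G Ghat θ h (G.dynProg θ Φ h.succ)]
      have h3 := abs_inner_ret_sub_le hθ hβ₁
      have h4 : |∑ x, (Ghat.trans h s a b).1 x *
          (G.dynProg θ Φ h.succ x - Ghat.dynProg θ Φ h.succ x)| ≤
          ∑ x, (Ghat.trans h s a b).1 x * (2 * w h.succ x) := by
        refine (Finset.abs_sum_le_sum_abs _ _).trans (Finset.sum_le_sum fun x _ => ?_)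
        rw [abs_mul, abs_of_nonneg ((Ghat.trans h s a b).2.1 x)]
        exact mul_le_mul_of_nonneg_left (ih x) ((Ghat.trans h s a b).2.1 x)
      have h5 : ∑ x, (Ghat.trans h s a b).1 x * (2 * w h.succ x) =
          2 * ∑ x, (Ghat.trans h s a b).1 x * w h.succ x := by
        rw [Finset.mul_sum]; exact Finset.sum_congr rfl fun _ _ => by ring
      have h6 : 0 ≤ Fintype.card 𝒮 * e * (2 * H) := by positivity
      have h7 := abs_nonneg (∑ x, ((G.trans h s a b).1 x - (Ghat.trans h s a b).1 x) *
        G.dynProg θ Φ h.succ x)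
      have h8 := abs_nonneg (inner ℝ θ (G.ret h s a b - Ghat.ret h s a b))
      simp only [sub_self, mul_zero, Finset.sum_const_zero, add_zero]
      refine (abs_add_le _ _).trans (le_trans (add_le_add (abs_add_le _ _) le_rfl) ?_)
      linarith

/-- Values of dynamic programming in `G` and `Ghat` are close if those in `Ghat` are close to the
function `V` which the error bound refers to. -/
theorem abs_dynProg_sub_dynProg_le_of_reference {Φ : Fin H → 𝒮 → (𝒜 → ℬ → ℝ) → ℝ}
    (hΦ : ∀ h s, IsGameFunctional (Φ h s)) (hθ : ‖θ‖ ≤ 1)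
    (hw : IsErrorBound G Ghat V w) (hw0 : ∀ h s, 0 ≤ w h s) (hV : ∀ h s, |V h s| ≤ H)
    (hVw : ∀ h s, |V h s - Ghat.dynProg θ Φ h s| ≤ 2 * w h s)
    (h : Fin (H + 1)) (s : 𝒮) :
    |G.dynProg θ Φ h s - Ghat.dynProg θ Φ h s| ≤
      (4 * (1 + 1 / (H : ℝ)) ^ (H - (h : ℕ)) - 2) * w h s := by
  induction h using Fin.reverseInduction generalizing s with
  | last => simpa using mul_nonneg (by norm_num) (hw0 _ s)
  | cast h ih =>
    have hH : (0 : ℝ) < H := by exact_mod_cast h.pos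
    set q : ℝ := (1 + 1 / (H : ℝ)) ^ (H - (h.succ : ℕ)) with hq
    have hq1 : 1 ≤ q := one_le_pow₀ (by simp)
    have hcs : (1 + 1 / (H : ℝ)) ^ (H - (h.castSucc : ℕ)) = (1 + 1 / (H : ℝ)) * q := by
      rw [hq, ← pow_succ']
      congr 1
      simp only [Fin.val_succ, Fin.val_castSucc]
      have := h.isLt
      omega
    rw [hcs]
    -- The constant obeys `c_h = c_{h+1} + (c_{h+1} + 2) / H` with `c_H = 2`: the propagated error,
    -- plus `1/H` times the distance to the reference, which is at most `(c_{h+1} + 2) w`. Hence `c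
    -- + 2` is multiplied by `1 + 1/H` in each step.
    set c : ℝ := 4 * ((1 + 1 / (H : ℝ)) * q) - 2 with hc
    have hcq : c = (4 * q - 2) + 1 / H * (4 * q) := by rw [hc]; ring
    have hc2 : 2 ≤ c := by
      have : 0 ≤ 1 / (H : ℝ) * (4 * q) := by positivity
      linarith
    rw [dynProg_castSucc, dynProg_castSucc]
    refine (hΦ h s).abs_sub_le fun a b => ?_
    have htriv : |G.lookahead θ h (G.dynProg θ Φ h.succ) s a b -
        Ghat.lookahead θ h (Ghat.dynProg θ Φ h.succ) s a b| ≤ c * H := by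
      refine (abs_sub _ _).trans ?_
      nlinarith [G.abs_lookahead_dynProg_le θ hΦ hθ h s a b,
        Ghat.abs_lookahead_dynProg_le θ hΦ hθ h s a b]
    rcases hw h s a b with h1 | ⟨β₁, β₂, e, he0, hβ₁, hβ₂, he, h1⟩
    · exact htriv.trans (mul_le_mul_of_nonneg_left h1 (by linarith))
    · refine le_trans (le_min ?_ htriv) (min_mul_le (by linarith) h1)
      rw [lookahead_sub G Ghat θ h (V h.succ)]
      have hP := (Ghat.trans h s a b).2.1
      have hPw : 0 ≤ ∑ x, (Ghat.trans h s a b).1 x * w h.succ x :=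
        Finset.sum_nonneg fun x _ => mul_nonneg (hP x) (hw0 _ x)
      have h3 := abs_inner_ret_sub_le hθ hβ₁
      have h4 : |∑ x, (Ghat.trans h s a b).1 x *
          (G.dynProg θ Φ h.succ x - Ghat.dynProg θ Φ h.succ x)| ≤
          (4 * q - 2) * ∑ x, (Ghat.trans h s a b).1 x * w h.succ x := by
        rw [Finset.mul_sum]
        refine (Finset.abs_sum_le_sum_abs _ _).trans (Finset.sum_le_sum fun x _ => ?_)
        rw [abs_mul, abs_of_nonneg (hP x), mul_left_comm]
        exact mul_le_mul_of_nonneg_left (ih x) (hP x)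
      -- The distance to the reference is bounded in two ways: by `4 q w` against the relative error
      -- `P̂ / H`, where it is absorbed into the recursion, and by the trivial `2 H` against the
      -- additive error `e`, whose sum over the states is part of the bonus.
      have h5 : |∑ x, ((G.trans h s a b).1 x - (Ghat.trans h s a b).1 x) *
          (G.dynProg θ Φ h.succ x - V h.succ x)| ≤
          1 / H * (4 * q) * (∑ x, (Ghat.trans h s a b).1 x * w h.succ x) +
            Fintype.card 𝒮 * e * (2 * H) := by
        have : (Fintype.card 𝒮 * e * (2 * H) : ℝ) = ∑ _x : 𝒮, e * (2 * H) := by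
          simp [mul_assoc]
        rw [Finset.mul_sum, this, ← Finset.sum_add_distrib]
        refine (Finset.abs_sum_le_sum_abs _ _).trans (Finset.sum_le_sum fun x _ => ?_)
        rw [abs_mul]
        have hd1 : |G.dynProg θ Φ h.succ x - V h.succ x| ≤ 4 * q * w h.succ x := by
          have h1 := abs_sub_le (G.dynProg θ Φ h.succ x) (Ghat.dynProg θ Φ h.succ x) (V h.succ x)
          have h2 := hVw h.succ x
          rw [abs_sub_comm] at h2
          linarith [ih x]
        have hd2 : |G.dynProg θ Φ h.succ x - V h.succ x| ≤ 2 * H := by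
          refine (abs_sub _ _).trans ?_
          have h1 : |G.dynProg θ Φ h.succ x| ≤ H := by
            have h2 : ((h.succ : ℕ) : ℝ) ≤ H := by exact_mod_cast h.succ.is_le
            have h3 : (0 : ℝ) ≤ (h.succ : ℕ) := by positivity
            refine (G.abs_dynProg_le θ hΦ h.succ x).trans ?_
            nlinarith [norm_nonneg θ]
          linarith [hV h.succ x]
        calc _ ≤ ((Ghat.trans h s a b).1 x / H + e) * |G.dynProg θ Φ h.succ x - V h.succ x| :=
              mul_le_mul_of_nonneg_right (he x) (abs_nonneg _)
          _ ≤ (Ghat.trans h s a b).1 x / H * (4 * q * w h.succ x) + e * (2 * H) := by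
              rw [add_mul]
              exact add_le_add
                (mul_le_mul_of_nonneg_left hd1 (div_nonneg (hP x) hH.le))
                (mul_le_mul_of_nonneg_left hd2 he0)
          _ = _ := by ring
      have h6 : 0 ≤ Fintype.card 𝒮 * e * (2 * H) := by positivity
      have h7 := abs_nonneg (∑ x, ((G.trans h s a b).1 x - (Ghat.trans h s a b).1 x) *
        V h.succ x)
      have h8 := abs_nonneg (inner ℝ θ (G.ret h s a b - Ghat.ret h s a b))
      refine (abs_add_three _ _ _ |> fun h => (abs_add_le _ _).trans (add_le_add h le_rfl)).trans ?_
      have h9 : (β₁ + β₂ + Fintype.card 𝒮 * e * (2 * H)) ≤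
          c * (β₁ + β₂ + Fintype.card 𝒮 * e * (2 * H)) :=
        le_mul_of_one_le_left (by linarith) (by linarith)
      have h10 : c * ∑ x, (Ghat.trans h s a b).1 x * w h.succ x =
          (4 * q - 2) * ∑ x, (Ghat.trans h s a b).1 x * w h.succ x +
          1 / H * (4 * q) * ∑ x, (Ghat.trans h s a b).1 x * w h.succ x := by rw [hcq]; ring
      rw [mul_add]
      linarith

theorem one_add_inv_pow_le_exp (H : ℕ) : (1 + 1 / (H : ℝ)) ^ H ≤ Real.exp 1 := by
  rcases Nat.eq_zero_or_pos H with rfl | hH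
  · simp
  · have h1 : 1 + 1 / (H : ℝ) ≤ Real.exp (1 / H) := by linarith [Real.add_one_le_exp (1 / (H : ℝ))]
    calc _ ≤ Real.exp (1 / H) ^ H := pow_le_pow_left₀ (by positivity) h1 H
      _ = Real.exp 1 := by
        rw [← Real.exp_nat_mul]
        congr 1
        field_simp

/-- The duality gap of an equilibrium of the model is at most a multiple of the error bound. -/
theorem dualityGap_le_of_isNashVIOutput [Nonempty 𝒜] [Nonempty ℬ] {s₁ : 𝒮} {μ : Policy H 𝒮 𝒜}
    {ν : Policy H 𝒮 ℬ} (hN : Ghat.IsNashVIOutput θ μ ν) (hθ : ‖θ‖ ≤ 1)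
    (hw : IsErrorBound G Ghat (G.nashValue θ) w) (hw0 : ∀ h s, 0 ≤ w h s) :
    G.dualityGap s₁ θ μ ν ≤ 18 * w 0 s₁ := by
  have hval := dynProg_eq_value (G := Ghat) (θ := θ) (μ := μ) (ν := ν)
    (Φ := fun _ _ => matrixValue) fun h s => (hN h s).matrixValue_eq
  have hmax := dynProg_eq_value (G := Ghat) (θ := θ) (μ := μ) (ν := ν)
    (Φ := fun h s => bestMax (μ h s)) fun h s => (hN h s).bestMax_eq
  have hmin := dynProg_eq_value (G := Ghat) (θ := θ) (μ := μ) (ν := ν)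
    (Φ := fun h s => bestMin (ν h s)) fun h s => (hN h s).bestMin_eq
  have hVw : ∀ h s, |G.nashValue θ h s - Ghat.value θ μ ν h s| ≤ 2 * w h s := fun h s => by
    rw [← hval]
    exact abs_dynProg_sub_dynProg_le (fun _ _ => isGameFunctional_matrixValue) hθ hw hw0 h s
  have hV : ∀ h s, |G.nashValue θ h s| ≤ H := fun h s => by
    have h2 : (h : ℝ) ≤ H := by exact_mod_cast h.is_le
    have h3 : (0 : ℝ) ≤ (h : ℕ) := by positivity
    refine (G.abs_dynProg_le θ (fun _ _ => isGameFunctional_matrixValue) h s).trans ?_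
    nlinarith [norm_nonneg θ]
  have hpow : (1 + 1 / (H : ℝ)) ^ H ≤ 2.7182818286 :=
    (one_add_inv_pow_le_exp H).trans Real.exp_one_lt_d9.le
  -- `4 exp 1 - 2 < 9`; the two players together give `18`.
  have hc : (4 * (1 + 1 / (H : ℝ)) ^ H - 2) * w 0 s₁ ≤ 9 * w 0 s₁ :=
    mul_le_mul_of_nonneg_right (by linarith) (hw0 _ _)
  have h1 := abs_dynProg_sub_dynProg_le_of_reference (Φ := fun h s => bestMax (ℬ := ℬ) (μ h s))
    (fun h s => isGameFunctional_bestMax (μ h s)) hθ hw hw0 hV (by simpa only [hmax] using hVw) 0 s₁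
  have h2 := abs_dynProg_sub_dynProg_le_of_reference (Φ := fun h s => bestMin (𝒜 := 𝒜) (ν h s))
    (fun h s => isGameFunctional_bestMin (ν h s)) hθ hw hw0 hV (by simpa only [hmin] using hVw) 0 s₁
  rw [hmax] at h1
  rw [hmin] at h2
  simp only [Fin.coe_ofNat_eq_mod, Nat.zero_mod, Nat.sub_zero] at h1 h2
  have h3 : G.valueVsBestMax θ μ 0 s₁ ≤ Ghat.value θ μ ν 0 s₁ + 9 * w 0 s₁ :=
    ciSup_le fun ν' => (G.value_le_dynProg_bestMax θ μ ν' 0 s₁).trans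
      (by linarith [(abs_le.1 h1).2])
  have h4 : Ghat.value θ μ ν 0 s₁ - 9 * w 0 s₁ ≤ G.valueVsBestMin θ ν 0 s₁ :=
    le_ciInf fun μ' => le_trans (by linarith [(abs_le.1 h2).1])
      (G.dynProg_bestMin_le_value θ μ' ν 0 s₁)
  rw [dualityGap]
  linarith

end VMG

/-! ### Multiplicative concentration for adapted variables in the unit interval. -/

section Concentration

variable {Ω : Type*} {mΩ : MeasurableSpace Ω} {P : Measure Ω} [IsProbabilityMeasure P]

theorem integral_mul_condExp_of_bound {m : MeasurableSpace Ω} (hm : m ≤ mΩ) {f g : Ω → ℝ}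
    (hf : StronglyMeasurable[m] f) {c : ℝ} (hc : ∀ ω, |f ω| ≤ c) (hg : Integrable g P) :
    ∫ ω, f ω * g ω ∂P = ∫ ω, f ω * (P[g|m]) ω ∂P := by
  rw [← integral_condExp hm (f := fun ω => f ω * g ω)]
  exact integral_congr_ae
    (condExp_stronglyMeasurable_mul_of_bound hm hf hg c (ae_of_all _ hc))

/-- Pulling a bounded predictable factor out of the conditional expectation makes the linear term of
the `cosh` supermartingale vanish. -/
theorem integral_inner_eq_zero_of_condExp {E : Type*} [NormedAddCommGroup E]
    [InnerProductSpace ℝ E] [CompleteSpace E] {m : MeasurableSpace Ω} (hm : m ≤ mΩ) {f g : Ω → E}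
    (hf : StronglyMeasurable[m] f) {c : ℝ} (hc : ∀ᵐ ω ∂P, ‖f ω‖ ≤ c) (hg : Integrable g P)
    (h0 : P[g|m] =ᵐ[P] 0) : ∫ ω, inner ℝ (f ω) (g ω) ∂P = 0 := by
  have h1 := condExp_stronglyMeasurable_bilin_of_bound (innerSL ℝ (E := E)) hm hf hg c hc
  rw [← integral_condExp hm (f := fun ω => inner ℝ (f ω) (g ω))]
  refine (integral_congr_ae h1).trans ?_
  have h2 : (fun ω => inner ℝ (f ω) ((P[g|m]) ω)) =ᵐ[P] fun _ => (0 : ℝ) := by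
    filter_upwards [h0] with ω hω
    simp [hω]
  exact (integral_congr_ae h2).trans (integral_zero _ _)

/-- From `exp y ≤ 1 + y + y²` on `[-1, 1]`, with `x² ≤ x`. The bound is linear in `x`, so the
conditional mean plays the part of the variance. -/
theorem exp_mul_le_one_add {l x : ℝ} (hl : |l| ≤ 1) (hx0 : 0 ≤ x) (hx1 : x ≤ 1) :
    Real.exp (l * x) ≤ 1 + (l + l ^ 2) * x := by
  have h1 : |l * x| ≤ 1 := by
    rw [abs_mul, abs_of_nonneg hx0]
    exact mul_le_one₀ hl hx0 hx1
  have h2 := (abs_le.1 (Real.abs_exp_sub_one_sub_id_le h1)).2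
  nlinarith [mul_nonneg (mul_nonneg (sq_nonneg l) hx0) (sub_nonneg.2 hx1)]

/-- Exponential supermartingale for random variables in the unit interval with predictable
conditional means. -/
theorem integral_exp_sum_le_one {K : ℕ} {m : Fin K → MeasurableSpace Ω} (hm : ∀ i, m i ≤ mΩ)
    {X Y : Fin K → Ω → ℝ} (hXm : ∀ i j, i < j → StronglyMeasurable[m j] (X i))
    (hX : ∀ i, StronglyMeasurable (X i)) (hYm : ∀ i j, i ≤ j → StronglyMeasurable[m j] (Y i))
    (hX01 : ∀ i ω, X i ω ∈ Set.Icc 0 1) (hY01 : ∀ i ω, Y i ω ∈ Set.Icc 0 1)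
    (hXY : ∀ i, P[X i|m i] =ᵐ[P] Y i) {l : ℝ} (hl : |l| ≤ 1) (k : ℕ) (hk : k ≤ K) :
    ∫ ω, Real.exp (∑ i : Fin k, (l * X (Fin.castLE hk i) ω - (l + l ^ 2) * Y (Fin.castLE hk i) ω))
      ∂P ≤ 1 := by
  induction k with
  | zero => simp
  | succ k ih =>
    have hk' : k ≤ K := (Nat.le_succ k).trans hk
    set j : Fin K := ⟨k, hk⟩ with hj
    set S : Ω → ℝ := fun ω => ∑ i : Fin k,
      (l * X (Fin.castLE hk' i) ω - (l + l ^ 2) * Y (Fin.castLE hk' i) ω) with hS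
    have hlt : ∀ i : Fin k, Fin.castLE hk' i < j := fun i => by simp [hj, Fin.lt_def]
    have hSm : StronglyMeasurable[m j] S := by
      refine Finset.stronglyMeasurable_fun_sum _ fun i _ => ?_
      exact ((hXm _ _ (hlt i)).const_mul l).sub ((hYm _ _ (hlt i).le).const_mul _)
    have hl2 := abs_le.1 hl
    have hstep : ∀ i ω, |l * X i ω - (l + l ^ 2) * Y i ω| ≤ 3 := fun i ω => by
      have h1 := hX01 i ω
      have h2 := hY01 i ω
      have h3 : |l * X i ω| ≤ 1 := by
        rw [abs_mul, abs_of_nonneg h1.1]; exact mul_le_one₀ hl h1.1 h1.2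
      have h4 : |(l + l ^ 2) * Y i ω| ≤ 2 := by
        rw [abs_mul, abs_of_nonneg h2.1]
        have : |l + l ^ 2| ≤ 2 := abs_le.2 ⟨by nlinarith, by nlinarith⟩
        nlinarith [h2.1, h2.2, abs_nonneg (l + l ^ 2)]
      exact (abs_sub _ _).trans (by linarith)
    have hSb : ∀ ω, |S ω| ≤ 3 * k := fun ω => by
      refine (Finset.abs_sum_le_sum_abs _ _).trans
        ((Finset.sum_le_sum fun i _ => hstep _ ω).trans ?_)
      simp [mul_comm]
    -- `Z` is known before `X j`. Thus `X j` may be replaced by its conditional mean `Y j` under the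
    -- integral, and then `1 + u ≤ exp u` cancels the compensator.
    set Z : Ω → ℝ := fun ω => Real.exp (S ω - (l + l ^ 2) * Y j ω) with hZ
    have hZm : StronglyMeasurable[m j] Z :=
      Real.continuous_exp.comp_stronglyMeasurable (hSm.sub ((hYm j j le_rfl).const_mul _))
    have hZb : ∀ ω, |Z ω| ≤ Real.exp (3 * k + 2) := fun ω => by
      rw [hZ, Real.abs_exp, Real.exp_le_exp]
      have := (abs_le.1 (hSb ω)).2
      have h2 := hY01 j ω
      nlinarith [mul_nonneg (sq_nonneg l) h2.1, h2.1, h2.2]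
    have hXint : Integrable (X j) P :=
      .of_bound (hX j).aestronglyMeasurable 1 (ae_of_all _ fun ω => by
        rw [Real.norm_eq_abs, abs_of_nonneg (hX01 j ω).1]; exact (hX01 j ω).2)
    have hYint : Integrable (Y j) P := integrable_condExp.congr (hXY j)
    have hZint : Integrable Z P :=
      .of_bound (hZm.mono (hm j)).aestronglyMeasurable _ (ae_of_all _ hZb)
    have hZXint : Integrable (fun ω => Z ω * X j ω) P :=
      hXint.bdd_mul (hZm.mono (hm j)).aestronglyMeasurable (ae_of_all _ hZb)
    have hZYint : Integrable (fun ω => Z ω * Y j ω) P :=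
      hYint.bdd_mul (hZm.mono (hm j)).aestronglyMeasurable (ae_of_all _ hZb)
    have hSint : Integrable (fun ω => Real.exp (S ω)) P :=
      .of_bound (Real.continuous_exp.comp_stronglyMeasurable
        (hSm.mono (hm j))).aestronglyMeasurable (Real.exp (3 * k)) (ae_of_all _ fun ω => by
          rw [Real.norm_eq_abs, Real.abs_exp, Real.exp_le_exp]; exact (abs_le.1 (hSb ω)).2)
    calc ∫ ω, Real.exp (∑ i : Fin (k + 1),
          (l * X (Fin.castLE hk i) ω - (l + l ^ 2) * Y (Fin.castLE hk i) ω)) ∂P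
        ≤ ∫ ω, (Z ω + (l + l ^ 2) * (Z ω * X j ω)) ∂P := by
          refine integral_mono_of_nonneg (ae_of_all _ fun ω => (Real.exp_pos _).le)
            (hZint.add (hZXint.const_mul _)) (ae_of_all _ fun ω => ?_)
          have h1 : ∑ i : Fin (k + 1),
              (l * X (Fin.castLE hk i) ω - (l + l ^ 2) * Y (Fin.castLE hk i) ω) =
              (S ω - (l + l ^ 2) * Y j ω) + l * X j ω := by
            rw [Fin.sum_univ_castSucc]
            have h2 : Fin.castLE hk (Fin.last k) = j := rfl
            have h3 : ∀ i : Fin k, Fin.castLE hk i.castSucc = Fin.castLE hk' i := fun i => rfl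
            simp only [h2, h3, hS]
            ring
          simp only [h1, Real.exp_add (S ω - _)]
          have h4 := exp_mul_le_one_add hl (hX01 j ω).1 (hX01 j ω).2
          calc Z ω * Real.exp (l * X j ω) ≤ Z ω * (1 + (l + l ^ 2) * X j ω) :=
                mul_le_mul_of_nonneg_left h4 (Real.exp_pos _).le
            _ = _ := by ring
      _ = ∫ ω, (Z ω + (l + l ^ 2) * (Z ω * Y j ω)) ∂P := by
          rw [integral_add hZint (hZXint.const_mul _), integral_add hZint (hZYint.const_mul _),
            integral_const_mul, integral_const_mul,
            integral_mul_condExp_of_bound (hm j) hZm hZb hXint]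
          congr 2
          refine integral_congr_ae ?_
          filter_upwards [hXY j] with ω hω
          rw [hω]
      _ ≤ ∫ ω, Real.exp (S ω) ∂P := by
          refine integral_mono (hZint.add (hZYint.const_mul _)) hSint fun ω => ?_
          have h1 : Real.exp (S ω) = Z ω * Real.exp ((l + l ^ 2) * Y j ω) := by
            rw [hZ, ← Real.exp_add]; congr 1; ring
          have h2 := Real.add_one_le_exp ((l + l ^ 2) * Y j ω)
          simp only [h1]
          calc Z ω + (l + l ^ 2) * (Z ω * Y j ω) = Z ω * ((l + l ^ 2) * Y j ω + 1) := by ring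
            _ ≤ _ := mul_le_mul_of_nonneg_left h2 (Real.exp_pos _).le
      _ ≤ 1 := ih hk'

theorem measure_lt_le_exp_neg {f : Ω → ℝ} {c : ℝ}
    (hint : Integrable (fun ω => Real.exp (f ω)) P) (h : ∫ ω, Real.exp (f ω) ∂P ≤ c) (L : ℝ) :
    P {ω | L < f ω} ≤ ENNReal.ofReal (c * Real.exp (-L)) := by
  have h1 := mul_meas_ge_le_integral_of_nonneg (ae_of_all P fun ω => (Real.exp_pos (f ω)).le) hint
    (Real.exp L)
  have h2 : P.real {ω | L < f ω} ≤ P.real {ω | Real.exp L ≤ Real.exp (f ω)} :=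
    measureReal_mono fun ω hω => Real.exp_le_exp.2 (le_of_lt hω)
  rw [← ENNReal.ofReal_toReal (measure_ne_top P {ω | L < f ω})]
  apply ENNReal.ofReal_le_ofReal
  rw [Real.exp_neg, ← div_eq_mul_inv, le_div_iff₀ (Real.exp_pos L)]
  have h3 : 0 < Real.exp L := Real.exp_pos L
  calc P.real {ω | L < f ω} * Real.exp L ≤ P.real {ω | Real.exp L ≤ Real.exp (f ω)} * Real.exp L :=
        mul_le_mul_of_nonneg_right h2 h3.le
    _ ≤ c := by linarith

/-- Multiplicative concentration for sums of random variables in the unit interval around the sums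
of their conditional means. -/
theorem measure_abs_sum_sub_sum_gt_le {K : ℕ} {m : Fin K → MeasurableSpace Ω}
    (hm : ∀ i, m i ≤ mΩ)
    {X Y : Fin K → Ω → ℝ} (hXm : ∀ i j, i < j → StronglyMeasurable[m j] (X i))
    (hX : ∀ i, StronglyMeasurable (X i)) (hYm : ∀ i j, i ≤ j → StronglyMeasurable[m j] (Y i))
    (hX01 : ∀ i ω, X i ω ∈ Set.Icc 0 1) (hY01 : ∀ i ω, Y i ω ∈ Set.Icc 0 1)
    (hXY : ∀ i, P[X i|m i] =ᵐ[P] Y i) {η : ℝ} (hη0 : 0 < η) (hη1 : η ≤ 1) (L : ℝ)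
    (k : ℕ) (hk : k ≤ K) :
    P {ω | ¬ |∑ i : Fin k, X (Fin.castLE hk i) ω - ∑ i : Fin k, Y (Fin.castLE hk i) ω| ≤
      η * ∑ i : Fin k, Y (Fin.castLE hk i) ω + L / η} ≤ ENNReal.ofReal (2 * Real.exp (-L)) := by
  set f : ℝ → Ω → ℝ := fun l ω =>
    ∑ i : Fin k, (l * X (Fin.castLE hk i) ω - (l + l ^ 2) * Y (Fin.castLE hk i) ω) with hf
  have hfint : ∀ l, Integrable (fun ω => Real.exp (f l ω)) P := fun l => by
    have hmeas : StronglyMeasurable (f l) :=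
      Finset.stronglyMeasurable_fun_sum _ fun i _ =>
        ((hX _).const_mul l).sub (((hYm _ _ le_rfl).mono (hm _)).const_mul _)
    refine .of_bound (Real.continuous_exp.comp_stronglyMeasurable hmeas).aestronglyMeasurable
      (Real.exp (∑ _i : Fin k, (|l| + |l + l ^ 2|))) (ae_of_all _ fun ω => ?_)
    rw [Real.norm_eq_abs, Real.abs_exp, Real.exp_le_exp]
    refine Finset.sum_le_sum fun i _ => ?_
    have h1 := hX01 (Fin.castLE hk i) ω
    have h2 := hY01 (Fin.castLE hk i) ω
    nlinarith [mul_le_mul_of_nonneg_right (le_abs_self l) h1.1,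
      mul_le_mul_of_nonneg_right (neg_abs_le (l + l ^ 2)) h2.1,
      mul_le_mul_of_nonneg_left h1.2 (abs_nonneg l),
      mul_le_mul_of_nonneg_left h2.2 (abs_nonneg (l + l ^ 2))]
  have htail : ∀ l, |l| ≤ 1 → P {ω | L < f l ω} ≤ ENNReal.ofReal (1 * Real.exp (-L)) :=
    fun l hl => measure_lt_le_exp_neg (hfint l)
      (integral_exp_sum_le_one hm hXm hX hYm hX01 hY01 hXY hl k hk) L
  have habs : |η| ≤ 1 := by rwa [abs_of_pos hη0]
  have hsub : {ω | ¬ |∑ i : Fin k, X (Fin.castLE hk i) ω - ∑ i : Fin k, Y (Fin.castLE hk i) ω| ≤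
      η * ∑ i : Fin k, Y (Fin.castLE hk i) ω + L / η} ⊆
      -- The parameters `η` and `-η` give the upper and the lower deviation; dividing by `η`
      -- produces the error `L / η`.
      {ω | L < f η ω} ∪ {ω | L < f (-η) ω} := by
    intro ω hω
    by_contra hcon
    simp only [Set.mem_union, Set.mem_ofPred_eq, not_or, not_lt] at hcon
    apply hω
    obtain ⟨h1, h2⟩ := hcon
    simp only [hf, Finset.sum_sub_distrib, ← Finset.mul_sum] at h1 h2
    set S := ∑ i : Fin k, X (Fin.castLE hk i) ω
    set C := ∑ i : Fin k, Y (Fin.castLE hk i) ω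
    have hL : L = η * (L / η) := by field_simp
    rw [abs_le]
    constructor
    · have : η * (-(η * C + L / η)) ≤ η * (S - C) := by nlinarith
      exact le_of_mul_le_mul_left this hη0
    · have : η * (S - C) ≤ η * (η * C + L / η) := by nlinarith
      exact le_of_mul_le_mul_left this hη0
  calc _ ≤ P ({ω | L < f η ω} ∪ {ω | L < f (-η) ω}) := measure_mono hsub
    _ ≤ ENNReal.ofReal (1 * Real.exp (-L)) + ENNReal.ofReal (1 * Real.exp (-L)) :=
      (measure_union_le _ _).trans (add_le_add (htail η habs) (htail (-η) (by rwa [abs_neg])))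
    _ = _ := by
      rw [← ENNReal.ofReal_add (by positivity) (by positivity)]
      congr 1
      ring

end Concentration

/-! ### Dimension-free concentration for martingales in a Hilbert space. -/

section HilbertConcentration

/-- The power series of `cosh √t` in `t` has nonnegative coefficients. -/
theorem convexOn_cosh_sqrt : ConvexOn ℝ (Set.Ici 0) fun t : ℝ => Real.cosh √t := by
  have hs : ∀ t : ℝ, 0 ≤ t → HasSum (fun n : ℕ => t ^ n / (2 * n).factorial) (Real.cosh √t) := by
    intro t ht
    convert Real.hasSum_cosh √t using 3 with n
    rw [pow_mul, Real.sq_sqrt ht]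
  refine ⟨convex_Ici 0, fun x hx y hy a b ha hb hab => ?_⟩
  have hx' : (0 : ℝ) ≤ x := hx
  have hy' : (0 : ℝ) ≤ y := hy
  have hxy : 0 ≤ a * x + b * y := by positivity
  refine hasSum_le (fun n => ?_) (hs _ hxy) (((hs x hx').mul_left a).add ((hs y hy').mul_left b))
  have h1 := (convexOn_pow n).2 hx hy ha hb hab
  rw [← mul_div_assoc, ← mul_div_assoc, ← add_div]
  exact div_le_div_of_nonneg_right h1 (Nat.cast_nonneg _)

/-- With `s` the inner product of `x` and `y` divided by `a ‖x‖`, the square `‖x + y‖²` is at most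
the average of `(‖x‖ ± a)²` with weights `(1 ± s) / 2`, so convexity of `cosh √t` applies. The term
containing `s` is linear in `y` and disappears in conditional expectation. At `x = 0` its
coefficient is harmless, as it multiplies the zero vector. -/
theorem cosh_norm_add_le {E : Type*} [NormedAddCommGroup E] [InnerProductSpace ℝ E] (x y : E)
    {a : ℝ} (ha : 0 < a) (hy : ‖y‖ ≤ a) :
    Real.cosh ‖x + y‖ ≤ Real.cosh a * Real.cosh ‖x‖ +
      inner ℝ ((Real.sinh a / a * (Real.sinh ‖x‖ / ‖x‖)) • x) y := by
  rcases eq_or_ne x 0 with rfl | hx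
  · have : |‖y‖| ≤ |a| := by rwa [abs_of_nonneg (norm_nonneg y), abs_of_pos ha]
    simpa using Real.cosh_le_cosh.2 this
  · have hx0 : 0 < ‖x‖ := norm_pos_iff.2 hx
    set s : ℝ := inner ℝ x y / (a * ‖x‖) with hs
    have hsx : inner ℝ x y = s * (a * ‖x‖) := by rw [hs]; field_simp
    have hs1 : |s| ≤ 1 := by
      rw [hs, abs_div, abs_of_pos (mul_pos ha hx0), div_le_one (mul_pos ha hx0)]
      refine (abs_real_inner_le_norm x y).trans ?_
      rw [mul_comm]
      exact mul_le_mul_of_nonneg_right hy hx0.le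
    obtain ⟨hs1, hs2⟩ := abs_le.1 hs1
    have h1 : ‖x + y‖ ≤ √((1 + s) / 2 * (‖x‖ + a) ^ 2 + (1 - s) / 2 * (‖x‖ - a) ^ 2) := by
      apply Real.le_sqrt_of_sq_le
      rw [norm_add_sq_real, hsx]
      nlinarith [norm_nonneg y]
    have h2 := convexOn_cosh_sqrt.2 (Set.mem_Ici.2 (sq_nonneg (‖x‖ + a)))
      (Set.mem_Ici.2 (sq_nonneg (‖x‖ - a))) (show 0 ≤ (1 + s) / 2 by linarith)
      (show 0 ≤ (1 - s) / 2 by linarith) (by ring)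
    simp only [smul_eq_mul, Real.sqrt_sq_eq_abs, Real.cosh_abs] at h2
    calc Real.cosh ‖x + y‖ ≤ _ := Real.cosh_le_cosh.2 (by
          rwa [abs_of_nonneg (norm_nonneg _), abs_of_nonneg (Real.sqrt_nonneg _)])
      _ ≤ _ := h2
      _ = Real.cosh a * Real.cosh ‖x‖ + s * (Real.sinh a * Real.sinh ‖x‖) := by
          rw [Real.cosh_add, Real.cosh_sub]; ring
      _ = _ := by
          rw [real_inner_smul_left, hsx]
          field_simp

variable {Ω : Type*} {mΩ : MeasurableSpace Ω} {P : Measure Ω} [IsProbabilityMeasure P]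
  {E : Type*} [NormedAddCommGroup E] [InnerProductSpace ℝ E] [CompleteSpace E]

/-- Each step with `N = 1` multiplies the conditional mean of `cosh ‖·‖` by at most `cosh a ≤ exp
(a² / 2)`, for which the exponential compensates; steps with `N = 0` change nothing. Hence the
compensator counts visits rather than episodes. -/
theorem integral_cosh_norm_sum_le_one {K : ℕ} {m : Fin K → MeasurableSpace Ω} (hm : ∀ i, m i ≤ mΩ)
    {D : Fin K → Ω → E} {N : Fin K → Ω → ℝ}
    (hDm : ∀ i j, i < j → StronglyMeasurable[m j] (D i))
    (hD : ∀ i, StronglyMeasurable (D i)) (hNm : ∀ i j, i ≤ j → StronglyMeasurable[m j] (N i))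
    (hN01 : ∀ i ω, N i ω = 0 ∨ N i ω = 1) {a : ℝ} (ha : 0 < a)
    (hDb : ∀ i, ∀ᵐ ω ∂P, ‖D i ω‖ ≤ a * N i ω)
    (hD0 : ∀ i, P[D i|m i] =ᵐ[P] 0) (k : ℕ) (hk : k ≤ K) :
    Integrable (fun ω => Real.cosh ‖∑ i : Fin k, D (Fin.castLE hk i) ω‖ *
      Real.exp (-(a ^ 2 / 2 * ∑ i : Fin k, N (Fin.castLE hk i) ω))) P ∧
    ∫ ω, Real.cosh ‖∑ i : Fin k, D (Fin.castLE hk i) ω‖ *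
      Real.exp (-(a ^ 2 / 2 * ∑ i : Fin k, N (Fin.castLE hk i) ω)) ∂P ≤ 1 := by
  have hDb' : ∀ᵐ ω ∂P, ∀ i, ‖D i ω‖ ≤ a * N i ω := ae_all_iff.2 hDb
  have hN0 : ∀ i ω, 0 ≤ N i ω := fun i ω => by rcases hN01 i ω with h | h <;> simp [h]
  have hN1 : ∀ i ω, N i ω ≤ 1 := fun i ω => by rcases hN01 i ω with h | h <;> simp [h]
  have hMb : ∀ k (hk : k ≤ K), ∀ᵐ ω ∂P, ‖∑ i : Fin k, D (Fin.castLE hk i) ω‖ ≤ k * a := by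
    intro k hk
    filter_upwards [hDb'] with ω hω
    refine (norm_sum_le _ _).trans ?_
    calc ∑ i : Fin k, ‖D (Fin.castLE hk i) ω‖ ≤ ∑ _i : Fin k, a :=
          Finset.sum_le_sum fun i _ => (hω _).trans (mul_le_of_le_one_right ha.le (hN1 _ _))
      _ = k * a := by simp
  have hWb : ∀ k (hk : k ≤ K) ω,
      Real.exp (-(a ^ 2 / 2 * ∑ i : Fin k, N (Fin.castLE hk i) ω)) ≤ 1 := by
    intro k hk ω
    rw [Real.exp_le_one_iff, neg_nonpos]
    exact mul_nonneg (by positivity) (Finset.sum_nonneg fun i _ => hN0 _ _)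
  have hint : ∀ k (hk : k ≤ K), Integrable (fun ω =>
      Real.cosh ‖∑ i : Fin k, D (Fin.castLE hk i) ω‖ *
      Real.exp (-(a ^ 2 / 2 * ∑ i : Fin k, N (Fin.castLE hk i) ω))) P := by
    intro k hk
    refine .of_bound (StronglyMeasurable.mul (Real.continuous_cosh.comp_stronglyMeasurable
      (Finset.stronglyMeasurable_fun_sum _ fun i _ => hD _).norm)
      (Real.continuous_exp.comp_stronglyMeasurable ((Finset.stronglyMeasurable_fun_sum _
        fun i _ => (hNm _ _ le_rfl).mono (hm _)).const_mul _).neg)).aestronglyMeasurable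
      (Real.cosh (k * a)) ?_
    filter_upwards [hMb k hk] with ω hω
    rw [Real.norm_eq_abs, abs_mul, Real.abs_exp, abs_of_pos (Real.cosh_pos _)]
    refine (mul_le_of_le_one_right (Real.cosh_pos _).le (hWb k hk ω)).trans ?_
    rw [Real.cosh_le_cosh, abs_of_nonneg (norm_nonneg _)]
    exact hω.trans (le_abs_self _)
  refine ⟨hint k hk, ?_⟩
  induction k with
  | zero => simp
  | succ k ih =>
    have hk' : k ≤ K := (Nat.le_succ k).trans hk
    set j : Fin K := ⟨k, hk⟩ with hj
    set M : Ω → E := fun ω => ∑ i : Fin k, D (Fin.castLE hk' i) ω with hM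
    set n : Ω → ℝ := fun ω => ∑ i : Fin k, N (Fin.castLE hk' i) ω with hn
    have hlt : ∀ i : Fin k, Fin.castLE hk' i < j := fun i => by simp [hj, Fin.lt_def]
    have hMm : StronglyMeasurable[m j] M :=
      Finset.stronglyMeasurable_fun_sum _ fun i _ => hDm _ _ (hlt i)
    have hnm : StronglyMeasurable[m j] n :=
      Finset.stronglyMeasurable_fun_sum _ fun i _ => hNm _ _ (hlt i).le
    have hMs : ∀ ω, ∑ i : Fin (k + 1), D (Fin.castLE hk i) ω = M ω + D j ω := fun ω => by
      rw [Fin.sum_univ_castSucc]; rfl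
    have hns : ∀ ω, ∑ i : Fin (k + 1), N (Fin.castLE hk i) ω = n ω + N j ω := fun ω => by
      rw [Fin.sum_univ_castSucc]; rfl
    set w : Ω → ℝ := fun ω => Real.exp (-(a ^ 2 / 2 * (n ω + N j ω))) with hw
    have hw1 : ∀ ω, w ω ≤ 1 := fun ω => by simpa only [hw, hns] using hWb (k + 1) hk ω
    have hwm : StronglyMeasurable[m j] w :=
      Real.continuous_exp.comp_stronglyMeasurable ((hnm.add (hNm j j le_rfl)).const_mul _).neg
    -- The predictable vector of the linear term in `cosh_norm_add_le`, including the weight `w`.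
    set g : Ω → E := fun ω =>
      (w ω * (Real.sinh a / a * (Real.sinh ‖M ω‖ / ‖M ω‖))) • M ω with hg
    have hgm : StronglyMeasurable[m j] g := by
      refine StronglyMeasurable.smul (hwm.mul (StronglyMeasurable.const_mul ?_ _)) hMm
      have h1 : Measurable fun r : ℝ => Real.sinh r / r :=
        Real.measurable_sinh.div measurable_id
      exact (h1.comp hMm.norm.measurable).stronglyMeasurable
    have hgb : ∀ᵐ ω ∂P, ‖g ω‖ ≤ Real.sinh a / a * Real.sinh (k * a) := by
      filter_upwards [hMb k hk'] with ω hω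
      have hs0 : 0 ≤ Real.sinh a / a := div_nonneg (Real.sinh_nonneg_iff.2 ha.le) ha.le
      have hsM : 0 ≤ Real.sinh ‖M ω‖ := Real.sinh_nonneg_iff.2 (norm_nonneg _)
      rw [hg, norm_smul, Real.norm_eq_abs, abs_of_nonneg (by positivity)]
      have h1 : Real.sinh ‖M ω‖ / ‖M ω‖ * ‖M ω‖ ≤ Real.sinh ‖M ω‖ := by
        rcases eq_or_ne ‖M ω‖ 0 with h | h
        · simp [h]
        · rw [div_mul_cancel₀ _ h]
      have h2 : Real.sinh ‖M ω‖ ≤ Real.sinh (k * a) := Real.sinh_le_sinh.2 hω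
      have h3 : 0 ≤ Real.sinh ‖M ω‖ / ‖M ω‖ * ‖M ω‖ := by positivity
      calc w ω * (Real.sinh a / a * (Real.sinh ‖M ω‖ / ‖M ω‖)) * ‖M ω‖
          = w ω * (Real.sinh a / a * (Real.sinh ‖M ω‖ / ‖M ω‖ * ‖M ω‖)) := by ring
        _ ≤ 1 * (Real.sinh a / a * (Real.sinh ‖M ω‖ / ‖M ω‖ * ‖M ω‖)) :=
          mul_le_mul_of_nonneg_right (hw1 ω) (by positivity)
        _ ≤ _ := by
          rw [one_mul]
          exact mul_le_mul_of_nonneg_left (h1.trans h2) hs0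
    have hDint : Integrable (D j) P := by
      refine .of_bound (hD j).aestronglyMeasurable a ?_
      filter_upwards [hDb j] with ω hω
      exact hω.trans (mul_le_of_le_one_right ha.le (hN1 _ _))
    have hgDint : Integrable (fun ω => inner ℝ (g ω) (D j ω)) P := by
      refine .of_bound ((hgm.mono (hm j)).inner (hD j)).aestronglyMeasurable
        (Real.sinh a / a * Real.sinh (k * a) * a) ?_
      filter_upwards [hgb, hDb j] with ω h1 h2
      refine (norm_inner_le_norm _ _).trans ?_
      exact mul_le_mul h1 (h2.trans (mul_le_of_le_one_right ha.le (hN1 _ _))) (norm_nonneg _)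
        ((norm_nonneg _).trans h1)
    have hzero := integral_inner_eq_zero_of_condExp (hm j) hgm hgb hDint (hD0 j)
    simp only [hMs, hns]
    calc ∫ ω, Real.cosh ‖M ω + D j ω‖ * w ω ∂P
        ≤ ∫ ω, (Real.cosh ‖M ω‖ * Real.exp (-(a ^ 2 / 2 * n ω)) + inner ℝ (g ω) (D j ω)) ∂P := by
          refine integral_mono_ae (by simpa only [hMs, hns] using hint (k + 1) hk)
            ((hint k hk').add hgDint) ?_
          filter_upwards [hDb j] with ω hω
          have hexp : w ω = Real.exp (-(a ^ 2 / 2 * n ω)) * Real.exp (-(a ^ 2 / 2 * N j ω)) := by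
            simp only [hw]; rw [← Real.exp_add]; congr 1; ring
          rcases hN01 j ω with h0 | h0
          · have hD0 : D j ω = 0 := by simpa [h0] using hω
            simp [hexp, hD0, h0]
          · rw [h0, mul_one] at hω
            have h1 := mul_le_mul_of_nonneg_right (cosh_norm_add_le (M ω) (D j ω) ha hω)
              (Real.exp_pos (-(a ^ 2 / 2 * (n ω + N j ω)))).le
            refine h1.trans ?_
            have h2 : Real.cosh a * Real.exp (-(a ^ 2 / 2)) ≤ 1 := by
              rw [Real.exp_neg, ← div_eq_mul_inv, div_le_one (Real.exp_pos _)]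
              exact Real.cosh_le_exp_half_sq a
            have h3 : inner ℝ (g ω) (D j ω) = inner ℝ ((Real.sinh a / a *
                (Real.sinh ‖M ω‖ / ‖M ω‖)) • M ω) (D j ω) * w ω := by
              rw [hg, real_inner_smul_left, real_inner_smul_left]; ring
            rw [add_mul, h3]
            refine add_le_add ?_ le_rfl
            calc Real.cosh a * Real.cosh ‖M ω‖ * w ω
                = Real.cosh ‖M ω‖ * Real.exp (-(a ^ 2 / 2 * n ω)) *
                  (Real.cosh a * Real.exp (-(a ^ 2 / 2))) := by rw [hexp, h0, mul_one]; ring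
              _ ≤ _ := mul_le_of_le_one_right (mul_nonneg (Real.cosh_pos _).le
                  (Real.exp_pos _).le) h2
      _ = ∫ ω, Real.cosh ‖M ω‖ * Real.exp (-(a ^ 2 / 2 * n ω)) ∂P := by
          rw [integral_add (hint k hk') hgDint, hzero, add_zero]
      _ ≤ 1 := ih hk'

/-- Dimension-free concentration of Hilbert space valued martingales with bounded differences; the
differences vanish where `N` does, and the tail is in terms of the sum of `N`. -/
theorem measure_norm_sum_gt_le {K : ℕ} {m : Fin K → MeasurableSpace Ω} (hm : ∀ i, m i ≤ mΩ)
    {D : Fin K → Ω → E} {N : Fin K → Ω → ℝ}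
    (hDm : ∀ i j, i < j → StronglyMeasurable[m j] (D i))
    (hD : ∀ i, StronglyMeasurable (D i)) (hNm : ∀ i j, i ≤ j → StronglyMeasurable[m j] (N i))
    (hN01 : ∀ i ω, N i ω = 0 ∨ N i ω = 1) {c : ℝ} (hc : 0 < c)
    (hDb : ∀ i, ∀ᵐ ω ∂P, ‖D i ω‖ ≤ c * N i ω)
    (hD0 : ∀ i, P[D i|m i] =ᵐ[P] 0) {l : ℝ} (hl : 0 < l) (L : ℝ) (k : ℕ) (hk : k ≤ K) :
    P {ω | ¬ l * ‖∑ i : Fin k, D (Fin.castLE hk i) ω‖ ≤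
      (l * c) ^ 2 / 2 * ∑ i : Fin k, N (Fin.castLE hk i) ω + L} ≤
      ENNReal.ofReal (2 * Real.exp (-L)) := by
  obtain ⟨h1, h2⟩ := integral_cosh_norm_sum_le_one hm (D := fun i ω => l • D i ω) (N := N)
    (fun i j hij => (hDm i j hij).const_smul l) (fun i => (hD i).const_smul l) hNm hN01
    (mul_pos hl hc)
    (fun i => by
      filter_upwards [hDb i] with ω hω
      rw [norm_smul, Real.norm_eq_abs, abs_of_pos hl, mul_assoc]
      exact mul_le_mul_of_nonneg_left hω hl.le)
    (fun i => by
      refine (condExp_smul l (D i) (m i)).trans ?_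
      filter_upwards [hD0 i] with ω hω
      simp [hω]) k hk
  set y : Ω → ℝ := fun ω => l * ‖∑ i : Fin k, D (Fin.castLE hk i) ω‖ with hy
  set n : Ω → ℝ := fun ω => (l * c) ^ 2 / 2 * ∑ i : Fin k, N (Fin.castLE hk i) ω with hn
  have hyn : ∀ ω, ‖∑ i : Fin k, l • D (Fin.castLE hk i) ω‖ = y ω := fun ω => by
    rw [← Finset.smul_sum, norm_smul, Real.norm_eq_abs, abs_of_pos hl]
  simp only [hyn] at h1 h2
  -- `exp y ≤ 2 cosh y` is the source of the factor `2` in the tail.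
  have hle : ∀ ω, Real.exp (y ω - n ω) ≤ 2 * (Real.cosh (y ω) * Real.exp (-n ω)) := fun ω => by
    rw [sub_eq_add_neg, Real.exp_add, ← mul_assoc]
    refine mul_le_mul_of_nonneg_right ?_ (Real.exp_pos _).le
    rw [Real.cosh_eq]
    linarith [Real.exp_pos (-y ω)]
  have hmeas : StronglyMeasurable fun ω => y ω - n ω :=
    ((Finset.stronglyMeasurable_fun_sum _ fun i _ => hD _).norm.const_mul l).sub
      ((Finset.stronglyMeasurable_fun_sum _ fun i _ => (hNm _ _ le_rfl).mono (hm _)).const_mul _)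
  have hint : Integrable (fun ω => Real.exp (y ω - n ω)) P :=
    (h1.const_mul 2).mono' (Real.continuous_exp.comp_stronglyMeasurable hmeas).aestronglyMeasurable
      (ae_of_all _ fun ω => by rw [Real.norm_eq_abs, Real.abs_exp]; exact hle ω)
  have hI : ∫ ω, Real.exp (y ω - n ω) ∂P ≤ 2 := by
    refine (integral_mono hint (h1.const_mul 2) hle).trans ?_
    rw [integral_const_mul]
    linarith
  refine (measure_mono fun ω hω => ?_).trans (measure_lt_le_exp_neg hint hI L)
  simp only [Set.mem_ofPred_eq, not_le] at hω ⊢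
  simp only [hy, hn]
  linarith

end HilbertConcentration

/-! ### Measurability of finitely valued maps, without a measurable structure on their range. -/

section Determined

variable {Ω : Type*} {α β : Type*}

/-- The value of `f` is known, given the information `m`. -/
def DeterminedBy (m : MeasurableSpace Ω) (f : Ω → α) : Prop :=
  ∀ a, MeasurableSet[m] (f ⁻¹' {a})

theorem DeterminedBy.mono {m m' : MeasurableSpace Ω} {f : Ω → α} (hf : DeterminedBy m f)
    (h : m ≤ m') : DeterminedBy m' f := fun a => h _ (hf a)

theorem DeterminedBy.comp [Finite α] {m : MeasurableSpace Ω} {f : Ω → α} (hf : DeterminedBy m f)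
    (g : α → β) : DeterminedBy m fun ω => g (f ω) := by
  intro b
  have : (fun ω => g (f ω)) ⁻¹' {b} = ⋃ a ∈ g ⁻¹' {b}, f ⁻¹' {a} := by
    ext ω
    simp
  rw [this]
  exact MeasurableSet.biUnion (Set.toFinite _).countable fun a _ => hf a

theorem DeterminedBy.prodMk {m : MeasurableSpace Ω} {f : Ω → α} {g : Ω → β}
    (hf : DeterminedBy m f) (hg : DeterminedBy m g) : DeterminedBy m fun ω => (f ω, g ω) := by
  rintro ⟨a, b⟩
  have : (fun ω => (f ω, g ω)) ⁻¹' {(a, b)} = f ⁻¹' {a} ∩ g ⁻¹' {b} := by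
    ext ω
    simp
  rw [this]
  exact (hf a).inter (hg b)

theorem DeterminedBy.pi {ι : Type*} [Finite ι] {m : MeasurableSpace Ω} {f : ι → Ω → α}
    (hf : ∀ i, DeterminedBy m (f i)) : DeterminedBy m fun ω i => f i ω := by
  intro a
  have : (fun ω i => f i ω) ⁻¹' {a} = ⋂ i, f i ⁻¹' {a i} := by
    ext ω
    simp [funext_iff]
  rw [this]
  exact MeasurableSet.iInter fun i => hf i (a i)

theorem DeterminedBy.stronglyMeasurable [Finite α] [TopologicalSpace β] {m : MeasurableSpace Ω}
    {f : Ω → α} (hf : DeterminedBy m f) (g : α → β) : StronglyMeasurable[m] fun ω => g (f ω) :=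
  let F : @SimpleFunc Ω m α := @SimpleFunc.mk Ω m α f hf (Set.toFinite _)
  (@SimpleFunc.map Ω α β m g F).stronglyMeasurable

end Determined

instance Episode.instFinite {H : ℕ} {𝒮 𝒜 ℬ : Type*} [Finite 𝒮] [Finite 𝒜] [Finite ℬ] :
    Finite (Episode H 𝒮 𝒜 ℬ) :=
  Finite.of_injective (fun e : Episode H 𝒮 𝒜 ℬ => (e.state, e.act)) fun e e' h => by
    cases e; cases e'; simpa using h

/-! ### The exploration process: adaptedness and concentration over episodes. -/

namespace ExplorationRun

variable {K d H : ℕ} {𝒮 𝒜 ℬ : Type*} [Fintype 𝒮] [Fintype 𝒜] [Fintype ℬ]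
  {alg : ExplorePlan K d H 𝒮 𝒜 ℬ} {G : VMG d H 𝒮 𝒜 ℬ} {s₁ : 𝒮}
  {Ω : Type*} {mΩ : MeasurableSpace Ω} {P : Measure Ω}

/-- The first `k` episodes. -/
def past (R : ExplorationRun alg G s₁ P) (k : ℕ) (hk : k ≤ K) (ω : Ω) :
    Fin k → Episode H 𝒮 𝒜 ℬ :=
  fun i => R.episode (Fin.castLE hk i) ω

/-- The state and the joint action of step `h` in episode `k`. -/
def triple (R : ExplorationRun alg G s₁ P) (k : Fin K) (h : Fin H) (ω : Ω) : 𝒮 × 𝒜 × ℬ :=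
  ((R.episode k ω).state h.castSucc, (R.episode k ω).act h)

variable (R : ExplorationRun alg G s₁ P)

theorem determinedBy_state (k : Fin K) (h : Fin (H + 1)) :
    DeterminedBy (R.ℱ (k * (H + 1) + h)) fun ω => (R.episode k ω).state h :=
  fun s => R.measurable_state k h s

/-- Only the states are assumed to be adapted. The actions are functions of the states and of the
earlier episodes, so strong induction over the episodes applies; finiteness makes every such
function measurable. -/
theorem determinedBy_episode (k : Fin K) :
    DeterminedBy (R.ℱ (k * (H + 1) + H)) (R.episode k) := by
  induction k using WellFoundedLT.induction with
  | ind k ih =>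
    have hpast : DeterminedBy (R.ℱ (k * (H + 1) + H)) (R.past k k.isLt.le) :=
      DeterminedBy.pi fun i => (ih (Fin.castLE k.isLt.le i) (by simp [Fin.lt_def])).mono
        (R.ℱ.mono (by
          have : ((Fin.castLE k.isLt.le i : Fin K) : ℕ) ≤ k := i.isLt.le
          gcongr))
    have hstate : DeterminedBy (R.ℱ (k * (H + 1) + H)) fun ω h => (R.episode k ω).state h :=
      DeterminedBy.pi fun h => (R.determinedBy_state k h).mono (R.ℱ.mono (by
        have := h.is_le
        omega))
    have hfun : R.episode k = fun ω =>
        (fun q : (Fin k → Episode H 𝒮 𝒜 ℬ) × (Fin (H + 1) → 𝒮) =>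
          (⟨q.2, fun h => alg.explore k q.1 h (q.2 h.castSucc)⟩ : Episode H 𝒮 𝒜 ℬ))
          (R.past k k.isLt.le ω, fun h => (R.episode k ω).state h) := by
      funext ω
      have := fun h => R.act_eq k h ω
      rcases he : R.episode k ω with ⟨st, ac⟩
      rw [he] at this
      simp only [Episode.mk.injEq, true_and]
      funext h
      exact this h
    rw [hfun]
    exact (hpast.prodMk hstate).comp fun q : (Fin k → Episode H 𝒮 𝒜 ℬ) × (Fin (H + 1) → 𝒮) =>
      (⟨q.2, fun h => alg.explore k q.1 h (q.2 h.castSucc)⟩ : Episode H 𝒮 𝒜 ℬ)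

theorem determinedBy_past (k : Fin K) (h : Fin H) :
    DeterminedBy (R.ℱ (k * (H + 1) + h)) (R.past k k.isLt.le) :=
  DeterminedBy.pi fun i => (R.determinedBy_episode (Fin.castLE k.isLt.le i)).mono
    (R.ℱ.mono (by
      have h1 : ((Fin.castLE k.isLt.le i : Fin K) : ℕ) + 1 ≤ k := i.isLt
      nlinarith))

/-- The joint action is prescribed by the past episodes and the current state, so it is known before
the transition. -/
theorem determinedBy_past_triple (k : Fin K) (h : Fin H) :
    DeterminedBy (R.ℱ (k * (H + 1) + h)) fun ω => (R.past k k.isLt.le ω, R.triple k h ω) := by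
  have h1 := (R.determinedBy_past k h).prodMk (R.determinedBy_state k h.castSucc)
  have h2 : (fun ω => (R.past k k.isLt.le ω, R.triple k h ω)) = fun ω =>
      (fun q : (Fin k → Episode H 𝒮 𝒜 ℬ) × 𝒮 => (q.1, q.2, alg.explore k q.1 h q.2))
        (R.past k k.isLt.le ω, (R.episode k ω).state h.castSucc) := by
    funext ω
    simp only [triple, R.act_eq k h ω]
    rfl
  rw [h2]
  exact h1.comp fun q : (Fin k → Episode H 𝒮 𝒜 ℬ) × 𝒮 => (q.1, q.2, alg.explore k q.1 h q.2)

theorem determinedBy_triple (k : Fin K) (h : Fin H) :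
    DeterminedBy (R.ℱ (k * (H + 1) + h)) (R.triple k h) :=
  (R.determinedBy_past_triple k h).comp Prod.snd

/-- All of episode `i` is over before step `h` of episode `j`. Sums over episodes at a fixed `h` are
therefore adapted, although the filtration runs over single steps. -/
theorem index_lt {i j : Fin K} (hij : i < j) (h : Fin H) :
    (i : ℕ) * (H + 1) + H ≤ j * (H + 1) + h := by
  have h1 : (i : ℕ) + 1 ≤ j := hij
  nlinarith

/-- The expectation of `f` at the state that follows the triple `p` in step `h`. -/
noncomputable def _root_.VMG.expNext (G : VMG d H 𝒮 𝒜 ℬ) (h : Fin H) (p : 𝒮 × 𝒜 × ℬ)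
    (f : 𝒮 → ℝ) : ℝ :=
  ∑ x, (G.trans h p.1 p.2.1 p.2.2).1 x * f x

variable [IsProbabilityMeasure P]

/-- Write the function as a sum over the possible next states of a predictable coefficient times an
indicator. The coefficient may depend on the past, as needed for the uncertainty functions of the
algorithm. -/
theorem condExp_next (k : Fin K) (h : Fin H)
    (g : (Fin k → Episode H 𝒮 𝒜 ℬ) × 𝒮 × 𝒜 × ℬ → 𝒮 → ℝ) (hg : ∀ q x, g q x ∈ Set.Icc 0 1) :
    P[fun ω => g (R.past k k.isLt.le ω, R.triple k h ω) ((R.episode k ω).state h.succ) |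
        R.ℱ (k * (H + 1) + h)] =ᵐ[P]
      fun ω => G.expNext h (R.triple k h ω) (g (R.past k k.isLt.le ω, R.triple k h ω)) := by
  classical
  have hm : R.ℱ (k * (H + 1) + h) ≤ mΩ := R.ℱ.le _
  set I : 𝒮 → Ω → ℝ := fun x =>
    Set.indicator {ω | (R.episode k ω).state h.succ = x} (fun _ => (1 : ℝ)) with hI
  set f : 𝒮 → Ω → ℝ := fun x ω => g (R.past k k.isLt.le ω, R.triple k h ω) x with hf
  have hImeas : ∀ x, MeasurableSet {ω | (R.episode k ω).state h.succ = x} := fun x =>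
    R.ℱ.le _ _ (R.measurable_state k h.succ x)
  have hIint : ∀ x, Integrable (I x) P := fun x =>
    (integrable_const (1 : ℝ)).indicator (hImeas x)
  have hfm : ∀ x, StronglyMeasurable[R.ℱ (k * (H + 1) + h)] (f x) := fun x =>
    (R.determinedBy_past_triple k h).stronglyMeasurable fun q => g q x
  have hfb : ∀ x ω, ‖f x ω‖ ≤ 1 := fun x ω => by
    rw [Real.norm_eq_abs, abs_of_nonneg (hg _ _).1]; exact (hg _ _).2
  have hsum : (fun ω => g (R.past k k.isLt.le ω, R.triple k h ω) ((R.episode k ω).state h.succ)) =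
      ∑ x, f x * I x := by
    funext ω
    simp only [hI, hf, Finset.sum_apply, Pi.mul_apply, Set.indicator_apply, Set.mem_ofPred_eq]
    simp
  rw [hsum]
  have hint : ∀ x ∈ Finset.univ, Integrable (f x * I x) P := fun x _ =>
    (hIint x).bdd_mul ((hfm x).mono hm).aestronglyMeasurable (ae_of_all _ (hfb x))
  refine (condExp_finsetSum hint _).trans ?_
  have h1 : ∀ᵐ ω ∂P, ∀ x, (P[f x * I x|R.ℱ (k * (H + 1) + h)]) ω = f x ω * (P[I x|R.ℱ (k * (H + 1) + h)]) ω := ae_all_iff.2 fun x =>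
    condExp_stronglyMeasurable_mul_of_bound hm (hfm x) (hIint x) 1 (ae_of_all _ (hfb x))
  have h2 : ∀ᵐ ω ∂P, ∀ x, (P[I x|R.ℱ (k * (H + 1) + h)]) ω = (G.trans h ((R.episode k ω).state h.castSucc)
      ((R.episode k ω).act h).1 ((R.episode k ω).act h).2).1 x :=
    ae_all_iff.2 fun x => R.condExp_state k h x
  filter_upwards [h1, h2] with ω h1 h2
  simp only [Finset.sum_apply, VMG.expNext]
  refine Finset.sum_congr rfl fun x _ => ?_
  rw [h1, h2, mul_comm]
  rfl

/-- Concentration of sums over episodes of functions of the next state at step `h`. -/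
theorem measure_abs_sum_next_gt_le (h : Fin H)
    (g : ∀ k : Fin K, (Fin k → Episode H 𝒮 𝒜 ℬ) × 𝒮 × 𝒜 × ℬ → 𝒮 → ℝ)
    (hg : ∀ k q x, g k q x ∈ Set.Icc 0 1) {η : ℝ} (hη0 : 0 < η) (hη1 : η ≤ 1) (L : ℝ)
    (X Y : Fin K → Ω → ℝ)
    (hX : ∀ k ω, X k ω =
      g k (R.past k k.isLt.le ω, R.triple k h ω) ((R.episode k ω).state h.succ))
    (hY : ∀ k ω, Y k ω = G.expNext h (R.triple k h ω) (g k (R.past k k.isLt.le ω, R.triple k h ω)))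
    (k : ℕ) (hk : k ≤ K) :
    P {ω | ¬ |∑ i : Fin k, X (Fin.castLE hk i) ω - ∑ i : Fin k, Y (Fin.castLE hk i) ω| ≤
      η * ∑ i : Fin k, Y (Fin.castLE hk i) ω + L / η} ≤ ENNReal.ofReal (2 * Real.exp (-L)) := by
  have hX' := fun k => funext (hX k)
  have hY' := fun k => funext (hY k)
  have hdet : ∀ k : Fin K, DeterminedBy (R.ℱ (k * (H + 1) + H))
      fun ω => ((R.past k k.isLt.le ω, R.triple k h ω), (R.episode k ω).state h.succ) := fun k =>
    ((R.determinedBy_past_triple k h).mono (R.ℱ.mono (by have := h.isLt; omega))).prodMk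
      ((R.determinedBy_episode k).comp fun e => e.state h.succ)
  have hXm : ∀ k : Fin K, StronglyMeasurable[R.ℱ (k * (H + 1) + H)] (X k) := fun k => by
    rw [hX']
    exact (hdet k).stronglyMeasurable fun q => g k q.1 q.2
  refine measure_abs_sum_sub_sum_gt_le (m := fun i : Fin K => R.ℱ (i * (H + 1) + h))
    (fun i => R.ℱ.le _) (fun i j hij => (hXm i).mono (R.ℱ.mono (index_lt hij h)))
    (fun i => (hXm i).mono (R.ℱ.le _)) (fun i j hij => ?_) (fun i ω => ?_) (fun i ω => ?_)
    (fun i => ?_) hη0 hη1 L k hk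
  · rw [hY']
    refine ((R.determinedBy_past_triple i h).stronglyMeasurable fun q =>
      G.expNext h q.2 (g i q)).mono (R.ℱ.mono ?_)
    have : (i : ℕ) ≤ j := hij
    gcongr
  · rw [hX]; exact hg _ _ _
  · rw [hY]
    exact ⟨le_stdSimplex_sum_mul _ fun x => (hg _ _ _).1,
      stdSimplex_sum_mul_le _ fun x => (hg _ _ _).2⟩
  · rw [hX', hY']
    exact R.condExp_next i h (g i) (hg i)

open Classical in
/-- Concentration of the sampled returns at the visits of a triple. -/
theorem measure_norm_sum_ret_gt_le (h : Fin H) (p : 𝒮 × 𝒜 × ℬ) {l : ℝ} (hl : 0 < l) (L : ℝ)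
    (k : ℕ) (hk : k ≤ K) :
    P {ω | ¬ l * ‖∑ i : Fin k, if R.triple (Fin.castLE hk i) h ω = p then
        R.ret (Fin.castLE hk i) h ω - G.ret h p.1 p.2.1 p.2.2 else 0‖ ≤
      (l * 2) ^ 2 / 2 * ∑ i : Fin k, (if R.triple (Fin.castLE hk i) h ω = p then (1 : ℝ) else 0)
        + L} ≤ ENNReal.ofReal (2 * Real.exp (-L)) := by
  set r := G.ret h p.1 p.2.1 p.2.2 with hr
  have hset : ∀ i : Fin K, MeasurableSet[R.ℱ (i * (H + 1) + h)] {ω | R.triple i h ω = p} :=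
    fun i => R.determinedBy_triple i h p
  set D : Fin K → Ω → EuclideanSpace ℝ (Fin d) := fun i ω =>
    if R.triple i h ω = p then R.ret i h ω - r else 0 with hD
  set N : Fin K → Ω → ℝ := fun i ω => if R.triple i h ω = p then 1 else 0 with hN
  have hDi : ∀ i, D i = Set.indicator {ω | R.triple i h ω = p} (fun ω => R.ret i h ω - r) := by
    intro i
    funext ω
    simp [hD, Set.indicator_apply]
  have hDm : ∀ i : Fin K, StronglyMeasurable[R.ℱ (i * (H + 1) + h + 1)] (D i) := fun i => by
    rw [hDi]
    exact ((R.measurable_ret i h).sub stronglyMeasurable_const).indicator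
      (R.ℱ.mono (Nat.le_succ _) _ (hset i))
  have hrint : ∀ i, Integrable (R.ret i h) P := fun i =>
    .of_bound ((R.measurable_ret i h).mono (R.ℱ.le _)).aestronglyMeasurable 1 (R.norm_ret_le i h)
  refine measure_norm_sum_gt_le (m := fun i : Fin K => R.ℱ (i * (H + 1) + h))
    (D := D) (N := N) (fun i => R.ℱ.le _)
    (fun i j hij => (hDm i).mono (R.ℱ.mono ?_)) (fun i => (hDm i).mono (R.ℱ.le _))
    -- The radius is `2`: a sampled return and its mean both lie in the unit ball.
    (fun i j hij => ?_) (fun i ω => ?_) two_pos (fun i => ?_) (fun i => ?_) hl L k hk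
  · have := index_lt hij h
    have := h.isLt
    omega
  · refine ((R.determinedBy_triple i h).stronglyMeasurable
      fun q => if q = p then (1 : ℝ) else 0).mono (R.ℱ.mono ?_)
    have : (i : ℕ) ≤ j := hij
    gcongr
  · simp only [hN]
    split_ifs <;> simp
  · filter_upwards [R.norm_ret_le i h] with ω hω
    simp only [hD, hN]
    split_ifs
    · have h1 : ‖r‖ ≤ 1 := G.norm_ret_le _ _ _ _
      linarith [norm_sub_le (R.ret i h ω) r]
    · simp
  · rw [hDi]
    refine (condExp_indicator ((hrint i).sub (integrable_const r)) (hset i)).trans ?_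
    have h1 := condExp_sub (m := R.ℱ (i * (H + 1) + h)) (hrint i) (integrable_const r)
    rw [condExp_const (R.ℱ.le _) r] at h1
    filter_upwards [h1, R.condExp_ret i h] with ω h1 h2
    rw [Set.indicator_apply]
    split_ifs with hω
    · have h3 : (R.episode i ω).state h.castSucc = p.1 ∧ (R.episode i ω).act h = p.2 := by
        have : R.triple i h ω = p := hω
        rw [← this]
        exact ⟨rfl, rfl⟩
      refine h1.trans ?_
      rw [Pi.sub_apply, h2, h3.1, h3.2]
      simp [hr]
    · rfl

end ExplorationRun

/-! ### Visit counts, empirical quantities and the good event. -/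

namespace ExplorationRun

variable {K d H : ℕ} {𝒮 𝒜 ℬ : Type*} [Fintype 𝒮] [Fintype 𝒜] [Fintype ℬ]
  {alg : ExplorePlan K d H 𝒮 𝒜 ℬ} {G : VMG d H 𝒮 𝒜 ℬ} {s₁ : 𝒮}
  {Ω : Type*} {mΩ : MeasurableSpace Ω} {P : Measure Ω} (R : ExplorationRun alg G s₁ P)

/-- The number of visits to `p` in step `h` of the first `k` episodes. -/
noncomputable def count (k : ℕ) (hk : k ≤ K) (h : Fin H) (p : 𝒮 × 𝒜 × ℬ) (ω : Ω) : ℕ :=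
  VIZero.visits (R.past k hk ω) h p.1 p.2.1 p.2.2

/-- The empirical expectation of `f` at the state following `p` in step `h`. -/
noncomputable def empNext (k : ℕ) (hk : k ≤ K) (h : Fin H) (p : 𝒮 × 𝒜 × ℬ) (f : 𝒮 → ℝ)
    (ω : Ω) : ℝ :=
  ∑ x, VIZero.empTrans (R.past k hk ω) h p.1 p.2.1 p.2.2 x * f x

/-- The empirical mean return. -/
noncomputable def empRet (k : ℕ) (hk : k ≤ K) (h : Fin H) (p : 𝒮 × 𝒜 × ℬ) (ω : Ω) :
    EuclideanSpace ℝ (Fin d) :=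
  VIZero.empRet (R.past k hk ω) (fun i h => R.ret (Fin.castLE hk i) h ω) h p.1 p.2.1 p.2.2

theorem mem_visitSet {k : ℕ} {hk : k ≤ K} {h : Fin H} {p : 𝒮 × 𝒜 × ℬ} {ω : Ω} {i : Fin k} :
    i ∈ VIZero.visitSet (R.past k hk ω) h p.1 p.2.1 p.2.2 ↔
      R.triple (Fin.castLE hk i) h ω = p := by
  obtain ⟨s, a, b⟩ := p
  classical
  rw [VIZero.visitSet, Finset.mem_filter]
  simp [triple, past]

theorem count_le (k : ℕ) (hk : k ≤ K) (h : Fin H) (p : 𝒮 × 𝒜 × ℬ) (ω : Ω) :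
    R.count k hk h p ω ≤ k :=
  (Finset.card_le_univ (VIZero.visitSet (R.past k hk ω) h p.1 p.2.1 p.2.2)).trans_eq
    (Fintype.card_fin k)

open Classical in
theorem sum_triple_eq {E : Type*} [AddCommMonoid E] (k : ℕ) (hk : k ≤ K) (h : Fin H)
    (p : 𝒮 × 𝒜 × ℬ) (ω : Ω) (f : Fin k → E) :
    ∑ i : Fin k, (if R.triple (Fin.castLE hk i) h ω = p then f i else 0) =
      ∑ i ∈ VIZero.visitSet (R.past k hk ω) h p.1 p.2.1 p.2.2, f i := by
  rw [← Finset.sum_filter]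
  congr 1
  ext i
  rw [mem_visitSet]
  simp

theorem sum_visitSet_const (k : ℕ) (hk : k ≤ K) (h : Fin H) (p : 𝒮 × 𝒜 × ℬ) (ω : Ω) (c : ℝ) :
    ∑ _i ∈ VIZero.visitSet (R.past k hk ω) h p.1 p.2.1 p.2.2, c = R.count k hk h p ω * c := by
  simp [count, VIZero.visits]

/-- Grouping the visits by their next state turns the sum over episodes into an empirical
expectation. Both sides are zero without a visit, so no hypothesis on the count is needed. -/
theorem sum_visitSet_next (k : ℕ) (hk : k ≤ K) (h : Fin H) (p : 𝒮 × 𝒜 × ℬ) (ω : Ω) (f : 𝒮 → ℝ) :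
    ∑ i ∈ VIZero.visitSet (R.past k hk ω) h p.1 p.2.1 p.2.2,
      f ((R.episode (Fin.castLE hk i) ω).state h.succ) =
      R.count k hk h p ω * R.empNext k hk h p f ω := by
  classical
  rcases eq_or_ne (R.count k hk h p ω) 0 with h0 | h0
  · have : VIZero.visitSet (R.past k hk ω) h p.1 p.2.1 p.2.2 = ∅ := Finset.card_eq_zero.1 h0
    simp [this, h0]
  · have hN : (R.count k hk h p ω : ℝ) ≠ 0 := by exact_mod_cast h0
    rw [empNext, Finset.mul_sum,
      ← Finset.sum_fiberwise _ (fun i => (R.episode (Fin.castLE hk i) ω).state h.succ)]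
    refine Finset.sum_congr rfl fun x _ => ?_
    have h1 : (R.count k hk h p ω : ℝ) *
        (VIZero.empTrans (R.past k hk ω) h p.1 p.2.1 p.2.2 x * f x) =
        VIZero.visitsTo (R.past k hk ω) h p.1 p.2.1 p.2.2 x * f x := by
      rw [VIZero.empTrans, ← mul_assoc, ← count, mul_div_cancel₀ _ hN]
    rw [h1, VIZero.visitsTo, ← nsmul_eq_mul, ← Finset.sum_const]
    refine Finset.sum_congr ?_ fun i hi => ?_
    · ext i
      rw [Finset.mem_filter, Finset.mem_filter]
      rfl
    · rw [← (Finset.mem_filter.1 hi).2]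
      rfl

variable [IsProbabilityMeasure P]

/-- Concentration of the empirical expectation of a fixed function. -/
theorem measure_empNext_gt_le (k : ℕ) (hk : k ≤ K) (h : Fin H) (p : 𝒮 × 𝒜 × ℬ) {f : 𝒮 → ℝ}
    (hf : ∀ x, f x ∈ Set.Icc 0 1) {η : ℝ} (hη0 : 0 < η) (hη1 : η ≤ 1) (L : ℝ) :
    P {ω | ¬ (R.count k hk h p ω : ℝ) * |R.empNext k hk h p f ω - G.expNext h p f| ≤
      η * (R.count k hk h p ω * G.expNext h p f) + L / η} ≤
      ENNReal.ofReal (2 * Real.exp (-L)) := by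
  classical
  refine (measure_mono fun ω hω => ?_).trans (R.measure_abs_sum_next_gt_le h
    (fun k q x => if q.2 = p then f x else 0) (fun k q x => ?_) hη0 hη1 L
    (fun k ω => if R.triple k h ω = p then f ((R.episode k ω).state h.succ) else 0)
    (fun k ω => if R.triple k h ω = p then G.expNext h p f else 0)
    (fun k ω => rfl) (fun k ω => ?_) k hk)
  · simp only [Set.mem_ofPred_eq] at hω ⊢
    rw [sum_triple_eq R k hk h p ω (fun i => f ((R.episode (Fin.castLE hk i) ω).state h.succ)),
      sum_triple_eq R k hk h p ω (fun _ => G.expNext h p f), sum_visitSet_next, sum_visitSet_const,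
      ← mul_sub, abs_mul, Nat.abs_cast]
    exact hω
  · by_cases hq : q.2 = p
    · simpa only [hq, if_true] using hf x
    · simp [hq]
  · split_ifs with h1
    · simp [h1]
    · simp [VMG.expNext]

/-- Concentration of the empirical mean return. -/
theorem measure_empRet_gt_le (k : ℕ) (hk : k ≤ K) (h : Fin H) (p : 𝒮 × 𝒜 × ℬ) {l : ℝ}
    (hl : 0 < l) (L : ℝ) :
    P {ω | ¬ l * (R.count k hk h p ω * ‖G.ret h p.1 p.2.1 p.2.2 - R.empRet k hk h p ω‖) ≤
      (l * 2) ^ 2 / 2 * R.count k hk h p ω + L} ≤ ENNReal.ofReal (2 * Real.exp (-L)) := by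
  classical
  refine (measure_mono fun ω hω => ?_).trans (R.measure_norm_sum_ret_gt_le h p hl L k hk)
  simp only [Set.mem_ofPred_eq] at hω ⊢
  rw [sum_triple_eq R k hk h p ω fun i =>
      R.ret (Fin.castLE hk i) h ω - G.ret h p.1 p.2.1 p.2.2,
    sum_triple_eq R k hk h p ω (fun _ => (1 : ℝ)), sum_visitSet_const, mul_one]
  have h1 : ‖∑ i ∈ VIZero.visitSet (R.past k hk ω) h p.1 p.2.1 p.2.2,
      (R.ret (Fin.castLE hk i) h ω - G.ret h p.1 p.2.1 p.2.2)‖ =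
      R.count k hk h p ω * ‖G.ret h p.1 p.2.1 p.2.2 - R.empRet k hk h p ω‖ := by
    rcases eq_or_ne (R.count k hk h p ω) 0 with h0 | h0
    · have : VIZero.visitSet (R.past k hk ω) h p.1 p.2.1 p.2.2 = ∅ := Finset.card_eq_zero.1 h0
      simp [this, h0]
    · have hN : (R.count k hk h p ω : ℝ) ≠ 0 := by exact_mod_cast h0
      have h2 : ∑ i ∈ VIZero.visitSet (R.past k hk ω) h p.1 p.2.1 p.2.2,
          (R.ret (Fin.castLE hk i) h ω - G.ret h p.1 p.2.1 p.2.2) =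
          (R.count k hk h p ω : ℝ) • (R.empRet k hk h p ω - G.ret h p.1 p.2.1 p.2.2) := by
        rw [Finset.sum_sub_distrib, Finset.sum_const, smul_sub, empRet, VIZero.empRet, ← count,
          smul_inv_smul₀ hN, ← Nat.cast_smul_eq_nsmul ℝ]
        rfl
      rw [h2, norm_smul, Real.norm_eq_abs, Nat.abs_cast, norm_sub_rev]
  rw [h1]
  exact hω

theorem _root_.MeasureTheory.measure_not_forall_le {Ω : Type*} {mΩ : MeasurableSpace Ω}
    (P : Measure Ω) {ι : Type*} [Fintype ι]
    {Q : ι → Ω → Prop} {c : ℝ} (hQ : ∀ i, P {ω | ¬ Q i ω} ≤ ENNReal.ofReal c) :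
    P {ω | ¬ ∀ i, Q i ω} ≤ ENNReal.ofReal (Fintype.card ι * c) := by
  have h1 : {ω | ¬ ∀ i, Q i ω} = ⋃ i, {ω | ¬ Q i ω} := by
    ext ω
    simp
  rw [h1]
  refine (measure_iUnion_fintype_le _ _).trans ((Finset.sum_le_sum fun i _ => hQ i).trans ?_)
  rw [Finset.sum_const, Finset.card_univ, nsmul_eq_mul, ENNReal.ofReal_mul (Nat.cast_nonneg _),
    ENNReal.ofReal_natCast]

/-- The event on which the empirical quantities are close to the true ones, and the uncertainty
functions `W` at the next state to their conditional expectations. `F` is a finite family of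
functions whose empirical expectations are controlled at level `L'`; the other controls are at
level `L`. -/
structure Good {ι : Type*} (F : ι → Fin H → 𝒮 → ℝ) (S : ℕ) (L L' : ℝ)
    (W : ∀ k : ℕ, (Fin k → Episode H 𝒮 𝒜 ℬ) → Fin H → 𝒮 → ℝ) (ω : Ω) : Prop where
  coord : ∀ (k : Fin K) h p (x : 𝒮),
    (R.count k k.isLt.le h p ω : ℝ) * |VIZero.empTrans (R.past k k.isLt.le ω) h p.1 p.2.1 p.2.2 x -
      (G.trans h p.1 p.2.1 p.2.2).1 x| ≤
      1 / (2 * H) * (R.count k k.isLt.le h p ω * (G.trans h p.1 p.2.1 p.2.2).1 x) + 2 * H * L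
  coord_sqrt : ∀ (k : Fin K) h p (x : 𝒮), R.count k k.isLt.le h p ω ≠ 0 →
    S * L ≤ R.count k k.isLt.le h p ω →
    (R.count k k.isLt.le h p ω : ℝ) * |VIZero.empTrans (R.past k k.isLt.le ω) h p.1 p.2.1 p.2.2 x -
      (G.trans h p.1 p.2.1 p.2.2).1 x| ≤
      √(S * L / R.count k k.isLt.le h p ω) *
        (R.count k k.isLt.le h p ω * (G.trans h p.1 p.2.1 p.2.2).1 x) +
      L / √(S * L / R.count k k.isLt.le h p ω)
  family : ∀ (k : Fin K) h p (i : ι), R.count k k.isLt.le h p ω ≠ 0 →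
    L' ≤ R.count k k.isLt.le h p ω →
    (R.count k k.isLt.le h p ω : ℝ) * |R.empNext k k.isLt.le h p (F i h) ω -
      G.expNext h p (F i h)| ≤
      √(L' / R.count k k.isLt.le h p ω) *
        (R.count k k.isLt.le h p ω * G.expNext h p (F i h)) +
      L' / √(L' / R.count k k.isLt.le h p ω)
  ret : ∀ (k : Fin K) h p, R.count k k.isLt.le h p ω ≠ 0 →
    √(L / R.count k k.isLt.le h p ω) *
      (R.count k k.isLt.le h p ω *
        ‖G.ret h p.1 p.2.1 p.2.2 - R.empRet k k.isLt.le h p ω‖) ≤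
      (√(L / R.count k k.isLt.le h p ω) * 2) ^ 2 / 2 * R.count k k.isLt.le h p ω + L
  next : ∀ h : Fin H,
    |∑ k : Fin K, W k (R.past k k.isLt.le ω) h ((R.episode k ω).state h.succ) -
      ∑ k : Fin K, G.expNext h (R.triple k h ω) (W k (R.past k k.isLt.le ω) h)| ≤
      1 / (2 * H) * ∑ k : Fin K, G.expNext h (R.triple k h ω) (W k (R.past k k.isLt.le ω) h) +
      2 * H * L
  norm_ret_le : ∀ k h, ‖R.ret k h ω‖ ≤ 1

/-- A union bound for statements about a random counter which is less than `K`. -/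
theorem measure_not_forall_count_le (k : Fin K) (h : Fin H) (p : 𝒮 × 𝒜 × ℬ)
    {Q : ℕ → Ω → Prop} {c : ℝ} (hQ : ∀ n, n ≠ 0 → P {ω | ¬ Q n ω} ≤ ENNReal.ofReal c) :
    P {ω | ¬ (R.count k k.isLt.le h p ω ≠ 0 → Q (R.count k k.isLt.le h p ω) ω)} ≤
      ENNReal.ofReal (K * c) := by
  have h1 := measure_not_forall_le P (ι := Fin K) (Q := fun n ω => (n : ℕ) ≠ 0 → Q n ω) (c := c)
    fun n => by
      by_cases hn : (n : ℕ) = 0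
      · simp [hn]
      · simpa [hn] using hQ n hn
  rw [Fintype.card_fin] at h1
  refine (measure_mono fun ω hω => ?_).trans h1
  intro hall
  refine hω fun h0 => hall ⟨R.count k k.isLt.le h p ω, ?_⟩ h0
  exact lt_of_le_of_lt (R.count_le k k.isLt.le h p ω) k.isLt

/-- A union bound over the five families of events and the null set of sampled returns outside the
ball. The second factors `K` come from the parameters that are tuned to the random counter. -/
theorem measure_not_good_le {ι : Type*} [Fintype ι] {F : ι → Fin H → 𝒮 → ℝ}
    (hF : ∀ i h x, F i h x ∈ Set.Icc 0 1) {S : ℕ} (hS : 0 < S) {L L' : ℝ} (hL : 0 < L)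
    (hL' : 0 < L') {W : ∀ k : ℕ, (Fin k → Episode H 𝒮 𝒜 ℬ) → Fin H → 𝒮 → ℝ}
    (hW : ∀ k D h x, W k D h x ∈ Set.Icc 0 1) :
    P {ω | ¬ R.Good F S L L' W ω} ≤ ENNReal.ofReal
      (2 * (K * H * (Fintype.card 𝒮 * Fintype.card 𝒜 * Fintype.card ℬ) *
        (Fintype.card 𝒮 + Fintype.card 𝒮 * K + K) + H) * Real.exp (-L) +
       2 * (K * H * (Fintype.card 𝒮 * Fintype.card 𝒜 * Fintype.card ℬ) * (Fintype.card ι * K)) *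
        Real.exp (-L')) := by
  classical
  -- Transition probabilities are expectations of indicators of single states.
  have hsingle : ∀ (k : ℕ) (hk : k ≤ K) h p x ω,
      R.empNext k hk h p (fun y => if y = x then 1 else 0) ω =
      VIZero.empTrans (R.past k hk ω) h p.1 p.2.1 p.2.2 x := fun k hk h p x ω => by
    simp [empNext]
  have hsingle' : ∀ h p x, G.expNext h p (fun y => if y = x then 1 else 0) =
      (G.trans h p.1 p.2.1 p.2.2).1 x := fun h p x => by
    simp [VMG.expNext]
  have hind : ∀ x y : 𝒮, (if y = x then (1 : ℝ) else 0) ∈ Set.Icc (0 : ℝ) 1 := fun x y => by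
    split_ifs <;> simp
  have hη : ∀ h : Fin H, 0 < 1 / (2 * (H : ℝ)) ∧ 1 / (2 * (H : ℝ)) ≤ 1 := fun h => by
    have : (1 : ℝ) ≤ H := by exact_mod_cast h.pos
    exact ⟨by positivity, by rw [div_le_one (by positivity)]; linarith⟩
  have e1 : P {ω | ¬ ∀ q : Fin K × Fin H × (𝒮 × 𝒜 × ℬ) × 𝒮, _} ≤ _ :=
    measure_not_forall_le P fun q => R.measure_empNext_gt_le q.1 q.1.isLt.le q.2.1 q.2.2.1
      (hind q.2.2.2) (hη q.2.1).1 (hη q.2.1).2 L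
  -- The optimal `η = √(S L / n)` depends on the counter, but concentration requires a fixed `η`.
  -- Therefore only the counter inside `η` is frozen to `n`, with a union over its possible values
  -- below `K`. The condition `S L ≤ n` ensures `η ≤ 1`.
  have e2 : P {ω | ¬ ∀ q : Fin K × Fin H × (𝒮 × 𝒜 × ℬ) × 𝒮, _} ≤ _ :=
    measure_not_forall_le P fun q => R.measure_not_forall_count_le q.1 q.2.1 q.2.2.1
      (Q := fun n ω => S * L ≤ n →
        (R.count q.1 q.1.isLt.le q.2.1 q.2.2.1 ω : ℝ) *
          |R.empNext q.1 q.1.isLt.le q.2.1 q.2.2.1 (fun y => if y = q.2.2.2 then 1 else 0) ω -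
            G.expNext q.2.1 q.2.2.1 (fun y => if y = q.2.2.2 then 1 else 0)| ≤
        √(S * L / n) * (R.count q.1 q.1.isLt.le q.2.1 q.2.2.1 ω *
          G.expNext q.2.1 q.2.2.1 (fun y => if y = q.2.2.2 then 1 else 0)) + L / √(S * L / n))
      (c := 2 * Real.exp (-L)) (fun n hn => by
        have hn' : (0 : ℝ) < n := by positivity
        by_cases hle : S * L ≤ n
        · simpa only [hle, true_imp_iff] using R.measure_empNext_gt_le q.1 q.1.isLt.le q.2.1
            q.2.2.1 (hind q.2.2.2) (Real.sqrt_pos.2 (by positivity))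
            (Real.sqrt_le_one.2 ((div_le_one hn').2 hle)) L
        · simp [hle])
  have e3 : P {ω | ¬ ∀ q : Fin K × Fin H × (𝒮 × 𝒜 × ℬ) × ι, _} ≤ _ :=
    measure_not_forall_le P fun q => R.measure_not_forall_count_le q.1 q.2.1 q.2.2.1
      (Q := fun n ω => L' ≤ n →
        (R.count q.1 q.1.isLt.le q.2.1 q.2.2.1 ω : ℝ) *
          |R.empNext q.1 q.1.isLt.le q.2.1 q.2.2.1 (F q.2.2.2 q.2.1) ω -
            G.expNext q.2.1 q.2.2.1 (F q.2.2.2 q.2.1)| ≤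
        √(L' / n) * (R.count q.1 q.1.isLt.le q.2.1 q.2.2.1 ω *
          G.expNext q.2.1 q.2.2.1 (F q.2.2.2 q.2.1)) + L' / √(L' / n))
      (c := 2 * Real.exp (-L')) (fun n hn => by
        have hn' : (0 : ℝ) < n := by positivity
        by_cases hle : L' ≤ n
        · simpa only [hle, true_imp_iff] using R.measure_empNext_gt_le q.1 q.1.isLt.le q.2.1
            q.2.2.1 (hF q.2.2.2 q.2.1) (Real.sqrt_pos.2 (by positivity))
            (Real.sqrt_le_one.2 ((div_le_one hn').2 hle)) L'
        · simp [hle])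
  have e4 : P {ω | ¬ ∀ q : Fin K × Fin H × (𝒮 × 𝒜 × ℬ), _} ≤ _ :=
    measure_not_forall_le P fun q => R.measure_not_forall_count_le q.1 q.2.1 q.2.2
      (Q := fun n ω => √(L / n) *
        (R.count q.1 q.1.isLt.le q.2.1 q.2.2 ω * ‖G.ret q.2.1 q.2.2.1 q.2.2.2.1 q.2.2.2.2 -
          R.empRet q.1 q.1.isLt.le q.2.1 q.2.2 ω‖) ≤
        (√(L / n) * 2) ^ 2 / 2 * R.count q.1 q.1.isLt.le q.2.1 q.2.2 ω + L)
      (c := 2 * Real.exp (-L)) (fun n hn => by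
        have hn' : (0 : ℝ) < n := by positivity
        exact R.measure_empRet_gt_le q.1 q.1.isLt.le q.2.1 q.2.2
          (Real.sqrt_pos.2 (by positivity)) L)
  have e5 : P {ω | ¬ ∀ h : Fin H, _} ≤ _ :=
    measure_not_forall_le P fun h => R.measure_abs_sum_next_gt_le h
      (fun k q x => W k q.1 h x) (fun k q x => hW k q.1 h x) (hη h).1 (hη h).2 L
      (fun k ω => W k (R.past k k.isLt.le ω) h ((R.episode k ω).state h.succ))
      (fun k ω => G.expNext h (R.triple k h ω) (W k (R.past k k.isLt.le ω) h))
      (fun _ _ => rfl) (fun _ _ => rfl) K le_rfl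
  have e6 : P {ω | ¬ ∀ k h, ‖R.ret k h ω‖ ≤ 1} = 0 :=
    ae_iff.1 (ae_all_iff.2 fun k => ae_all_iff.2 fun h => R.norm_ret_le k h)
  have hunion : ∀ {A B : Set Ω} {a b : ENNReal}, P A ≤ a → P B ≤ b → P (A ∪ B) ≤ a + b :=
    fun hA hB => (measure_union_le _ _).trans (add_le_add hA hB)
  refine (measure_mono fun ω hω => ?_).trans
    ((hunion e1 (hunion e2 (hunion e3 (hunion e4 (hunion e5 e6.le))))).trans ?_)
  · by_contra hcon
    simp only [Set.mem_union, Set.mem_ofPred_eq, not_or, not_not] at hcon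
    obtain ⟨h1, h2, h3, h4, h5, h6⟩ := hcon
    simp only [hsingle, hsingle'] at h1 h2
    refine hω ⟨fun k h p x => ?_, fun k h p x h0 hle => ?_, fun k h p i h0 hle => ?_,
      fun k h p h0 => ?_, fun h => ?_, h6⟩
    · have := h1 (k, h, p, x)
      refine this.trans (le_of_eq ?_)
      simp only [div_div_eq_mul_div, div_one]
      ring
    · exact h2 (k, h, p, x) h0 hle
    · exact h3 (k, h, p, i) h0 hle
    · exact h4 (k, h, p) h0
    · have := h5 h
      refine this.trans (le_of_eq ?_)
      simp only [div_div_eq_mul_div, div_one, Fin.castLE_rfl, id]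
      ring
  · rw [add_zero, ← ENNReal.ofReal_add (by positivity) (by positivity),
      ← ENNReal.ofReal_add (by positivity) (by positivity),
      ← ENNReal.ofReal_add (by positivity) (by positivity),
      ← ENNReal.ofReal_add (by positivity) (by positivity)]
    apply ENNReal.ofReal_le_ofReal
    simp only [Fintype.card_prod, Fintype.card_fin]
    push_cast
    apply le_of_eq
    ring

end ExplorationRun

/-! ### Elementary properties of the empirical model and of the uncertainty functions. -/

namespace VIZero

variable {k d H : ℕ} {𝒮 𝒜 ℬ : Type*} [Fintype 𝒮]

theorem empTrans_mem_stdSimplex {D : Fin k → Episode H 𝒮 𝒜 ℬ} {h : Fin H} {s : 𝒮} {a : 𝒜} {b : ℬ}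
    (hN : visits D h s a b ≠ 0) : empTrans D h s a b ∈ stdSimplex ℝ 𝒮 := by
  classical
  refine ⟨fun x => by unfold empTrans; positivity, ?_⟩
  simp only [empTrans]
  rw [← Finset.sum_div, div_eq_one_iff_eq (by exact_mod_cast hN), ← Nat.cast_sum, visits,
    Finset.card_eq_sum_card_fiberwise (f := fun i => (D i).state h.succ) (t := Finset.univ)
      fun _ _ => Finset.mem_univ _]
  congr 1

theorem norm_empRet_le {D : Fin k → Episode H 𝒮 𝒜 ℬ} {r : Fin k → Fin H → EuclideanSpace ℝ (Fin d)}
    (hr : ∀ i h, ‖r i h‖ ≤ 1) (h : Fin H) (s : 𝒮) (a : 𝒜) (b : ℬ) :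
    ‖empRet D r h s a b‖ ≤ 1 := by
  rw [empRet, norm_smul, norm_inv, Real.norm_eq_abs, Nat.abs_cast]
  have h1 : ‖∑ i ∈ visitSet D h s a b, r i h‖ ≤ visits D h s a b := by
    refine (norm_sum_le _ _).trans ((Finset.sum_le_sum fun i _ => hr i h).trans_eq ?_)
    simp [visits]
  calc _ ≤ (visits D h s a b : ℝ)⁻¹ * visits D h s a b :=
        mul_le_mul_of_nonneg_left h1 (by positivity)
    _ ≤ 1 := inv_mul_le_one

theorem exists_isEmpiricalGame [Nonempty 𝒮] (D : Fin k → Episode H 𝒮 𝒜 ℬ)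
    {r : Fin k → Fin H → EuclideanSpace ℝ (Fin d)} (hr : ∀ i h, ‖r i h‖ ≤ 1) :
    ∃ Ghat : VMG d H 𝒮 𝒜 ℬ, IsEmpiricalGame D r Ghat := by
  classical
  refine ⟨⟨fun h s a b => if hN : visits D h s a b ≠ 0 then
    ⟨empTrans D h s a b, empTrans_mem_stdSimplex hN⟩ else Classical.arbitrary _,
    empRet D r, norm_empRet_le hr⟩, fun h s a b hN => ⟨?_, rfl⟩⟩
  simp [hN]

variable [Fintype 𝒜] [Fintype ℬ] [Nonempty 𝒜] [Nonempty ℬ] (β : ℕ → ℝ)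
  (D : Fin k → Episode H 𝒮 𝒜 ℬ)

@[simp]
theorem vTilde_last (s : 𝒮) : vTilde β D (Fin.last H) s = 0 := by
  simp [vTilde]

theorem vTilde_castSucc (h : Fin H) (s : 𝒮) :
    vTilde β D h.castSucc s = Finset.univ.sup' Finset.univ_nonempty (qTilde β D h s) := by
  unfold qTilde
  simp [vTilde]

theorem qTilde_le_vTilde (h : Fin H) (s : 𝒮) (p : 𝒜 × ℬ) :
    qTilde β D h s p ≤ vTilde β D h.castSucc s := by
  rw [vTilde_castSucc]
  exact Finset.le_sup' _ (Finset.mem_univ p)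

variable {β}

theorem vTilde_mem_Icc (hβ : ∀ t, 0 ≤ β t) (h : Fin (H + 1)) (s : 𝒮) :
    vTilde β D h s ∈ Set.Icc 0 (H : ℝ) := by
  induction h using Fin.reverseInduction generalizing s with
  | last => simp
  | cast h ih =>
    have h1 : ∀ p, qTilde β D h s p ∈ Set.Icc 0 (H : ℝ) := by
      intro p
      rw [qTilde, qUpdate]
      split_ifs
      · simp
      · refine ⟨le_min (add_nonneg (Finset.sum_nonneg fun x _ => mul_nonneg ?_ (ih x).1) (hβ _))
          (Nat.cast_nonneg _), min_le_right _ _⟩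
        unfold empTrans
        positivity
    rw [vTilde_castSucc]
    obtain ⟨p⟩ : Nonempty (𝒜 × ℬ) := inferInstance
    exact ⟨(h1 p).1.trans (Finset.le_sup' _ (Finset.mem_univ p)),
      Finset.sup'_le _ _ fun p _ => (h1 p).2⟩

end VIZero

/-! ### A finite grid for the parameter `θ`. -/

section Grid

/-- The points of a grid with mesh `1 / m` around the origin. -/
noncomputable def gridPoint {d : ℕ} (m : ℕ) (j : Fin d → Fin (2 * m + 1)) :
    EuclideanSpace ℝ (Fin d) :=
  WithLp.toLp 2 fun i => ((j i : ℕ) : ℝ) / m - 1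

/-- Rounding down moves each coordinate by at most `1 / (d K)`, hence the vector by at most `√d / (d
K) ≤ 1 / K`. -/
theorem exists_norm_sub_gridPoint_le {d K : ℕ} (hd : 0 < d) (hK : 0 < K)
    {θ : EuclideanSpace ℝ (Fin d)} (hθ : ‖θ‖ ≤ 1) :
    ∃ j : Fin d → Fin (2 * (d * K) + 1), ‖θ - gridPoint (d * K) j‖ ≤ 1 / K := by
  set m := d * K with hm
  have hm0 : (0 : ℝ) < m := by exact_mod_cast Nat.mul_pos hd hK
  have hθi : ∀ i, |θ i| ≤ 1 := fun i => (PiLp.norm_apply_le θ i).trans hθ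
  have hnn : ∀ i, 0 ≤ (θ i + 1) * m := fun i =>
    mul_nonneg (by linarith [(abs_le.1 (hθi i)).1]) hm0.le
  refine ⟨fun i => ⟨⌊(θ i + 1) * m⌋₊, ?_⟩, ?_⟩
  · rw [Nat.lt_succ_iff]
    apply Nat.floor_le_of_le
    push_cast
    nlinarith [(abs_le.1 (hθi i)).2]
  · have hcoord : ∀ i, |θ i - ((⌊(θ i + 1) * m⌋₊ : ℝ) / m - 1)| ≤ 1 / m := fun i => by
      have h1 := Nat.floor_le (hnn i)
      have h2 := Nat.lt_floor_add_one ((θ i + 1) * m)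
      have h3 : θ i - ((⌊(θ i + 1) * m⌋₊ : ℝ) / m - 1) =
          ((θ i + 1) * m - ⌊(θ i + 1) * m⌋₊) / m := by field_simp; ring
      rw [h3, abs_div, abs_of_pos hm0]
      refine div_le_div_of_nonneg_right (abs_le.2 ⟨by linarith, by linarith⟩) hm0.le
    rw [EuclideanSpace.norm_eq]
    apply Real.sqrt_le_iff.2
    refine ⟨by positivity, ?_⟩
    calc _ ≤ ∑ _i : Fin d, (1 / (m : ℝ)) ^ 2 := Finset.sum_le_sum fun i _ => by
          rw [Real.norm_eq_abs]
          exact pow_le_pow_left₀ (abs_nonneg _) (hcoord i) 2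
      _ = d * (1 / (m : ℝ)) ^ 2 := by simp
      _ ≤ (1 / (K : ℝ)) ^ 2 := by
          have hd' : (1 : ℝ) ≤ d := by exact_mod_cast hd
          have hK' : (0 : ℝ) < K := by exact_mod_cast hK
          rw [hm, Nat.cast_mul]
          have : (d : ℝ) * (1 / (d * K)) ^ 2 = (1 / K) ^ 2 / d := by field_simp
          rw [this]
          exact div_le_self (by positivity) hd'

end Grid

section Auxiliary

theorem sqrt_div_sq_mul {L n : ℝ} (hL : 0 ≤ L) (hn : 0 < n) : √(L / n) ^ 2 * n = L := by
  rw [Real.sq_sqrt (by positivity)]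
  field_simp

theorem div_sqrt_div {L n : ℝ} (hL : 0 < L) (hn : 0 < n) : L / √(L / n) = √(L / n) * n := by
  have h1 : 0 < √(L / n) := Real.sqrt_pos.2 (by positivity)
  rw [div_eq_iff h1.ne']
  linarith [sqrt_div_sq_mul hL.le hn]

theorem abs_sum_sub_mul_le {α : Type*} [Fintype α] (p q : stdSimplex ℝ α) {f : α → ℝ} {c : ℝ}
    (hf : ∀ x, |f x| ≤ c) : |∑ x, (p.1 x - q.1 x) * f x| ≤ 2 * c := by
  simp only [sub_mul, Finset.sum_sub_distrib]
  refine (abs_sub _ _).trans ?_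
  linarith [abs_stdSimplex_sum_mul_le p hf, abs_stdSimplex_sum_mul_le q hf]

end Auxiliary

/-! ### Consequences of the good event: the uncertainty dominates the model error. -/

namespace ExplorationRun

variable {K d H : ℕ} {𝒮 𝒜 ℬ : Type*} [Fintype 𝒮] [Fintype 𝒜] [Fintype ℬ]
  [Nonempty 𝒜] [Nonempty ℬ]
  {alg : ExplorePlan K d H 𝒮 𝒜 ℬ} {G : VMG d H 𝒮 𝒜 ℬ} {s₁ : 𝒮}
  {Ω : Type*} {mΩ : MeasurableSpace Ω} {P : Measure Ω} {R : ExplorationRun alg G s₁ P}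

/-- The Nash values at the next step for the `θ` on the grid, scaled to the unit interval. -/
noncomputable def gridFamily (G : VMG d H 𝒮 𝒜 ℬ) (m : ℕ)
    (j : {j : Fin d → Fin (2 * m + 1) // ‖gridPoint m j‖ ≤ 2}) (h : Fin H) (x : 𝒮) : ℝ :=
  (G.nashValue (gridPoint m j.1) h.succ x + 2 * H) / (4 * H)

theorem _root_.VMG.abs_nashValue_le (G : VMG d H 𝒮 𝒜 ℬ) (θ : EuclideanSpace ℝ (Fin d))
    (h : Fin (H + 1)) (x : 𝒮) : |G.nashValue θ h x| ≤ H * ‖θ‖ := by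
  refine (G.abs_dynProg_le θ (fun _ _ => isGameFunctional_matrixValue) h x).trans ?_
  have h3 : (0 : ℝ) ≤ (h : ℕ) := by positivity
  nlinarith [norm_nonneg θ]

theorem _root_.VMG.abs_nashValue_sub_le (G : VMG d H 𝒮 𝒜 ℬ) (θ θ' : EuclideanSpace ℝ (Fin d))
    (h : Fin (H + 1)) (x : 𝒮) : |G.nashValue θ h x - G.nashValue θ' h x| ≤ H * ‖θ - θ'‖ := by
  refine (G.abs_dynProg_sub_le θ θ' (fun _ _ => isGameFunctional_matrixValue) h x).trans ?_
  have h3 : (0 : ℝ) ≤ (h : ℕ) := by positivity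
  nlinarith [norm_nonneg (θ - θ')]

theorem gridFamily_mem_Icc (G : VMG d H 𝒮 𝒜 ℬ) (m : ℕ)
    (j : {j : Fin d → Fin (2 * m + 1) // ‖gridPoint m j‖ ≤ 2}) (h : Fin H) (x : 𝒮) :
    gridFamily G m j h x ∈ Set.Icc 0 1 := by
  have hH : (0 : ℝ) < H := by exact_mod_cast h.pos
  have h1 := abs_le.1 ((G.abs_nashValue_le (gridPoint m j.1) h.succ x).trans
    (mul_le_mul_of_nonneg_left j.2 hH.le))
  constructor
  · exact div_nonneg (by linarith [h1.1]) (by positivity)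
  · rw [gridFamily, div_le_one (by positivity)]
    linarith [h1.2]

section Good

variable {S : ℕ} {L L' : ℝ} {W : ∀ k : ℕ, (Fin k → Episode H 𝒮 𝒜 ℬ) → Fin H → 𝒮 → ℝ} {ω : Ω}
  {ι : Type*} {F : ι → Fin H → 𝒮 → ℝ}

/-- With `l = √(L / n)` one has `l² n = L`, so the right-hand side of the concentration bound is `2
L + L = 3 l² n`; divide by `l n`. -/
theorem Good.norm_ret_sub_le (hg : R.Good F S L L' W ω) (hL : 0 < L) {k : Fin K} {h : Fin H}
    {p : 𝒮 × 𝒜 × ℬ} (hN : R.count k k.isLt.le h p ω ≠ 0) :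
    ‖G.ret h p.1 p.2.1 p.2.2 - R.empRet k k.isLt.le h p ω‖ ≤
      3 * √(L / R.count k k.isLt.le h p ω) := by
  have h1 := hg.ret k h p hN
  have hn : (0 : ℝ) < R.count k k.isLt.le h p ω := by positivity
  have h2 := sqrt_div_sq_mul hL.le hn
  have h3 : 0 < √(L / R.count k k.isLt.le h p ω) := Real.sqrt_pos.2 (by positivity)
  set n : ℝ := (R.count k k.isLt.le h p ω : ℝ)
  set l := √(L / n)
  have h4 : l * n * ‖G.ret h p.1 p.2.1 p.2.2 - R.empRet k k.isLt.le h p ω‖ ≤ l * n * (3 * l) := by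
    nlinarith
  exact le_of_mul_le_mul_left h4 (by positivity)

theorem Good.abs_empTrans_sub_le (hg : R.Good F S L L' W ω) {k : Fin K} {h : Fin H}
    {p : 𝒮 × 𝒜 × ℬ} (hN : R.count k k.isLt.le h p ω ≠ 0) (x : 𝒮) :
    |VIZero.empTrans (R.past k k.isLt.le ω) h p.1 p.2.1 p.2.2 x -
      (G.trans h p.1 p.2.1 p.2.2).1 x| ≤
      (G.trans h p.1 p.2.1 p.2.2).1 x / (2 * H) + 2 * H * L / R.count k k.isLt.le h p ω := by
  have hn : (0 : ℝ) < R.count k k.isLt.le h p ω := by positivity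
  have h1 := hg.coord k h p x
  rw [← mul_le_mul_iff_right₀ hn]
  refine h1.trans (le_of_eq ?_)
  field_simp

/-- The relative error is turned from the true to the empirical probability: substitute `P ≤ P̂ +
|P̂ - P|` and absorb half of the error, which doubles the constants. -/
theorem Good.abs_trans_sub_le (hg : R.Good F S L L' W ω) {k : Fin K} {h : Fin H}
    {p : 𝒮 × 𝒜 × ℬ} (hN : R.count k k.isLt.le h p ω ≠ 0) (x : 𝒮) :
    |(G.trans h p.1 p.2.1 p.2.2).1 x -
      VIZero.empTrans (R.past k k.isLt.le ω) h p.1 p.2.1 p.2.2 x| ≤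
      VIZero.empTrans (R.past k k.isLt.le ω) h p.1 p.2.1 p.2.2 x / H +
        4 * H * L / R.count k k.isLt.le h p ω := by
  have hH : (1 : ℝ) ≤ H := by exact_mod_cast h.pos
  have h1 := hg.abs_empTrans_sub_le hN x
  rw [abs_sub_comm]
  set a := VIZero.empTrans (R.past k k.isLt.le ω) h p.1 p.2.1 p.2.2 x
  set b := (G.trans h p.1 p.2.1 p.2.2).1 x
  set t := |a - b| with ht
  have h2 : b ≤ a + t := by linarith [neg_abs_le (a - b)]
  have h3 : b / (2 * H) ≤ (a + t) / (2 * H) := div_le_div_of_nonneg_right h2 (by positivity)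
  have h4 : t / (2 * H) ≤ t / 2 :=
    div_le_div_of_nonneg_left (abs_nonneg _) (by norm_num) (by linarith)
  have h5 : (a + t) / (2 * H) = a / H / 2 + t / (2 * H) := by field_simp
  have h6 : 4 * H * L / R.count k k.isLt.le h p ω =
    2 * (2 * H * L / R.count k k.isLt.le h p ω) := by ring
  rw [h6]
  linarith

/-- The coordinate errors `l P(x) + L / (l n)` sum to at most `l + S L / (l n) = 2 l` for `l = √(S L
/ n)`. This is an `ℓ¹` bound, hence uniform in the test function; it gives the alternative `S` in
`min{d, S}`. If `n < S L` then `l > 1` and the trivial bound is enough. -/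
theorem Good.abs_sum_le_of_card (hg : R.Good F S L L' W ω) (hL : 0 < L)
    (hS : Fintype.card 𝒮 ≤ S) (hS0 : 0 < S) {k : Fin K} {h : Fin H}
    {p : 𝒮 × 𝒜 × ℬ} (hN : R.count k k.isLt.le h p ω ≠ 0) {f : 𝒮 → ℝ} {c : ℝ} (hc : 0 ≤ c)
    (hf : ∀ x, |f x| ≤ c) :
    |∑ x, ((G.trans h p.1 p.2.1 p.2.2).1 x -
      VIZero.empTrans (R.past k k.isLt.le ω) h p.1 p.2.1 p.2.2 x) * f x| ≤
      2 * c * √(S * L / R.count k k.isLt.le h p ω) := by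
  have hn : (0 : ℝ) < R.count k k.isLt.le h p ω := by positivity
  have hS' : (0 : ℝ) < S := by exact_mod_cast hS0
  rcases le_or_gt (S * L) (R.count k k.isLt.le h p ω : ℝ) with hle | hlt
  · set n : ℝ := (R.count k k.isLt.le h p ω : ℝ)
    set l := √(S * L / n) with hl
    have hl0 : 0 < l := Real.sqrt_pos.2 (by positivity)
    have hln : l ^ 2 * n = S * L := sqrt_div_sq_mul (by positivity) hn
    have h1 : ∀ x, |(G.trans h p.1 p.2.1 p.2.2).1 x -
        VIZero.empTrans (R.past k k.isLt.le ω) h p.1 p.2.1 p.2.2 x| ≤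
        l * (G.trans h p.1 p.2.1 p.2.2).1 x + L / (l * n) := fun x => by
      have h2 := hg.coord_sqrt k h p x hN hle
      rw [abs_sub_comm, ← mul_le_mul_iff_right₀ hn]
      refine h2.trans (le_of_eq ?_)
      change l * (n * (G.trans h p.1 p.2.1 p.2.2).1 x) + L / l = _
      field_simp
    have h2 : Fintype.card 𝒮 * (L / (l * n)) ≤ l := by
      have h3 : S * (L / (l * n)) = l := by
        rw [← mul_div_assoc, ← hln]
        field_simp
      rw [← h3]
      have : (Fintype.card 𝒮 : ℝ) ≤ S := by exact_mod_cast hS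
      rw [h3]
      calc _ ≤ S * (L / (l * n)) := mul_le_mul_of_nonneg_right this (by positivity)
        _ = l := h3
    calc _ ≤ ∑ x, (l * (G.trans h p.1 p.2.1 p.2.2).1 x + L / (l * n)) * c := by
          refine (Finset.abs_sum_le_sum_abs _ _).trans (Finset.sum_le_sum fun x _ => ?_)
          rw [abs_mul]
          exact mul_le_mul (h1 x) (hf x) (abs_nonneg _) ((abs_nonneg _).trans (h1 x))
      _ = (l + Fintype.card 𝒮 * (L / (l * n))) * c := by
          rw [← Finset.sum_mul, Finset.sum_add_distrib, ← Finset.mul_sum,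
            (G.trans h p.1 p.2.1 p.2.2).2.2]
          simp
      _ ≤ (l + l) * c := mul_le_mul_of_nonneg_right (by linarith) hc
      _ = _ := by ring
  · have h1 := abs_sum_sub_mul_le (G.trans h p.1 p.2.1 p.2.2)
      ⟨_, VIZero.empTrans_mem_stdSimplex hN⟩ hf
    refine h1.trans (le_mul_of_one_le_right (by positivity) ?_)
    rw [Real.one_le_sqrt, one_le_div hn]
    exact hlt.le

/-- Concentration at the nearest grid point, then Lipschitz dependence on `θ`. The scaling by `4 H`
turns the error `2 √(L' / n)` into `8 H √(L' / n)`; the constant shift cancels since both arguments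
are probability vectors. Rounding costs `2 H / K`. For `n < L'` the bound is trivial. -/
theorem Good.abs_sum_nashValue_le (hg : R.Good (gridFamily G (d * K)) S L L' W ω)
    (hL' : 0 < L') (hd : 0 < d) {θ : EuclideanSpace ℝ (Fin d)} (hθ : ‖θ‖ ≤ 1)
    {k : Fin K} {h : Fin H} {p : 𝒮 × 𝒜 × ℬ} (hN : R.count k k.isLt.le h p ω ≠ 0) :
    |∑ x, ((G.trans h p.1 p.2.1 p.2.2).1 x -
      VIZero.empTrans (R.past k k.isLt.le ω) h p.1 p.2.1 p.2.2 x) * G.nashValue θ h.succ x| ≤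
      8 * H * √(L' / R.count k k.isLt.le h p ω) + 2 * H / K := by
  have hn : (0 : ℝ) < R.count k k.isLt.le h p ω := by positivity
  have hH : (0 : ℝ) < H := by exact_mod_cast h.pos
  have hK : (1 : ℝ) ≤ K := by exact_mod_cast k.pos
  set q := G.trans h p.1 p.2.1 p.2.2 with hq
  set e : stdSimplex ℝ 𝒮 := ⟨_, VIZero.empTrans_mem_stdSimplex hN⟩ with he
  rcases le_or_gt L' (R.count k k.isLt.le h p ω : ℝ) with hle | hlt
  · obtain ⟨j, hj⟩ := exists_norm_sub_gridPoint_le hd k.pos hθ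
    -- A rounded point may leave the unit ball. Radius `2` suffices and keeps the scaled values in
    -- `[0, 1]`.
    have hj2 : ‖gridPoint (d * K) j‖ ≤ 2 := by
      have h1 := norm_sub_norm_le (gridPoint (d * K) j) θ
      rw [norm_sub_rev] at h1
      have h2 : 1 / (K : ℝ) ≤ 1 := (div_le_one (by linarith)).2 hK
      linarith
    set V := G.nashValue (gridPoint (d * K) j) h.succ with hV
    have h1 := hg.family k h p ⟨j, hj2⟩ hN hle
    set f := gridFamily G (d * K) ⟨j, hj2⟩ h with hf
    rw [div_sqrt_div hL' hn] at h1
    have h2 : G.expNext h p f ≤ 1 :=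
      stdSimplex_sum_mul_le _ fun x => (gridFamily_mem_Icc G _ _ h x).2
    have h3 : |R.empNext k k.isLt.le h p f ω - G.expNext h p f| ≤
        2 * √(L' / R.count k k.isLt.le h p ω) := by
      rw [← mul_le_mul_iff_right₀ hn]
      have h4 := Real.sqrt_nonneg (L' / R.count k k.isLt.le h p ω)
      nlinarith [mul_le_mul_of_nonneg_left h2 (mul_nonneg h4 hn.le)]
    have h5 : G.expNext h p f - R.empNext k k.isLt.le h p f ω =
        (∑ x, (q.1 x - e.1 x) * V x) / (4 * H) := by
      have h6 : ∀ x, f x = V x * (1 / (4 * H)) + 1 / 2 := fun x => by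
        simp only [hf, gridFamily, hV]
        field_simp
        ring
      have h7 : ∀ r : stdSimplex ℝ 𝒮, ∑ x, r.1 x * f x =
          (∑ x, r.1 x * V x) * (1 / (4 * H)) + 1 / 2 := fun r => by
        simp only [h6, mul_add, ← mul_assoc, Finset.sum_add_distrib, ← Finset.sum_mul, r.2.2,
          one_mul]
      have h8 := h7 q
      have h9 := h7 e
      rw [VMG.expNext, empNext]
      simp only [sub_mul, Finset.sum_sub_distrib]
      refine (congrArg₂ (· - ·) h8 h9).trans ?_
      ring
    have h6 : |∑ x, (q.1 x - e.1 x) * V x| ≤ 8 * H * √(L' / R.count k k.isLt.le h p ω) := by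
      rw [abs_sub_comm, h5, abs_div, abs_of_pos (by positivity : (0 : ℝ) < 4 * H),
        div_le_iff₀ (by positivity)] at h3
      linarith
    have h7 := abs_sum_sub_mul_le q e (f := fun x => G.nashValue θ h.succ x - V x) (c := H / K)
      fun x => (G.abs_nashValue_sub_le _ _ _ _).trans
        ((mul_le_mul_of_nonneg_left hj hH.le).trans_eq (by ring))
    have h8 : ∑ x, (q.1 x - e.1 x) * G.nashValue θ h.succ x = ∑ x, (q.1 x - e.1 x) * V x +
        ∑ x, (q.1 x - e.1 x) * (G.nashValue θ h.succ x - V x) := by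
      rw [← Finset.sum_add_distrib]
      exact Finset.sum_congr rfl fun _ _ => by ring
    change |∑ x, (q.1 x - e.1 x) * G.nashValue θ h.succ x| ≤ _
    rw [h8]
    refine (abs_add_le _ _).trans ((add_le_add h6 h7).trans_eq ?_)
    ring
  · have h1 := abs_sum_sub_mul_le q e (f := fun x => G.nashValue θ h.succ x) (c := H)
      fun x => (G.abs_nashValue_le θ _ x).trans (mul_le_of_le_one_right hH.le hθ)
    have h2 : 1 ≤ √(L' / R.count k k.isLt.le h p ω) := by
      rw [Real.one_le_sqrt, one_le_div hn]
      exact hlt.le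
    have h3 : 0 ≤ 2 * (H : ℝ) / K := by positivity
    refine h1.trans ?_
    nlinarith

/-- On the good event, the uncertainty functions of the algorithm dominate the estimation errors of
the empirical games. -/
theorem Good.isErrorBound (hg : R.Good (gridFamily G (d * K)) S L L' W ω) (hL : 0 < L)
    (hL' : 0 < L') (hd : 0 < d) (hS : Fintype.card 𝒮 ≤ S) (hS0 : 0 < S)
    {θ : EuclideanSpace ℝ (Fin d)} (hθ : ‖θ‖ ≤ 1) {β : ℕ → ℝ}
    (hβ : ∀ n : ℕ, n ≠ 0 → n < K → 3 * √(L / n) +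
      min (8 * H * √(L' / n) + 2 * H / K) (2 * H * √(S * L / n)) + S * (4 * H * L / n) * (2 * H) ≤
      β n)
    {k : Fin K} {Ghat : VMG d H 𝒮 𝒜 ℬ}
    (hG : VIZero.IsEmpiricalGame (R.past k k.isLt.le ω)
      (fun i h => R.ret (Fin.castLE k.isLt.le i) h ω) Ghat) :
    VMG.IsErrorBound G Ghat (G.nashValue θ) (VIZero.vTilde β (R.past k k.isLt.le ω)) := by
  intro h s a b
  set D := R.past k k.isLt.le ω with hD
  have hle := VIZero.qTilde_le_vTilde β D h s (a, b)
  -- At an unvisited triple `Q̃` equals `H`, which is why the model may be arbitrary there.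
  by_cases hN : VIZero.visits D h s a b = 0
  · left
    refine le_trans (le_of_eq ?_) hle
    simp [VIZero.qTilde, VIZero.qUpdate, hN]
  right
  have hN' : R.count k k.isLt.le h (s, a, b) ω ≠ 0 := hN
  have hn : (0 : ℝ) < R.count k k.isLt.le h (s, a, b) ω := by positivity
  obtain ⟨ht, hr⟩ := hG h s a b hN
  have hH : (0 : ℝ) ≤ H := by positivity
  have hV : ∀ x, |G.nashValue θ h.succ x| ≤ H := fun x =>
    (G.abs_nashValue_le θ _ x).trans (mul_le_of_le_one_right hH hθ)
  have h1 := hg.norm_ret_sub_le hL hN'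
  have h2 := hg.abs_sum_nashValue_le hL' hd hθ hN'
  have h3 := hg.abs_sum_le_of_card hL hS hS0 hN' hH hV
  have h4 := hg.abs_trans_sub_le hN'
  dsimp only at h1 h2 h3 h4
  -- Both controls of the Nash value hold at the same time, so their minimum may be taken as the
  -- second bonus.
  refine ⟨3 * √(L / R.count k k.isLt.le h (s, a, b) ω),
    min (8 * H * √(L' / R.count k k.isLt.le h (s, a, b) ω) + 2 * H / K)
    (2 * H * √(S * L / R.count k k.isLt.le h (s, a, b) ω)),
    4 * H * L / R.count k k.isLt.le h (s, a, b) ω, by positivity, ?_, ?_, ?_, ?_⟩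
  · rw [hr]
    exact h1
  · rw [ht]
    exact le_min h2 h3
  · rw [ht]
    exact h4
  · refine le_trans ?_ hle
    rw [VIZero.qTilde, VIZero.qUpdate, if_neg hN, ht]
    refine min_le_min (add_le_add le_rfl ?_) le_rfl
    refine le_trans ?_ (hβ (R.count k k.isLt.le h (s, a, b) ω) hN'
      (lt_of_le_of_lt (R.count_le k k.isLt.le h (s, a, b) ω) k.isLt))
    have : (Fintype.card 𝒮 : ℝ) ≤ S := by exact_mod_cast hS
    gcongr

end Good

end ExplorationRun

/-! ### Sums of bonuses over the visits of one triple. -/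

section Pigeonhole

/-- Compare `1 / √(n + 1)` with `2 (√(n + 1) - √n)` and `1 / (n + 1)` with `log (n + 1) - log n`.
The first visit is charged separately, at count `0`. -/
theorem sum_range_bonus_le {b : ℕ → ℝ} {b₀ a c : ℝ} (ha : 0 ≤ a) (hc : 0 ≤ c) (h0 : b 0 = b₀)
    (hb : ∀ n, n ≠ 0 → b n ≤ a / √n + c / n) (n : ℕ) :
    ∑ j ∈ Finset.range (n + 1), b j ≤ b₀ + 2 * a * √n + c * (1 + Real.log n) := by
  induction n with
  | zero => simp [h0, hc]
  | succ n ih =>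
    rw [Finset.sum_range_succ]
    have h1 := hb (n + 1) (Nat.succ_ne_zero n)
    rcases Nat.eq_zero_or_pos n with rfl | hn
    · simp [h0] at h1 ⊢
      linarith
    · have hn' : (0 : ℝ) < n := by exact_mod_cast hn
      have hs0 : 0 < √((n + 1 : ℕ) : ℝ) := Real.sqrt_pos.2 (by positivity)
      have h2 : a / √((n + 1 : ℕ) : ℝ) ≤ 2 * a * (√((n + 1 : ℕ) : ℝ) - √n) := by
        rw [div_le_iff₀ hs0]
        have h3 : √((n + 1 : ℕ) : ℝ) ^ 2 = n + 1 := by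
          rw [Real.sq_sqrt (by positivity)]; push_cast; ring
        have h4 : √(n : ℝ) ^ 2 = n := Real.sq_sqrt hn'.le
        have h5 : 1 ≤ 2 * (√((n + 1 : ℕ) : ℝ) - √n) * √((n + 1 : ℕ) : ℝ) := by
          nlinarith [sq_nonneg (√((n + 1 : ℕ) : ℝ) - √n)]
        nlinarith
      have h3 : 1 / ((n + 1 : ℕ) : ℝ) ≤ Real.log ((n + 1 : ℕ) : ℝ) - Real.log n := by
        rw [← Real.log_div (by positivity) hn'.ne']
        have h4 := Real.one_sub_inv_le_log_of_pos
          (show 0 < ((n + 1 : ℕ) : ℝ) / n by positivity)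
        refine le_trans (le_of_eq ?_) h4
        push_cast
        field_simp
        ring
      have h4 : c / ((n + 1 : ℕ) : ℝ) ≤ c * (Real.log ((n + 1 : ℕ) : ℝ) - Real.log n) := by
        rw [div_eq_mul_one_div]
        exact mul_le_mul_of_nonneg_left h3 hc
      linarith

end Pigeonhole

/-! ### Exploration: the uncertainties are small on average. -/

namespace ExplorationRun

variable {K d H : ℕ} {𝒮 𝒜 ℬ : Type*} [Fintype 𝒮] [Fintype 𝒜] [Fintype ℬ]
  {alg : ExplorePlan K d H 𝒮 𝒜 ℬ} {G : VMG d H 𝒮 𝒜 ℬ} {s₁ : 𝒮}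
  {Ω : Type*} {mΩ : MeasurableSpace Ω} {P : Measure Ω} (R : ExplorationRun alg G s₁ P)

open Classical in
theorem count_eq_sum (k : ℕ) (hk : k ≤ K) (h : Fin H) (p : 𝒮 × 𝒜 × ℬ) (ω : Ω) :
    R.count k hk h p ω = ∑ i : Fin k, if R.triple (Fin.castLE hk i) h ω = p then 1 else 0 := by
  rw [sum_triple_eq R k hk h p ω fun _ => (1 : ℕ)]
  simp [count, VIZero.visits]

open Classical in
theorem count_succ (k : ℕ) (hk : k + 1 ≤ K) (h : Fin H) (p : 𝒮 × 𝒜 × ℬ) (ω : Ω) :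
    R.count (k + 1) hk h p ω = R.count k ((Nat.le_succ k).trans hk) h p ω +
      if R.triple ⟨k, hk⟩ h ω = p then 1 else 0 := by
  rw [count_eq_sum, count_eq_sum, Fin.sum_univ_castSucc]
  rfl

theorem sum_count (k : ℕ) (hk : k ≤ K) (h : Fin H) (ω : Ω) : ∑ p, R.count k hk h p ω = k := by
  classical
  simp only [count_eq_sum]
  rw [Finset.sum_comm]
  simp

/-- Successive visits of a triple see the counts `0, 1, 2, …`, so the sum over episodes can be
regrouped by triples. -/
theorem sum_count_triple (b : ℕ → ℝ) (h : Fin H) (ω : Ω) (k : ℕ) (hk : k ≤ K) :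
    ∑ i : Fin k, b (R.count i (i.isLt.le.trans hk) h (R.triple (Fin.castLE hk i) h ω) ω) =
      ∑ p, ∑ j ∈ Finset.range (R.count k hk h p ω), b j := by
  classical
  induction k with
  | zero => simp [count_eq_sum]
  | succ k ih =>
    rw [Fin.sum_univ_castSucc]
    have h1 := ih ((Nat.le_succ k).trans hk)
    have h2 : ∀ p, ∑ j ∈ Finset.range (R.count (k + 1) hk h p ω), b j =
        ∑ j ∈ Finset.range (R.count k ((Nat.le_succ k).trans hk) h p ω), b j +
        if R.triple ⟨k, hk⟩ h ω = p then b (R.count k ((Nat.le_succ k).trans hk) h p ω) else 0 := by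
      intro p
      rw [count_succ]
      split_ifs
      · rw [Finset.sum_range_succ]
      · simp
    simp only [h2, Finset.sum_add_distrib, ← h1, Finset.sum_ite_eq, Finset.mem_univ, if_true]
    rfl

/-- The sum of bonuses at the visited triples. -/
theorem sum_bonus_le {b : ℕ → ℝ} {b₀ a c M : ℝ} (hb₀ : 0 ≤ b₀) (ha : 0 ≤ a) (hc : 0 ≤ c)
    (h0 : b 0 = b₀) (hb : ∀ n, n ≠ 0 → b n ≤ a / √n + c / n)
    (hM : Fintype.card (𝒮 × 𝒜 × ℬ) ≤ M) (h : Fin H) (ω : Ω) :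
    ∑ k : Fin K, b (R.count k k.isLt.le h (R.triple k h ω) ω) ≤
      M * (b₀ + c * (1 + Real.log K)) + 2 * a * √(M * K) := by
  have h1 := R.sum_count_triple b h ω K le_rfl
  have h2 : ∑ i : Fin K, b (R.count i (i.isLt.le.trans le_rfl) h
      (R.triple (Fin.castLE le_rfl i) h ω) ω) =
      ∑ k : Fin K, b (R.count k k.isLt.le h (R.triple k h ω) ω) := rfl
  rw [← h2, h1]
  have hlogK : 0 ≤ Real.log K := Real.log_natCast_nonneg K
  have h3 : ∀ p, ∑ j ∈ Finset.range (R.count K le_rfl h p ω), b j ≤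
      (b₀ + c * (1 + Real.log K)) + 2 * a * √(R.count K le_rfl h p ω) := by
    intro p
    have hle := R.count_le K le_rfl h p ω
    generalize R.count K le_rfl h p ω = n at hle
    rcases n with _ | n
    · simp only [Finset.range_zero, Finset.sum_empty]
      positivity
    · refine (sum_range_bonus_le ha hc h0 hb n).trans ?_
      have h4 : √(n : ℝ) ≤ √((n + 1 : ℕ) : ℝ) := Real.sqrt_le_sqrt (by push_cast; linarith)
      have h5 : Real.log n ≤ Real.log K := by
        rcases Nat.eq_zero_or_pos n with rfl | hn
        · simpa using hlogK
        · exact Real.log_le_log (by exact_mod_cast hn) (by exact_mod_cast (Nat.le_succ n).trans hle)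
      have h6 : c * (1 + Real.log n) ≤ c * (1 + Real.log K) :=
        mul_le_mul_of_nonneg_left (by linarith) hc
      have h7 : 2 * a * √(n : ℝ) ≤ 2 * a * √((n + 1 : ℕ) : ℝ) :=
        mul_le_mul_of_nonneg_left h4 (by positivity)
      linarith
  refine (Finset.sum_le_sum fun p _ => h3 p).trans ?_
  rw [Finset.sum_add_distrib, Finset.sum_const, Finset.card_univ, nsmul_eq_mul, ← Finset.mul_sum]
  -- Cauchy–Schwarz; the counts of one step sum to the number of episodes.
  have h8 : ∑ p, √(R.count K le_rfl h p ω) ≤ √(M * K) := by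
    apply Real.le_sqrt_of_sq_le
    refine (sq_sum_le_card_mul_sum_sq (s := Finset.univ)
      (f := fun p => √(R.count K le_rfl h p ω : ℝ))).trans ?_
    have h9 : ∑ p, √(R.count K le_rfl h p ω : ℝ) ^ 2 = K := by
      simp only [Real.sq_sqrt (Nat.cast_nonneg _)]
      exact_mod_cast R.sum_count K le_rfl h ω
    rw [h9, Finset.card_univ]
    exact mul_le_mul_of_nonneg_right hM (Nat.cast_nonneg _)
  refine add_le_add (mul_le_mul_of_nonneg_right hM (by positivity))
    (mul_le_mul_of_nonneg_left h8 (by positivity))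

section Exploration

variable [Nonempty 𝒜] [Nonempty ℬ] {β : ℕ → ℝ}
  {sel : ℕ → Fin H → 𝒮 → (𝒜 × ℬ → ℝ) → 𝒜 × ℬ}

/-- The uncertainty at the next state, scaled to the unit interval. -/
noncomputable def scaledUncertainty (β : ℕ → ℝ) (k : ℕ) (D : Fin k → Episode H 𝒮 𝒜 ℬ) (h : Fin H)
    (x : 𝒮) : ℝ :=
  VIZero.vTilde β D h.succ x / H

theorem scaledUncertainty_mem_Icc (hβ : ∀ t, 0 ≤ β t) (k : ℕ) (D : Fin k → Episode H 𝒮 𝒜 ℬ)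
    (h : Fin H) (x : 𝒮) : scaledUncertainty β k D h x ∈ Set.Icc 0 1 := by
  have hH : (0 : ℝ) < H := by exact_mod_cast h.pos
  have h1 := VIZero.vTilde_mem_Icc (D := D) hβ h.succ x
  exact ⟨div_nonneg h1.1 hH.le, (div_le_one hH).2 h1.2⟩

/-- The played action maximizes `Q̃`, so `Ṽ` at the visited state is a look-ahead at the visited
triple. Passing from `P̂` to `P` costs the factor `1 + 1/(2H)` and an additive error at most `β`,
hence `2β`. At a first visit `H` is charged. -/
theorem Good.vTilde_le {S : ℕ} {L L' : ℝ} {ω : Ω} {ι : Type*} {F : ι → Fin H → 𝒮 → ℝ}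
    {W : ∀ k : ℕ, (Fin k → Episode H 𝒮 𝒜 ℬ) → Fin H → 𝒮 → ℝ}
    {R : ExplorationRun (VIZero.algorithm K β s₁ sel) G s₁ P}
    (hg : R.Good F S L L' W ω)
    (hsel : ∀ k h s (f : 𝒜 × ℬ → ℝ) p, f p ≤ f (sel k h s f)) (hL : 0 < L)
    (hS : Fintype.card 𝒮 ≤ S) (hβ0 : ∀ t, 0 ≤ β t)
    (hβ : ∀ n : ℕ, n ≠ 0 → n < K → S * (2 * H * L / n) * H ≤ β n) (k : Fin K) (h : Fin H) :
    VIZero.vTilde β (R.past k k.isLt.le ω) h.castSucc ((R.episode k ω).state h.castSucc) ≤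
      (1 + 1 / (2 * H)) * G.expNext h (R.triple k h ω)
        (VIZero.vTilde β (R.past k k.isLt.le ω) h.succ) +
      (fun n : ℕ => if n = 0 then (H : ℝ) else 2 * β n)
        (R.count k k.isLt.le h (R.triple k h ω) ω) := by
  set D := R.past k k.isLt.le ω with hD
  set p := R.triple k h ω with hp
  have hH : (0 : ℝ) < H := by exact_mod_cast h.pos
  have hw := VIZero.vTilde_mem_Icc (D := D) hβ0 h.succ
  have hact : p.2 = sel k h p.1 (VIZero.qTilde β D h p.1) := R.act_eq k h ω
  have hv : VIZero.vTilde β D h.castSucc p.1 ≤ VIZero.qTilde β D h p.1 p.2 := by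
    rw [VIZero.vTilde_castSucc, hact]
    exact Finset.sup'_le _ _ fun q _ => hsel k h _ _ q
  refine hv.trans ?_
  have hq := (G.trans h p.1 p.2.1 p.2.2).2
  have hE0 : 0 ≤ G.expNext h p (VIZero.vTilde β D h.succ) :=
    Finset.sum_nonneg fun x _ => mul_nonneg (hq.1 x) (hw x).1
  rw [VIZero.qTilde, VIZero.qUpdate]
  by_cases hN : R.count k k.isLt.le h p ω = 0
  · have hN' : VIZero.visits D h p.1 p.2.1 p.2.2 = 0 := hN
    simp only [hN, hN', if_true]
    have : 0 ≤ (1 + 1 / (2 * (H : ℝ))) * G.expNext h p (VIZero.vTilde β D h.succ) := by positivity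
    linarith
  · have hN' : VIZero.visits D h p.1 p.2.1 p.2.2 ≠ 0 := hN
    simp only [hN, hN', if_false]
    refine (min_le_left _ _).trans ?_
    have h1 := hg.abs_empTrans_sub_le hN
    have h2 : ∑ x, VIZero.empTrans D h p.1 p.2.1 p.2.2 x * VIZero.vTilde β D h.succ x ≤
        ∑ x, ((1 + 1 / (2 * H)) * ((G.trans h p.1 p.2.1 p.2.2).1 x *
          VIZero.vTilde β D h.succ x) + 2 * H * L / R.count k k.isLt.le h p ω * H) := by
      refine Finset.sum_le_sum fun x _ => ?_
      have h3 := (abs_le.1 (h1 x)).2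
      have h4 : 0 ≤ 2 * H * L / R.count k k.isLt.le h p ω := by positivity
      calc _ ≤ ((1 + 1 / (2 * H)) * (G.trans h p.1 p.2.1 p.2.2).1 x +
            2 * H * L / R.count k k.isLt.le h p ω) * VIZero.vTilde β D h.succ x := by
            refine mul_le_mul_of_nonneg_right ?_ (hw x).1
            have h5 : (1 + 1 / (2 * H)) * (G.trans h p.1 p.2.1 p.2.2).1 x =
              (G.trans h p.1 p.2.1 p.2.2).1 x + (G.trans h p.1 p.2.1 p.2.2).1 x / (2 * H) := by
              ring
            rw [h5]
            linarith
        _ ≤ _ := by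
            rw [add_mul, mul_assoc]
            exact add_le_add le_rfl (mul_le_mul_of_nonneg_left (hw x).2 h4)
    rw [Finset.sum_add_distrib, ← Finset.mul_sum, Finset.sum_const, Finset.card_univ,
      nsmul_eq_mul] at h2
    have h5 : Fintype.card 𝒮 * (2 * H * L / R.count k k.isLt.le h p ω * H) ≤
        β (R.count k k.isLt.le h p ω) := by
      refine le_trans ?_ (hβ _ hN (lt_of_le_of_lt (R.count_le k k.isLt.le h p ω) k.isLt))
      have : (Fintype.card 𝒮 : ℝ) ≤ S := by exact_mod_cast hS
      have h6 : 0 ≤ 2 * H * L / R.count k k.isLt.le h p ω * H := by positivity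
      exact (mul_le_mul_of_nonneg_right this h6).trans_eq (mul_assoc _ _ _).symm
    change _ + β (R.count k k.isLt.le h p ω) ≤ (1 + 1 / (2 * H)) * (∑ x,
      (G.trans h p.1 p.2.1 p.2.2).1 x * VIZero.vTilde β D h.succ x) + _
    linarith

/-- On the good event, the sum of the initial uncertainties over the episodes is small. -/
theorem Good.sum_vTilde_le {S : ℕ} {L L' : ℝ} {ω : Ω} {ι : Type*} {F : ι → Fin H → 𝒮 → ℝ}
    {R : ExplorationRun (VIZero.algorithm K β s₁ sel) G s₁ P}
    (hg : R.Good F S L L' (scaledUncertainty β) ω)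
    (hsel : ∀ k h s (f : 𝒜 × ℬ → ℝ) p, f p ≤ f (sel k h s f)) (hL : 0 < L)
    (hS : Fintype.card 𝒮 ≤ S) (hβ0 : ∀ t, 0 ≤ β t)
    (hβ : ∀ n : ℕ, n ≠ 0 → n < K → S * (2 * H * L / n) * H ≤ β n)
    {a c M : ℝ} (ha : 0 ≤ a) (hc : 0 ≤ c) (hβac : ∀ n : ℕ, n ≠ 0 → β n ≤ a / √n + c / n)
    (hM : Fintype.card (𝒮 × 𝒜 × ℬ) ≤ M) :
    ∑ k : Fin K, VIZero.vTilde β (R.past k k.isLt.le ω) 0 s₁ ≤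
      8 * H * (M * (H + 2 * c * (1 + Real.log K)) + 4 * a * √(M * K) + 8 * H ^ 2 * L) := by
  set v : Fin (H + 1) → ℝ := fun h => ∑ k : Fin K,
    VIZero.vTilde β (R.past k k.isLt.le ω) h ((R.episode k ω).state h) with hv
  set B : ℝ := M * (H + 2 * c * (1 + Real.log K)) + 4 * a * √(M * K) + 8 * H ^ 2 * L with hB
  have hlogK : 0 ≤ Real.log K := Real.log_natCast_nonneg K
  have hM0 : 0 ≤ M := (Nat.cast_nonneg _).trans hM
  have hB0 : 0 ≤ B := by positivity
  have hv0 : ∀ h, 0 ≤ v h := fun h => Finset.sum_nonneg fun k _ =>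
    (VIZero.vTilde_mem_Icc _ hβ0 _ _).1
  have hstep : ∀ h : Fin H, v h.castSucc ≤ (1 + 1 / (H : ℝ)) ^ 2 * v h.succ + B := by
    intro h
    have hH : (1 : ℝ) ≤ H := by exact_mod_cast h.pos
    set C : ℝ := ∑ k : Fin K, G.expNext h (R.triple k h ω)
      (VIZero.vTilde β (R.past k k.isLt.le ω) h.succ) with hC
    have h1 : v h.castSucc ≤ (1 + 1 / (2 * H)) * C +
        ∑ k : Fin K, (fun n : ℕ => if n = 0 then (H : ℝ) else 2 * β n)
          (R.count k k.isLt.le h (R.triple k h ω) ω) := by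
      rw [hC, Finset.mul_sum, ← Finset.sum_add_distrib]
      exact Finset.sum_le_sum fun k _ => hg.vTilde_le hsel hL hS hβ0 hβ k h
    have h2 := R.sum_bonus_le (b := fun n : ℕ => if n = 0 then (H : ℝ) else 2 * β n)
      (b₀ := H) (a := 2 * a) (c := 2 * c) (M := M) (by positivity) (by positivity) (by positivity)
      (by simp) (fun n hn => by
        simp only [hn, if_false]
        have := hβac n hn
        rw [mul_div_assoc, mul_div_assoc]
        linarith) hM h ω
    have h3 := hg.next h
    have h4 : ∑ k : Fin K, scaledUncertainty β k (R.past k k.isLt.le ω) h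
        ((R.episode k ω).state h.succ) = v h.succ / H := by
      simp only [scaledUncertainty, hv, Finset.sum_div]
    have h5 : ∑ k : Fin K, G.expNext h (R.triple k h ω)
        (scaledUncertainty β k (R.past k k.isLt.le ω) h) = C / H := by
      rw [hC, Finset.sum_div]
      refine Finset.sum_congr rfl fun k _ => ?_
      simp only [VMG.expNext, scaledUncertainty, Finset.sum_div, mul_div_assoc]
    rw [h4, h5] at h3
    have hC0 : 0 ≤ C := Finset.sum_nonneg fun k _ => Finset.sum_nonneg fun x _ =>
      mul_nonneg ((G.trans h _ _ _).2.1 x) (VIZero.vTilde_mem_Icc _ hβ0 _ _).1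
    -- The martingale error is relative, with `η = 1/(2H)`, so it is mostly absorbed by `C` itself;
    -- what remains does not grow with `√K`.
    have h6 : C ≤ v h.succ + C / (2 * H) + 2 * H ^ 2 * L := by
      have h7 := (abs_le.1 h3).1
      have h8 : C / H - v h.succ / H ≤ 1 / (2 * H) * (C / H) + 2 * H * L := by linarith
      have h9 := mul_le_mul_of_nonneg_left h8 (zero_le_one.trans hH)
      have h10 : H * (C / H - v h.succ / H) = C - v h.succ := by field_simp
      have h11 : H * (1 / (2 * H) * (C / H) + 2 * H * L) = C / (2 * H) + 2 * H ^ 2 * L := by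
        field_simp
      linarith
    -- For `x ≤ 1/2` one has `(1 + 2x)(1 - x) ≥ 1`. Thus both relative errors of a step are covered
    -- by `(1 + 2x)² = (1 + 1/H)²`.
    set x : ℝ := 1 / (2 * H) with hx
    have hx0 : 0 ≤ x := by positivity
    have hx1 : x ≤ 1 / 2 := by
      rw [hx, div_le_div_iff₀ (by positivity) (by norm_num)]; linarith
    have hx2 : 1 / (H : ℝ) = 2 * x := by rw [hx]; field_simp
    have h7 : C / (2 * H) = x * C := by rw [hx]; ring
    rw [h7] at h6
    have hL2 : 0 ≤ 2 * (H : ℝ) ^ 2 * L := by positivity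
    have h8 : C ≤ (1 + 2 * x) * (v h.succ + 2 * H ^ 2 * L) := by
      have h9 : (1 + 2 * x) * (C * (1 - x)) ≤ (1 + 2 * x) * (v h.succ + 2 * H ^ 2 * L) :=
        mul_le_mul_of_nonneg_left (by linarith) (by linarith)
      have h10 : C ≤ (1 + 2 * x) * (C * (1 - x)) := by
        nlinarith [mul_nonneg (mul_nonneg hx0 hC0) (show 0 ≤ 1 - 2 * x by linarith)]
      linarith
    have h9 : (1 + x) * C ≤ (1 + 2 * x) ^ 2 * (v h.succ + 2 * H ^ 2 * L) := by
      calc (1 + x) * C ≤ (1 + 2 * x) * C := mul_le_mul_of_nonneg_right (by linarith) hC0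
        _ ≤ (1 + 2 * x) * ((1 + 2 * x) * (v h.succ + 2 * H ^ 2 * L)) :=
          mul_le_mul_of_nonneg_left h8 (by linarith)
        _ = _ := by ring
    have h10 : (1 + 2 * x) ^ 2 * (2 * H ^ 2 * L) ≤ 4 * (2 * H ^ 2 * L) :=
      mul_le_mul_of_nonneg_right (by nlinarith) hL2
    rw [hx2]
    rw [mul_add] at h9
    linarith
  have hind : ∀ h : Fin (H + 1),
      v h ≤ (H - (h : ℕ) : ℕ) * (((1 + 1 / (H : ℝ)) ^ 2) ^ (H - (h : ℕ)) * B) := by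
    intro h
    induction h using Fin.reverseInduction with
    | last => simp [hv]
    | cast h ih =>
      set y : ℝ := (1 + 1 / (H : ℝ)) ^ 2 with hy
      have hy1 : 1 ≤ y := one_le_pow₀ (by simp)
      have hsub : H - (h.castSucc : ℕ) = (H - (h.succ : ℕ)) + 1 := by
        have := h.isLt
        simp only [Fin.val_succ, Fin.val_castSucc]
        omega
      rw [hsub]
      set n := H - (h.succ : ℕ)
      calc v h.castSucc ≤ y * v h.succ + B := hstep h
        _ ≤ y * (n * (y ^ n * B)) + y ^ (n + 1) * B :=
          add_le_add (mul_le_mul_of_nonneg_left ih (by linarith))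
            (le_mul_of_one_le_left hB0 (one_le_pow₀ hy1))
        _ = _ := by push_cast; ring
  have h1 := hind 0
  have h2 : v 0 = ∑ k : Fin K, VIZero.vTilde β (R.past k k.isLt.le ω) 0 s₁ := by
    simp only [hv, R.state_zero]
  rw [← h2]
  refine h1.trans ?_
  simp only [Fin.coe_ofNat_eq_mod, Nat.zero_mod, Nat.sub_zero]
  -- `exp 2 < 8`.
  have h3 : ((1 + 1 / (H : ℝ)) ^ 2) ^ H ≤ 8 := by
    rw [pow_right_comm]
    have h4 := (VMG.one_add_inv_pow_le_exp H).trans Real.exp_one_lt_d9.le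
    have h5 : 0 ≤ (1 + 1 / (H : ℝ)) ^ H := by positivity
    nlinarith
  calc (H : ℝ) * (((1 + 1 / (H : ℝ)) ^ 2) ^ H * B) ≤ H * (8 * B) :=
        mul_le_mul_of_nonneg_left (mul_le_mul_of_nonneg_right h3 hB0) (Nat.cast_nonneg _)
    _ = 8 * H * B := by ring

end Exploration

end ExplorationRun

/-! ### Constants and logarithms. -/

section Numerics

/-- The union bound: the probabilities of the bad events sum up to at most `δ`. -/
theorem union_bound_le {d K : ℕ} {U V H Q X δ : ℝ} (hd : 0 < d) (hX : 2 ≤ X) (hδ : 1 / X ≤ δ)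
    (hU0 : 0 ≤ U) (hU : U ≤ X) (hV : V ≤ 3 * X) (hH : H ≤ X)
    (hQ0 : 0 ≤ Q) (hQ : Q ≤ (3 * X) ^ d) (hK : (K : ℝ) ≤ X) :
    2 * (U * V + H) * Real.exp (-(10 * Real.log X)) +
      2 * (U * (Q * K)) * Real.exp (-(10 * (d * Real.log X))) ≤ δ := by
  have hX0 : 0 < X := by linarith
  set y := 1 / X with hy
  have hy0 : 0 < y := by positivity
  have hy2 : y ≤ 1 / 2 := by
    rw [hy]
    exact one_div_le_one_div_of_le (by norm_num) hX
  have hXy : X * y = 1 := by rw [hy]; field_simp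
  have e1 : Real.exp (-(10 * Real.log X)) = y ^ 10 := by
    rw [Real.exp_neg, show (10 : ℝ) * Real.log X = (10 : ℕ) * Real.log X by norm_num,
      Real.exp_nat_mul, Real.exp_log hX0, hy, one_div, inv_pow]
  have e2 : Real.exp (-(10 * (d * Real.log X))) = (y ^ 10) ^ d := by
    rw [← e1, ← Real.exp_nat_mul]
    congr 1
    ring
  rw [e1, e2]
  have h1 : 2 * (U * V + H) * y ^ 10 ≤ 8 * y ^ 8 := by
    have : U * V + H ≤ 4 * X ^ 2 := by
      have : U * V ≤ X * (3 * X) :=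
        (mul_le_mul_of_nonneg_left hV hU0).trans (mul_le_mul_of_nonneg_right hU (by positivity))
      nlinarith
    calc 2 * (U * V + H) * y ^ 10 ≤ 2 * (4 * X ^ 2) * y ^ 10 := by gcongr
      _ = 8 * (X * y) ^ 2 * y ^ 8 := by ring
      _ = 8 * y ^ 8 := by rw [hXy]; ring
  have h3 : 3 * X ≤ X ^ 3 := by nlinarith [mul_nonneg hX0.le (show 0 ≤ X ^ 2 - 4 by nlinarith)]
  -- The level `L'` is `d` times as large as `L`, so `exp (-L')` is a `d`-th power and beats the
  -- cardinality of the grid, at most `(3 X)^d`.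
  have h2 : 2 * (U * (Q * K)) * (y ^ 10) ^ d ≤ 2 * y ^ 5 := by
    have h4 : Q ≤ (X ^ 3) ^ d := hQ.trans (pow_le_pow_left₀ (by positivity) h3 d)
    have h5 : Q * K ≤ (X ^ 3) ^ d * X :=
      mul_le_mul h4 hK (Nat.cast_nonneg K) (by positivity)
    have h6 : U * (Q * K) ≤ X * ((X ^ 3) ^ d * X) :=
      mul_le_mul hU h5 (mul_nonneg hQ0 (Nat.cast_nonneg K)) hX0.le
    have h7 : (y ^ 7) ^ d ≤ y ^ 7 := by
      have : y ^ 7 ≤ 1 := pow_le_one₀ hy0.le (by linarith)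
      exact pow_le_of_le_one (by positivity) this hd.ne'
    calc 2 * (U * (Q * K)) * (y ^ 10) ^ d ≤ 2 * (X * ((X ^ 3) ^ d * X)) * (y ^ 10) ^ d := by gcongr
      _ = 2 * X ^ 2 * (((X * y) ^ 3 * y ^ 7) ^ d) := by
          rw [show (X * y) ^ 3 * y ^ 7 = X ^ 3 * y ^ 10 by ring, mul_pow (X ^ 3)]; ring
      _ = 2 * X ^ 2 * (y ^ 7) ^ d := by rw [hXy]; norm_num
      _ ≤ 2 * X ^ 2 * y ^ 7 := by gcongr
      _ = 2 * (X * y) ^ 2 * y ^ 5 := by ring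
      _ = 2 * y ^ 5 := by rw [hXy]; ring
  have h8 : y ^ 8 ≤ y ^ 5 := pow_le_pow_of_le_one hy0.le (by linarith) (by norm_num)
  have h9 : y ^ 4 ≤ (1 / 2) ^ 4 := pow_le_pow_left₀ hy0.le hy2 4
  have h10 : y ^ 5 = y ^ 4 * y := by ring
  have h11 : y ^ 4 * y ≤ (1 / 2) ^ 4 * y := mul_le_mul_of_nonneg_right h9 hy0.le
  linarith

theorem sqrt_ten_mul_div_le {u q ι n : ℝ} (hn : 0 < n) (hι : 0 ≤ ι) (hu : 0 ≤ u) (h : u ≤ q) :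
    √(u * (10 * ι) / n) ≤ 4 * √(q * ι / n) := by
  rw [show (4 : ℝ) = √16 by rw [show (16 : ℝ) = 4 ^ 2 by norm_num, Real.sqrt_sq (by norm_num)],
    ← Real.sqrt_mul (by norm_num)]
  apply Real.sqrt_le_sqrt
  rw [mul_div_assoc, mul_div_assoc, mul_div_assoc]
  have h1 : 0 ≤ ι / n := by positivity
  have h2 := mul_le_mul_of_nonneg_right h h1
  have h3 : 0 ≤ u * (ι / n) := by positivity
  linarith

/-- The bonus dominates the estimation errors. -/
theorem estimation_error_le {d H S K n : ℕ} {ι : ℝ} (hd : 1 ≤ d) (hH : 1 ≤ H) (hS : 1 ≤ S)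
    (hι : 2 / 3 ≤ ι) (hn : n ≠ 0) (hnK : n < K) :
    3 * √(10 * ι / n) + min (8 * H * √(10 * (d * ι) / n) + 2 * H / K)
        (2 * H * √(S * (10 * ι) / n)) + S * (4 * H * (10 * ι) / n) * (2 * H) ≤
      100 * (√(min (d : ℝ) S * (H : ℝ) ^ 2 * ι / n) + (H : ℝ) ^ 2 * S * ι / n) := by
  have hd' : (1 : ℝ) ≤ d := by exact_mod_cast hd
  have hH' : (1 : ℝ) ≤ H := by exact_mod_cast hH
  have hS' : (1 : ℝ) ≤ S := by exact_mod_cast hS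
  have hn' : (0 : ℝ) < n := by exact_mod_cast Nat.pos_of_ne_zero hn
  have hι0 : 0 ≤ ι := by linarith
  have hm : 1 ≤ min (d : ℝ) S := le_min hd' hS'
  have hH2 : (1 : ℝ) ≤ (H : ℝ) ^ 2 := one_le_pow₀ hH'
  set q := √(min (d : ℝ) S * (H : ℝ) ^ 2 * ι / n) with hq
  set t := (H : ℝ) ^ 2 * S * ι / n with ht
  have hq0 : 0 ≤ q := Real.sqrt_nonneg _
  have ht0 : 0 ≤ t := by positivity
  have h1 : √(10 * ι / n) ≤ 4 * q := by
    have := sqrt_ten_mul_div_le (u := 1) (q := min (d : ℝ) S * (H : ℝ) ^ 2) hn' hι0 zero_le_one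
      (by nlinarith)
    rwa [one_mul] at this
  have hmul : ∀ u : ℝ, 0 ≤ u → u ≤ min (d : ℝ) S → H * √(u * (10 * ι) / n) ≤ 4 * q := by
    intro u hu hum
    have h := sqrt_ten_mul_div_le (u := u * (H : ℝ) ^ 2) (q := min (d : ℝ) S * (H : ℝ) ^ 2) hn' hι0
      (by positivity) (by gcongr)
    rwa [show u * (H : ℝ) ^ 2 * (10 * ι) / n = (H : ℝ) ^ 2 * (u * (10 * ι) / n) by ring,
      Real.sqrt_mul (by positivity), Real.sqrt_sq (by positivity)] at h
  have h2 : min (8 * H * √(10 * (d * ι) / n) + 2 * H / K) (2 * H * √(S * (10 * ι) / n)) ≤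
      32 * q + 3 * t := by
    rcases le_total (d : ℝ) S with h | h
    · refine (min_le_left _ _).trans ?_
      have h3 := hmul d (by positivity) (le_min le_rfl h)
      rw [show (d : ℝ) * (10 * ι) = 10 * (d * ι) by ring] at h3
      -- The rounding error is paid for by the lower-order part of the bonus, as `n < K` and `ι ≥
      -- 2/3`.
      have h4 : 2 * (H : ℝ) / K ≤ 3 * t := by
        have : 2 * (H : ℝ) / K ≤ 2 * H / n := by gcongr
        refine this.trans ?_
        rw [ht, ← mul_div_assoc]
        refine div_le_div_of_nonneg_right ?_ hn'.le
        have h5 : 2 / 3 ≤ (H * S : ℝ) * ι := by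
          have : (1 : ℝ) ≤ H * S := one_le_mul_of_one_le_of_one_le hH' hS'
          nlinarith
        have h6 := mul_le_mul_of_nonneg_left h5 (show (0 : ℝ) ≤ H by linarith)
        linarith
      linarith
    · refine (min_le_right _ _).trans ?_
      have h3 := hmul S (by positivity) (le_min h le_rfl)
      linarith
  have h3 : S * (4 * H * (10 * ι) / n) * (2 * H) = 80 * t := by rw [ht]; ring
  rw [h3]
  linarith

/-- If `K` exceeds `2 ^ 42` times the rate with the logarithm of `Z`, then also with the
logarithm of `Z * K`, up to a constant. -/
theorem rate_log_le {Z a₁ a₂ K ι : ℝ} (hZ : 2 ≤ Z) (ha₁ : 0 < a₁) (ha₂ : 0 ≤ a₂)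
    (h₁ : a₁ ≤ Z ^ 4) (h₂ : a₂ ≤ Z ^ 4) (hK : 2 ^ 42 * (a₁ * Real.log Z + a₂ * Real.log Z ^ 2) ≤ K)
    (hι0 : 0 ≤ ι) (hι : ι ≤ Real.log Z + Real.log K) :
    a₁ * ι ≤ 53 * (K / 2 ^ 42) ∧ a₂ * ι ^ 2 ≤ 2809 * (K / 2 ^ 42) := by
  set i := Real.log Z with hi
  have hlog2 : 2 / 3 ≤ Real.log 2 := by linarith [Real.log_two_gt_d9]
  have hi2 : Real.log 2 ≤ i := Real.log_le_log (by norm_num) hZ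
  have hi0 : 0 < i := by linarith
  have hiZ : i ≤ Z := (Real.log_le_sub_one_of_pos (by linarith)).trans (by linarith)
  have hZ0 : 0 < Z := by linarith
  set ρ := a₁ * i + a₂ * i ^ 2 with hρ
  have hρ0 : 0 < ρ := by positivity
  have hρZ : ρ ≤ Z ^ 7 := by
    have e1 : a₁ * i ≤ Z ^ 4 * Z := mul_le_mul h₁ hiZ hi0.le (by positivity)
    have e2 : a₂ * i ^ 2 ≤ Z ^ 4 * Z ^ 2 :=
      mul_le_mul h₂ (pow_le_pow_left₀ hi0.le hiZ 2) (by positivity) (by positivity)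
    have e3 : Z ^ 4 * Z ≤ Z ^ 6 := by
      rw [← pow_succ]; exact pow_le_pow_right₀ (by linarith) (by norm_num)
    have e4 : 2 * Z ^ 6 ≤ Z ^ 7 := by
      rw [pow_succ Z 6, mul_comm]; gcongr
    have e5 : Z ^ 4 * Z ^ 2 = Z ^ 6 := by ring
    linarith
  have hKpos : 0 < K := lt_of_lt_of_le (by positivity) hK
  -- `r` is the excess of `K` over the required size. It enters `log K` only through `log r ≤ 2 √r`,
  -- so even the square of the logarithm grows at most linearly in `r`, like `K`.
  set r := K / (2 ^ 42 * ρ) with hr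
  have hr1 : 1 ≤ r := (one_le_div (by positivity)).2 hK
  have hKr : K = 2 ^ 42 * ρ * r := by rw [hr]; field_simp
  have hsr : 1 ≤ √r := Real.one_le_sqrt.2 hr1
  have hlogr : Real.log r ≤ 2 * √r := by
    have h := Real.log_le_sub_one_of_pos (show 0 < √r by linarith)
    rw [Real.log_sqrt (by linarith)] at h
    linarith
  have hlogρ : Real.log ρ ≤ 7 * i := by
    have := Real.log_le_log hρ0 hρZ
    rwa [Real.log_pow] at this
  have hlogK : Real.log K = 42 * Real.log 2 + Real.log ρ + Real.log r := by
    rw [hKr, Real.log_mul (by positivity) (by positivity),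
      Real.log_mul (by positivity) (by positivity), Real.log_pow]
    norm_num
  -- `53 = 1 + 42 + 7 + 3`: from `log Z`, from `2 ^ 42`, from `ρ ≤ Z ^ 7`, and from `2 √r ≤ 3 i √r`
  -- by `i ≥ 2/3`.
  have hιr : ι ≤ 53 * (i * √r) := by
    have e1 : i ≤ i * √r := le_mul_of_one_le_right hi0.le hsr
    have e2 : 2 / 3 * √r ≤ i * √r := by gcongr; linarith
    linarith
  have hrr : √r * √r = r := Real.mul_self_sqrt (by linarith)
  have hKρ : K / 2 ^ 42 = ρ * r := by rw [hKr]; ring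
  have hsr' : √r ≤ r := by
    calc √r = √r * 1 := (mul_one _).symm
      _ ≤ √r * √r := by gcongr
      _ = r := hrr
  have hr0 : 0 ≤ r := by linarith
  have ha₂i : 0 ≤ a₂ * i ^ 2 := by positivity
  have ha₁i : 0 ≤ a₁ * i := by positivity
  rw [hKρ]
  constructor
  · calc a₁ * ι ≤ a₁ * (53 * (i * √r)) := by gcongr
      _ = 53 * (a₁ * i * √r) := by ring
      _ ≤ 53 * (ρ * r) := by
        have : a₁ * i ≤ ρ := by linarith
        gcongr
  · calc a₂ * ι ^ 2 ≤ a₂ * (53 * (i * √r)) ^ 2 := by gcongr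
      _ = 2809 * (a₂ * i ^ 2 * (√r * √r)) := by ring
      _ ≤ 2809 * (ρ * r) := by
        have : a₂ * i ^ 2 ≤ ρ := by linarith
        rw [hrr]
        gcongr

/-- The square-root term takes half of `K ε`, since `115200 = 2 · 18 · 8 · 400`. The other terms are
multiples of `T`, with factors summing to at most `115200`, and take the other half. -/
theorem exploration_bound_le {m H S M ι K ε : ℝ} (hm : 0 ≤ m) (hH : 1 ≤ H) (hS : 1 ≤ S)
    (hM : 1 ≤ M) (hι : 2 / 3 ≤ ι) (hK : 0 < K) (hε : 0 < ε) (hlog : Real.log K ≤ ι)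
    (h₁ : 115200 ^ 2 * (m * H ^ 4 * M * ι) ≤ K * ε ^ 2)
    (h₂ : 230400 * (H ^ 3 * S * M * ι ^ 2) ≤ K * ε) :
    18 * (8 * H * (M * (H + 2 * (100 * (H ^ 2 * S * ι)) * (1 + Real.log K)) +
      4 * (100 * √(m * H ^ 2 * ι)) * √(M * K) + 8 * H ^ 2 * (10 * ι))) ≤ K * ε := by
  have hι0 : 0 ≤ ι := by linarith
  set T := H ^ 3 * S * M * ι ^ 2 with hT
  have hsqrt : H * (√(m * H ^ 2 * ι) * √(M * K)) * 115200 ≤ K * ε := by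
    have : H * (√(m * H ^ 2 * ι) * √(M * K)) * 115200 =
        √(115200 ^ 2 * (m * H ^ 4 * M * ι) * K) := by
      rw [← Real.sqrt_mul (by positivity),
        show 115200 ^ 2 * (m * H ^ 4 * M * ι) * K =
          (H * 115200) ^ 2 * (m * H ^ 2 * ι * (M * K)) by ring,
        Real.sqrt_mul (x := (H * 115200) ^ 2) (by positivity), Real.sqrt_sq (by positivity)]
      ring
    rw [this]
    refine Real.sqrt_le_iff.2 ⟨by positivity, ?_⟩
    calc _ ≤ K * ε ^ 2 * K := by gcongr
      _ = _ := by ring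
  have hSι : 2 / 3 ≤ S * ι := by nlinarith
  have hι2 : 4 / 9 ≤ ι ^ 2 := by nlinarith
  have h3 : H * (M * H) * (4 / 9) ≤ T := by
    have : H * (M * H) ≤ H ^ 3 * S * M := by
      calc H * (M * H) = H ^ 2 * 1 * M := by ring
        _ ≤ H ^ 3 * S * M := by
          have : H ^ 2 ≤ H ^ 3 := pow_le_pow_right₀ hH (by norm_num)
          gcongr
    rw [hT]
    gcongr
  have h4 : H * (M * (H ^ 2 * S * ι * (1 + Real.log K))) ≤ 3 * T := by
    calc H * (M * (H ^ 2 * S * ι * (1 + Real.log K))) ≤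
        H * (M * (H ^ 2 * S * ι * (3 * ι))) := by gcongr; linarith
      _ = 3 * T := by rw [hT]; ring
  have h5 : H * (H ^ 2 * ι) * (2 / 3) ≤ T := by
    calc H * (H ^ 2 * ι) * (2 / 3) = H ^ 3 * 1 * 1 * (ι * (2 / 3)) := by ring
      _ ≤ H ^ 3 * S * M * (ι * ι) := by gcongr
      _ = T := by rw [hT]; ring
  have h6 : 18 * (8 * H * (M * (H + 2 * (100 * (H ^ 2 * S * ι)) * (1 + Real.log K)) +
      4 * (100 * √(m * H ^ 2 * ι)) * √(M * K) + 8 * H ^ 2 * (10 * ι))) =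
      144 * (H * (M * H)) + 28800 * (H * (M * (H ^ 2 * S * ι * (1 + Real.log K)))) +
      (H * (√(m * H ^ 2 * ι) * √(M * K)) * 115200) / 2 + 11520 * (H * (H ^ 2 * ι)) := by ring
  have hT0 : 0 ≤ T := by positivity
  rw [h6]
  linarith

end Numerics

/-! ### Degenerate games, existence of an output, and the assembly of the proof. -/

instance {α : Type*} [Fintype α] [Subsingleton α] : Subsingleton (stdSimplex ℝ α) := by
  refine ⟨fun x y => Subtype.ext (funext fun a => ?_)⟩
  have h : ∀ x : stdSimplex ℝ α, x.1 a = 1 := fun x => by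
    rw [← x.2.2]
    exact (Fintype.sum_subsingleton _ a).symm
  rw [h x, h y]

namespace VMG

variable {d H : ℕ} {𝒮 𝒜 ℬ : Type*} [Fintype 𝒮] [Fintype 𝒜] [Fintype ℬ]

theorem dualityGap_eq_zero [Subsingleton 𝒜] [Subsingleton ℬ] (G : VMG d H 𝒮 𝒜 ℬ) (s₁ : 𝒮)
    (θ : EuclideanSpace ℝ (Fin d)) (μ : Policy H 𝒮 𝒜) (ν : Policy H 𝒮 ℬ) :
    G.dualityGap s₁ θ μ ν = 0 := by
  rw [dualityGap, valueVsBestMax, valueVsBestMin, ciSup_subsingleton ν, ciInf_subsingleton μ,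
    sub_self]

end VMG

namespace VIZero

variable {d H : ℕ} {𝒮 𝒜 ℬ : Type*} [Fintype 𝒮] [Fintype 𝒜] [Fintype ℬ] [Nonempty 𝒜] [Nonempty ℬ]

theorem plan_nonempty {K : ℕ} (hK : 0 < K) (β : ℕ → ℝ) (s₁ : 𝒮)
    (sel : ℕ → Fin H → 𝒮 → (𝒜 × ℬ → ℝ) → 𝒜 × ℬ) (D : Fin K → Episode H 𝒮 𝒜 ℬ)
    {r : Fin K → Fin H → EuclideanSpace ℝ (Fin d)} (hr : ∀ i h, ‖r i h‖ ≤ 1)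
    (θ : EuclideanSpace ℝ (Fin d)) : ((algorithm K β s₁ sel).plan D r θ).Nonempty := by
  have : Nonempty (Fin K) := ⟨⟨0, hK⟩⟩
  have : Nonempty 𝒮 := ⟨s₁⟩
  obtain ⟨k, hk⟩ := Finite.exists_min
    fun k : Fin K => vTilde β (fun i : Fin k => D (Fin.castLE k.isLt.le i)) 0 s₁
  obtain ⟨Ghat, hG⟩ := exists_isEmpiricalGame (fun i : Fin k => D (Fin.castLE k.isLt.le i))
    (r := fun i : Fin k => r (Fin.castLE k.isLt.le i)) fun i h => hr _ h
  obtain ⟨μ, ν, h⟩ := Ghat.exists_isNashVIOutput θ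
  exact ⟨(μ, ν), k, hk, Ghat, hG, Or.inl h⟩

end VIZero

namespace ExplorationRun

variable {K d H : ℕ} {𝒮 𝒜 ℬ : Type*} [Fintype 𝒮] [Fintype 𝒜] [Fintype ℬ] [Nonempty 𝒜] [Nonempty ℬ]
  {β : ℕ → ℝ} {s₁ : 𝒮} {sel : ℕ → Fin H → 𝒮 → (𝒜 × ℬ → ℝ) → 𝒜 × ℬ}
  {G : VMG d H 𝒮 𝒜 ℬ} {Ω : Type*} [MeasurableSpace Ω] {P : Measure Ω} [IsProbabilityMeasure P]
  {R : ExplorationRun (VIZero.algorithm K β s₁ sel) G s₁ P}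

/-- On the good event, the planning phase succeeds if the uncertainties `Ṽ` are small on average. -/
theorem Good.dualityGap_le {S : ℕ} {L L' ε : ℝ} {ω : Ω}
    {W : (k : ℕ) → (Fin k → Episode H 𝒮 𝒜 ℬ) → Fin H → 𝒮 → ℝ}
    (hg : R.Good (gridFamily G (d * K)) S L L' W ω)
    (hL : 0 < L) (hL' : 0 < L') (hd : 0 < d) (hS : Fintype.card 𝒮 ≤ S) (hS0 : 0 < S) (hK : 0 < K)
    (hβ0 : ∀ t, 0 ≤ β t)
    (hβ : ∀ n : ℕ, n ≠ 0 → n < K → 3 * √(L / n) + min (8 * H * √(L' / n) + 2 * H / K)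
      (2 * H * √(S * L / n)) + S * (4 * H * L / n) * (2 * H) ≤ β n)
    (hsum : 18 * ∑ k : Fin K, VIZero.vTilde β (R.past k k.isLt.le ω) 0 s₁ ≤ K * ε)
    {θ : EuclideanSpace ℝ (Fin d)} (hθ : ‖θ‖ ≤ 1) {μ : Policy H 𝒮 𝒜} {ν : Policy H 𝒮 ℬ}
    (hπ : (μ, ν) ∈ (VIZero.algorithm K β s₁ sel).plan (fun k => R.episode k ω)
      (fun k h => R.ret k h ω) θ) :
    G.dualityGap s₁ θ μ ν ≤ ε := by
  obtain ⟨k, hk, Ghat, hG, hN⟩ := hπ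
  have hN' : Ghat.IsNashVIOutput θ μ ν := hN.elim id fun h => h.isNashVIOutput
  refine (VMG.dualityGap_le_of_isNashVIOutput hN' hθ
    (hg.isErrorBound hL hL' hd hS hS0 hθ hβ hG)
    fun h s => (VIZero.vTilde_mem_Icc _ hβ0 h s).1).trans ?_
  have hmin : K * VIZero.vTilde β (R.past k k.isLt.le ω) 0 s₁ ≤
      ∑ j : Fin K, VIZero.vTilde β (R.past j j.isLt.le ω) 0 s₁ := by
    calc _ = ∑ _j : Fin K, VIZero.vTilde β (R.past k k.isLt.le ω) 0 s₁ := by simp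
      _ ≤ _ := Finset.sum_le_sum fun j _ => hk j
  have hK' : (0 : ℝ) < K := by exact_mod_cast hK
  refine le_of_mul_le_mul_left ?_ hK'
  linarith

end ExplorationRun

namespace VIZero

theorem bonus_nonneg {c : ℝ} (hc : 0 ≤ c) {d H S A B K : ℕ} {δ : ℝ}
    (hι : 0 ≤ Real.log (d * S * A * B * K * H / δ)) (t : ℕ) : 0 ≤ bonus c d H S A B K δ t := by
  unfold bonus
  positivity

theorem bonus_le {c : ℝ} {d H S A B K : ℕ} {δ : ℝ}
    (hι : 0 ≤ Real.log (d * S * A * B * K * H / δ)) (t : ℕ) :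
    bonus c d H S A B K δ t ≤
      c * √(min (d : ℝ) S * H ^ 2 * Real.log (d * S * A * B * K * H / δ)) / √t +
      c * (H ^ 2 * S * Real.log (d * S * A * B * K * H / δ)) / t := by
  unfold bonus
  rw [Real.sqrt_div (by positivity)]
  apply le_of_eq
  ring

theorem rate_pos {d H S A B : ℕ} {ε δ : ℝ} (hd : 1 ≤ d) (hH : 1 ≤ H) (hS : 1 ≤ S) (hA : 1 ≤ A)
    (hB : 1 ≤ B) (hε : 0 < ε) (hlog : 0 < logFactor d H S A B ε δ) : 0 < rate d H S A B ε δ := by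
  have hd' : (0 : ℝ) < d := by exact_mod_cast hd
  have hH' : (0 : ℝ) < H := by exact_mod_cast hH
  have hS' : (0 : ℝ) < S := by exact_mod_cast hS
  have hA' : (0 : ℝ) < A := by exact_mod_cast hA
  have hB' : (0 : ℝ) < B := by exact_mod_cast hB
  have hm : 0 < min (d : ℝ) S := lt_min hd' hS'
  unfold rate
  positivity

/-- The coefficients of the rate are polynomial in the argument of the logarithm, so the logarithm
of the rate is a multiple of `logFactor`; this is what `rate_log_le` needs. -/
theorem coeff_le {d H S A B : ℕ} {ε δ : ℝ} (hd : 1 ≤ d) (hH : 1 ≤ H) (hS : 1 ≤ S) (hA : 1 ≤ A)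
    (hB : 1 ≤ B) (hε : 0 < ε) (hδ : 0 < δ) (hδ1 : δ ≤ 1) :
    min (d : ℝ) S * H ^ 4 * S * A * B / ε ^ 2 ≤ (d * S * A * B * H / (min ε 1 * δ)) ^ 4 ∧
      H ^ 3 * S ^ 2 * A * B / ε ≤ ((d * S * A * B * H / (min ε 1 * δ)) ^ 4 : ℝ) := by
  have hd' : (1 : ℝ) ≤ d := by exact_mod_cast hd
  have hH' : (1 : ℝ) ≤ H := by exact_mod_cast hH
  have hS' : (1 : ℝ) ≤ S := by exact_mod_cast hS
  have hA' : (1 : ℝ) ≤ A := by exact_mod_cast hA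
  have hB' : (1 : ℝ) ≤ B := by exact_mod_cast hB
  have he0 : 0 < min ε 1 * δ := mul_pos (lt_min hε one_pos) hδ
  have he1 : min ε 1 * δ ≤ 1 := mul_le_one₀ (min_le_right _ _) hδ.le hδ1
  have heε : min ε 1 * δ ≤ ε := (mul_le_of_le_one_right (lt_min hε one_pos).le hδ1).trans
    (min_le_left _ _)
  set e := min ε 1 * δ
  have h4 : ∀ x : ℝ, 1 ≤ x → x ≤ x ^ 4 := fun x hx => le_self_pow₀ hx (by norm_num)
  rw [div_pow]
  constructor
  · refine div_le_div₀ (by positivity) ?_ (by positivity) ?_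
    · calc min (d : ℝ) S * H ^ 4 * S * A * B ≤ (d : ℝ) ^ 4 * H ^ 4 * S ^ 4 * A ^ 4 * B ^ 4 := by
            gcongr
            · exact (min_le_left _ _).trans (h4 _ hd')
            · exact h4 _ hS'
            · exact h4 _ hA'
            · exact h4 _ hB'
        _ = _ := by ring
    · calc e ^ 4 ≤ e ^ 2 := pow_le_pow_of_le_one he0.le he1 (by norm_num)
        _ ≤ ε ^ 2 := by gcongr
  · refine div_le_div₀ (by positivity) ?_ (by positivity) ?_
    · calc (H : ℝ) ^ 3 * S ^ 2 * A * B ≤ H ^ 4 * S ^ 4 * A ^ 4 * B ^ 4 := by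
            gcongr
            any_goals norm_num
            · exact h4 _ hA'
            · exact h4 _ hB'
        _ ≤ (d : ℝ) ^ 4 * (H ^ 4 * S ^ 4 * A ^ 4 * B ^ 4) :=
          le_mul_of_one_le_left (by positivity) (one_le_pow₀ hd')
        _ = _ := by ring
    · exact (pow_le_of_le_one he0.le he1 (by norm_num)).trans heε

theorem succeeds_of_rate_le {d H S A B K : ℕ} {ε δ : ℝ} (hd : 1 ≤ d) (hS : 1 ≤ S) (hA : 1 ≤ A)
    (hB : 1 ≤ B) (hε : 0 < ε) (hεH : ε ≤ H) (hδ : 0 < δ) (hδ1 : δ ≤ 1)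
    (hrate : 2 ^ 42 * rate d H S A B ε δ ≤ K) :
    Succeeds.{u, v, w, z} 100 d H S A B K ε δ := by
  classical
  intro 𝒮 𝒜 ℬ _ _ _ _ _ h𝒮 h𝒜 hℬ s₁ sel hsel G Ω _ P _ R
  -- For `δ = 1` nothing is claimed. This removes the case of a vanishing logarithm, in which `K =
  -- 0` would be allowed.
  rcases hδ1.eq_or_lt with rfl | hδ1'
  · simpa using prob_le_one
  have hH : 1 ≤ H := by
    by_contra h
    have : H = 0 := by omega
    subst this
    simp at hεH
    linarith
  have hp : (1 : ℝ) ≤ (d * S * A * B * H : ℕ) := by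
    exact_mod_cast Nat.one_le_iff_ne_zero.2 (by positivity)
  have he0 : 0 < min ε 1 * δ := mul_pos (lt_min hε one_pos) hδ
  have heδ : min ε 1 * δ ≤ δ := mul_le_of_le_one_left hδ.le (min_le_right _ _)
  have hZ : (d * S * A * B * H : ℝ) ≤ d * S * A * B * H / (min ε 1 * δ) :=
    le_div_self (by positivity) he0 (by linarith)
  have hlog : 0 < logFactor d H S A B ε δ := by
    apply Real.log_pos
    rw [lt_div_iff₀ he0, one_mul]
    push_cast at hp
    linarith
  have hK : 0 < K := by
    have : (0 : ℝ) < K :=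
      lt_of_lt_of_le (mul_pos (by norm_num) (rate_pos hd hH hS hA hB hε hlog)) hrate
    exact_mod_cast this
  -- With one action for each player the gap is zero. Otherwise `A B ≥ 2` keeps the logarithms above
  -- `log 2 > 2/3`, as the numerical lemmas require.
  by_cases hAB : A = 1 ∧ B = 1
  · obtain ⟨rfl, rfl⟩ := hAB
    have : Subsingleton 𝒜 := Fintype.card_le_one_iff_subsingleton.1 h𝒜
    have : Subsingleton ℬ := Fintype.card_le_one_iff_subsingleton.1 hℬ
    have h0 : P {ω | ¬ ∀ k h, ‖R.ret k h ω‖ ≤ 1} = 0 :=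
      ae_iff.1 (ae_all_iff.2 fun k => ae_all_iff.2 fun h => R.norm_ret_le k h)
    refine (measure_mono fun ω hω => ?_).trans (h0.trans_le zero_le)
    refine fun hr => hω fun θ _ => ⟨plan_nonempty hK _ _ _ _ hr θ, fun μ ν _ => ?_⟩
    rw [VMG.dualityGap_eq_zero]
    exact hε.le
  have hAB2 : 2 ≤ A * B := by
    rcases Nat.lt_or_ge 1 A with h | h
    · exact Nat.mul_le_mul h hB
    · have : 1 < B := by omega
      exact Nat.mul_le_mul hA this
  set X : ℝ := d * S * A * B * K * H / δ with hX
  have hXnat : ∀ n : ℕ, n ≤ d * S * A * B * K * H → (n : ℝ) ≤ X := by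
    intro n hn
    have h1 : (n : ℝ) ≤ d * S * A * B * K * H := by exact_mod_cast hn
    exact h1.trans (le_div_self (by positivity) hδ hδ1)
  have hX2 : 2 ≤ X := by
    refine hXnat 2 (hAB2.trans ?_)
    calc A * B = A * B * 1 := (mul_one _).symm
      _ ≤ A * B * (d * S * K * H) := Nat.mul_le_mul_left _ (Nat.one_le_iff_ne_zero.2 (by positivity))
      _ = _ := by ring
  have hKX : (K : ℝ) ≤ X := by
    refine hXnat K ?_
    calc K = K * 1 := (mul_one _).symm
      _ ≤ K * (d * S * A * B * H) := Nat.mul_le_mul_left _ (Nat.one_le_iff_ne_zero.2 (by positivity))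
      _ = _ := by ring
  have hι : 2 / 3 ≤ Real.log X := by
    have := Real.log_le_log (by norm_num) hX2
    linarith [Real.log_two_gt_d9]
  have hι0 : 0 ≤ Real.log X := by linarith
  have hd0 : (0 : ℝ) < d := by exact_mod_cast hd
  have hS1 : (1 : ℝ) ≤ S := by exact_mod_cast hS
  have hH1 : (1 : ℝ) ≤ H := by exact_mod_cast hH
  have hK0 : (0 : ℝ) < K := by exact_mod_cast hK
  have hL : 0 < 10 * Real.log X := by linarith
  have hL' : 0 < 10 * (d * Real.log X) := by
    have : 0 < Real.log X := by linarith
    positivity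
  have hβ0 : ∀ t, 0 ≤ bonus 100 d H S A B K δ t := bonus_nonneg (by norm_num) hι0
  have hM : (Fintype.card (𝒮 × 𝒜 × ℬ) : ℝ) ≤ (S * A * B : ℝ) := by
    rw [Fintype.card_prod, Fintype.card_prod]
    have : Fintype.card 𝒮 * (Fintype.card 𝒜 * Fintype.card ℬ) ≤ S * A * B := by
      rw [mul_assoc]; gcongr
    exact_mod_cast this
  have hnum : 18 * (8 * H * ((S * A * B) * (H + 2 * (100 * (H ^ 2 * S * Real.log X)) *
      (1 + Real.log K)) + 4 * (100 * √(min (d : ℝ) S * H ^ 2 * Real.log X)) * √((S * A * B) * K) +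
      8 * H ^ 2 * (10 * Real.log X))) ≤ (K * ε : ℝ) := by
    have hZ2 : (2 : ℝ) ≤ d * S * A * B * H / (min ε 1 * δ) := by
      refine le_trans ?_ hZ
      have : 2 ≤ d * S * A * B * H := by
        calc 2 ≤ A * B * 1 := by rwa [mul_one]
          _ ≤ A * B * (d * S * H) :=
            Nat.mul_le_mul_left _ (Nat.one_le_iff_ne_zero.2 (by positivity))
          _ = _ := by ring
      exact_mod_cast this
    have hm : 0 < min (d : ℝ) S := lt_min hd0 (by linarith)
    -- Replacing `δ` by the smaller `min ε 1 * δ` only increases the argument.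
    have hιZ : Real.log X ≤ Real.log (d * S * A * B * H / (min ε 1 * δ)) + Real.log K := by
      rw [← Real.log_mul (by positivity) hK0.ne']
      refine Real.log_le_log (by linarith) ?_
      rw [hX, show (d * S * A * B * H / (min ε 1 * δ) * K : ℝ) =
        d * S * A * B * K * H / (min ε 1 * δ) by ring]
      gcongr
    obtain ⟨hc1, hc2⟩ := coeff_le hd hH hS hA hB hε hδ hδ1
    obtain ⟨h1, h2⟩ := rate_log_le (K := K) hZ2 (by positivity) (by positivity) hc1 hc2
      (le_trans (le_of_eq (by unfold rate logFactor; ring)) hrate) hι0 hιZ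
    refine exploration_bound_le hm.le hH1 hS1 ?_ hι hK0 hε (Real.log_le_log hK0 hKX) ?_ ?_
    · have : 1 ≤ S * A * B := Nat.one_le_iff_ne_zero.2 (by positivity)
      exact_mod_cast this
    · have e : min (d : ℝ) S * H ^ 4 * S * A * B / ε ^ 2 * Real.log X * ε ^ 2 =
          min (d : ℝ) S * H ^ 4 * (S * A * B) * Real.log X := by field_simp
      rw [← e, ← mul_assoc]
      gcongr
      linarith
    · have e : H ^ 3 * S ^ 2 * A * B / ε * Real.log X ^ 2 * ε =
          (H ^ 3 * S * (S * A * B) * Real.log X ^ 2 : ℝ) := by field_simp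
      rw [← e, ← mul_assoc]
      gcongr
      linarith
  refine (measure_mono fun ω hω => ?_).trans ((R.measure_not_good_le
    (ExplorationRun.gridFamily_mem_Icc G (d * K)) (S := S) hS hL hL'
    (ExplorationRun.scaledUncertainty_mem_Icc hβ0)).trans (ENNReal.ofReal_le_ofReal ?_))
  · intro hg
    refine hω fun θ hθ => ⟨plan_nonempty hK _ _ _ _ hg.norm_ret_le θ, fun μ ν hπ => ?_⟩
    refine hg.dualityGap_le hL hL' hd h𝒮 hS hK hβ0 (fun n hn hnK => ?_) ?_ hθ hπ
    · exact estimation_error_le hd hH hS hι hn hnK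
    · refine le_trans ?_ hnum
      have := hg.sum_vTilde_le hsel hL h𝒮 hβ0 (fun n hn hnK => ?_) (by positivity) (by positivity)
        (fun n _ => bonus_le hι0 n) hM
      · linarith
      · unfold bonus
        have h1 : 0 ≤ √(min (d : ℝ) S * H ^ 2 * Real.log X / n) := Real.sqrt_nonneg _
        have h2 : (0 : ℝ) ≤ H ^ 2 * S * Real.log X / n := by positivity
        have h3 : S * (2 * H * (10 * Real.log X) / n) * H =
          20 * (H ^ 2 * S * Real.log X / n : ℝ) := by ring
        rw [h3]
        linarith
  · have hprod : Fintype.card 𝒮 * Fintype.card 𝒜 * Fintype.card ℬ ≤ S * A * B := by gcongr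
    refine union_bound_le hd hX2 ?_ (by positivity) ?_ ?_ ?_ (by positivity) ?_ hKX
    · rw [hX, one_div_div]
      refine div_le_self hδ.le ?_
      have : 1 ≤ d * S * A * B * K * H := Nat.one_le_iff_ne_zero.2 (by positivity)
      exact_mod_cast this
    · have := hXnat (K * H * (Fintype.card 𝒮 * Fintype.card 𝒜 * Fintype.card ℬ)) (by
        calc _ ≤ K * H * (S * A * B) * 1 := by rw [mul_one]; gcongr
          _ ≤ K * H * (S * A * B) * d := by gcongr
          _ = _ := by ring)
      exact_mod_cast this
    · have h1 : Fintype.card 𝒮 + Fintype.card 𝒮 * K + K ≤ 3 * (S * K) := by nlinarith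
      have h2 := hXnat (S * K) (by
        calc S * K = S * K * 1 := (mul_one _).symm
          _ ≤ S * K * (d * A * B * H) :=
            Nat.mul_le_mul_left _ (Nat.one_le_iff_ne_zero.2 (by positivity))
          _ = _ := by ring)
      have h3 : (Fintype.card 𝒮 + Fintype.card 𝒮 * K + K : ℝ) ≤ 3 * (S * K : ℕ) := by
        exact_mod_cast h1
      linarith
    · refine hXnat H ?_
      calc H = H * 1 := (mul_one _).symm
        _ ≤ H * (d * S * A * B * K) :=
          Nat.mul_le_mul_left _ (Nat.one_le_iff_ne_zero.2 (by positivity))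
        _ = _ := by ring
    · have h1 := hXnat (d * K) (by
        calc d * K = d * K * 1 := (mul_one _).symm
          _ ≤ d * K * (S * A * B * H) :=
            Nat.mul_le_mul_left _ (Nat.one_le_iff_ne_zero.2 (by positivity))
          _ = _ := by ring)
      have h2 := Fintype.card_subtype_le
        fun j : Fin d → Fin (2 * (d * K) + 1) => ‖gridPoint (d * K) j‖ ≤ 2
      rw [Fintype.card_fun, Fintype.card_fin, Fintype.card_fin] at h2
      have h3 : 2 * (d * K) + 1 ≤ 3 * (d * K) := by nlinarith
      have h4 : ((2 * (d * K) + 1 : ℕ) : ℝ) ≤ 3 * X := by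
        have : ((2 * (d * K) + 1 : ℕ) : ℝ) ≤ 3 * (d * K : ℕ) := by exact_mod_cast h3
        linarith
      calc _ ≤ (((2 * (d * K) + 1) ^ d : ℕ) : ℝ) := Nat.cast_le.2 h2
        _ = ((2 * (d * K) + 1 : ℕ) : ℝ) ^ d := by push_cast; rfl
        _ ≤ _ := pow_le_pow_left₀ (by positivity) h4 d

end VIZero

theorem mainTheorem6 :
    ∃ cβ cK : ℝ, 0 < cβ ∧ 0 < cK ∧
      ∀ (d H S A B : ℕ) (ε δ : ℝ), 1 ≤ d → 1 ≤ S → 1 ≤ A → 1 ≤ B →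
        0 < ε → ε ≤ H → 0 < δ → δ ≤ 1 →
        (∀ K : ℕ, cK * VIZero.rate d H S A B ε δ ≤ K →
          VIZero.Succeeds.{u, v, w, z} cβ d H S A B K ε δ) ∧
        ∃ mRFE : ℕ, mRFE ≤ ⌈cK * VIZero.rate d H S A B ε δ⌉₊ ∧
          VIZero.Succeeds.{u, v, w, z} cβ d H S A B mRFE ε δ := by
  refine ⟨100, 2 ^ 42, by norm_num, by positivity, ?_⟩
  intro d H S A B ε δ hd hS hA hB hε hεH hδ hδ1
  have key : ∀ K : ℕ, 2 ^ 42 * VIZero.rate d H S A B ε δ ≤ K →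
      VIZero.Succeeds.{u, v, w, z} 100 d H S A B K ε δ := fun K hK =>
    VIZero.succeeds_of_rate_le hd hS hA hB hε hεH hδ hδ1 hK
  -- The number of episodes is the ceiling itself.
  exact ⟨key, _, le_rfl, key _ (Nat.le_ceil _)⟩
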